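/- Conventions. For a finite alphabet $A$, a subshift $X\subseteq A^{\mathbb Z}$ is a closed set invariant under the shift $\sigma$, $\sigma(x)[i]=x[i+1]$; $L(X)$ is the set of finite words occurring in points of $X$. $X$ is transitive if for all $u,v\in L(X)$ there is $w\in L(X)$ with $uwv\in L(X)$, and sofic if $L(X)$ is a regular language. A word $w\in L(X)$ is synchronizing if $uw,wv\in L(X)$ with $u,v\in L(X)$ implies $uwv\in L(X)$. A word $w=w_1\cdots w_n\in L(X)$ is deterministic if its letters are distinct, every $w_i$ with $i<n$ has a unique successor ($w_ia\in L(X)$ for exactly one letter $a$) and every $w_j$ with $j>1$ has a unique predecessor ($aw_j\in L(X)$ for exactly one letter $a$). A morphism between subshifts is a map given by a local rule on a finite window; a conjugacy is a bijective morphism, and a reversible cellular automaton (CA) on $X$ is a bijective morphism $X\to X$. For a nonempty word $w$, $w^{\mathbb Z}$ is the bi-infinite repetition of $w$ with $w^{\mathbb Z}[0,|w|-1]=w$, while ${}^\infty w$ and $w^\infty$ are the left- and right-infinite repetitions. A point $x$ is $w$-finite if $x[-\infty,i]={}^\infty w$ and $x[j,\infty]=w^\infty$ for some $i,j\in\mathbb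 Z$. For a language $L$, ${}^\infty w\,L\,w^\infty$ is the set of configurations consisting of ${}^\infty w$, then a word of $L$, then $w^\infty$, with the origin at any position. Theorem. Let $Y$ be an infinite transitive sofic subshift over a finite alphabet, and let $\mathbf 0_Y$ be a nonempty word such that $\mathbf 0_Y^{\mathbb Z}\in Y$, the minimal period of $\mathbf 0_Y^{\mathbb Z}$ is $|\mathbf 0_Y|$, and some subword of $\mathbf 0_Y^{\mathbb Z}$ is a synchronizing word of $Y$. Then there are a subshift $X$ over a finite alphabet $B$, a word $\mathbf 0$ over $B$ with $|\mathbf 0|=|\mathbf 0_Y|$ and a conjugacy $\psi:Y\to X$ such that $\psi(\mathbf 0_Y^{\mathbb Z})=\mathbf 0^{\mathbb Z}\in X$ and $\mathbf 0$ is synchronizing and deterministic in $X$; and there is a reversible CA $G_X:X\to X$ such that there are - words $g_\ell,g_r\in L(X)$ (left- and rightbound gliders), - languages $L_\ell=(g_\ell\mathbf 0\mathbf 0^*)^*\subseteq L(X)$ and $L_r=(\mathbf 0^*\mathbf 0 g_r)^*\subseteq L(X)$, - glider fleet sets $\mathrm{GF}_\ell={}^\infty\mathbf 0L_\ell\mathbf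 0^\infty\subseteq X$ and $\mathrm{GF}_r={}^\infty\mathbf 0L_r\mathbf 0^\infty\subseteq X$, in each element of which there are only finitely many occurrences of $g_\ell$ and of $g_r$, and an integer $s\ge 1$ which is a multiple of $|\mathbf 0|$, satisfying: - $G_X(x)=\sigma^s(x)$ for $x\in\mathrm{GF}_\ell$ and $G_X(x)=\sigma^{-s}(x)$ for $x\in\mathrm{GF}_r$; - if $x\in X$ is $\mathbf 0$-finite, then for every $N\in\mathbb N$ there exist $t,N_\ell,N_r,M\in\mathbb N$ with $N_\ell,N_r\ge N$ such that $G_X^t(x)[-N_\ell,N_r]=\mathbf 0^M$, $G_X^t(x)[-\infty,-(N_\ell+1)]\in{}^\infty\mathbf 0L_\ell$ and $G_X^t(x)[N_r+1,\infty]\in L_r\mathbf 0^\infty$. -/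

import Mathlib

open SymbolicDynamics.FullShift (shift Subshift)
open scoped Computability

namespace SymDyn

variable {A : Type*}

/-- The word `x[i,j] = x[i] x[i+1] ... x[j]`, which is empty if `j < i`. -/
def block (x : ℤ → A) (i j : ℤ) : List A :=
  (List.range (j + 1 - i).toNat).map fun k => x (i + k)

/-- The language of a set of configurations: all words occurring in its elements. -/
def lang (S : Set (ℤ → A)) : Language A :=
  {w | ∃ x ∈ S, ∃ i j : ℤ, block x i j = w}

/-- The set of positions at which the word `w` occurs in `x`. -/
def occ (x : ℤ → A) (w : List A) : Set ℤ :=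
  {i | block x i (i + w.length - 1) = w}

/-- The periodic configuration `w^ℤ` with `w^ℤ[in, (i+1)n-1] = w` for all `i`, `n = |w|`. -/
def perConf (w : List A) (hw : w ≠ []) : ℤ → A := fun i =>
  w[(i % (w.length : ℤ)).toNat]'(by
    have hpos : 0 < (w.length : ℤ) := by exact_mod_cast List.length_pos_iff.mpr hw
    have h1 := Int.emod_nonneg i hpos.ne'
    have h2 := Int.emod_lt_of_pos i hpos
    omega)

/-- `x[-∞,i] = ^∞w`. -/
def LeftRep (w : List A) (hw : w ≠ []) (x : ℤ → A) (i : ℤ) : Prop :=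
  ∀ k ≤ i, x k = perConf w hw (k - i - 1)

/-- `x[j,∞] = w^∞`. -/
def RightRep (w : List A) (hw : w ≠ []) (x : ℤ → A) (j : ℤ) : Prop :=
  ∀ k ≥ j, x k = perConf w hw (k - j)

/-- `x` is `w`-finite: `x[-∞,i] = ^∞w` and `x[j,∞] = w^∞` for some `i`, `j`. -/
def IsFiniteConf (w : List A) (hw : w ≠ []) (x : ℤ → A) : Prop :=
  ∃ i j : ℤ, LeftRep w hw x i ∧ RightRep w hw x j

/-- `x[-∞,i] ∈ ^∞w L`. -/
def LeftRepLang (w : List A) (hw : w ≠ []) (L : Language A) (x : ℤ → A) (i : ℤ) : Prop :=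
  ∃ j ≤ i + 1, LeftRep w hw x (j - 1) ∧ block x j i ∈ L

/-- `x[i,∞] ∈ L w^∞`. -/
def RightLangRep (w : List A) (hw : w ≠ []) (L : Language A) (x : ℤ → A) (i : ℤ) : Prop :=
  ∃ j ≥ i, block x i (j - 1) ∈ L ∧ RightRep w hw x j

/-- The set `^∞w L w^∞` of configurations (the position of the origin is arbitrary). -/
def fleetSet (w : List A) (hw : w ≠ []) (L : Language A) : Set (ℤ → A) :=
  {x | ∃ i j : ℤ, i ≤ j ∧ LeftRep w hw x (i - 1) ∧ block x i (j - 1) ∈ L ∧ RightRep w hw x j}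

/-- The language `(g z z^*)^*`. -/
def leftGliderLang (z g : List A) : Language A :=
  (({g} : Language A) * {z} * ({z} : Language A)∗)∗

/-- The language `(z^* z g)^*`. -/
def rightGliderLang (z g : List A) : Language A :=
  (({z} : Language A)∗ * {z} * {g})∗

section Subshifts

variable [TopologicalSpace A]

def IsTransitive (X : Subshift A ℤ) : Prop :=
  ∀ u ∈ lang X.carrier, ∀ v ∈ lang X.carrier,
    ∃ w ∈ lang X.carrier, u ++ w ++ v ∈ lang X.carrier

def IsSofic (X : Subshift A ℤ) : Prop :=
  (lang X.carrier).IsRegular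

/-- `w` is a synchronizing word of `X`. -/
def IsSynchronizing (X : Subshift A ℤ) (w : List A) : Prop :=
  w ∈ lang X.carrier ∧ ∀ u ∈ lang X.carrier, ∀ v ∈ lang X.carrier,
    u ++ w ∈ lang X.carrier → w ++ v ∈ lang X.carrier → u ++ w ++ v ∈ lang X.carrier

def HasUniqueSuccessor (X : Subshift A ℤ) (w : List A) : Prop :=
  ∃! a : A, w ++ [a] ∈ lang X.carrier

def HasUniquePredecessor (X : Subshift A ℤ) (w : List A) : Prop :=
  ∃! a : A, a :: w ∈ lang X.carrier

/-- `w ∈ L(X)` has distinct letters, all of which, except possibly the last one, have unique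
successors. -/
def IsFutureDeterministic (X : Subshift A ℤ) (w : List A) : Prop :=
  w ∈ lang X.carrier ∧ w.Nodup ∧
    ∀ (i : ℕ) (h : i + 1 < w.length), HasUniqueSuccessor X [w[i]]

/-- `w ∈ L(X)` has distinct letters, all of which, except possibly the first one, have unique
predecessors. -/
def IsPastDeterministic (X : Subshift A ℤ) (w : List A) : Prop :=
  w ∈ lang X.carrier ∧ w.Nodup ∧
    ∀ (i : ℕ) (h : i + 1 < w.length), HasUniquePredecessor X [w[i + 1]]

def IsDeterministic (X : Subshift A ℤ) (w : List A) : Prop :=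
  IsFutureDeterministic X w ∧ IsPastDeterministic X w

/-- `F` is a morphism of subshifts: it is given by a local rule `f` with memory `m` and
anticipation `a`. -/
def IsMorphism {B : Type*} [TopologicalSpace B] {X : Subshift A ℤ} {Y : Subshift B ℤ}
    (F : X.carrier → Y.carrier) : Prop :=
  ∃ m a : ℤ, m ≤ a ∧ ∃ f : (Set.Icc m a → A) → B,
    ∀ (x : X.carrier) (i : ℤ), (F x).1 i = f fun k => x.1 (i + k)

/-- A conjugacy is a bijective morphism. -/
def IsConjugacy {B : Type*} [TopologicalSpace B] {X : Subshift A ℤ} {Y : Subshift B ℤ}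
    (F : X.carrier → Y.carrier) : Prop :=
  IsMorphism F ∧ Function.Bijective F

/-- A reversible cellular automaton on `X` is a bijective morphism from `X` to itself. -/
def IsReversibleCA {X : Subshift A ℤ} (G : X.carrier → X.carrier) : Prop :=
  IsMorphism G ∧ Function.Bijective G

end Subshifts

end SymDyn

open SymDyn

/-! Recoding. Letters of `Y` deep inside long stretches of the periodic point are replaced by `p`
fresh letters, numbered modulo `p` and called zeros below. Blocks deep inside such stretches cannot
overlap, so the word 0 of all fresh letters in order is deterministic; it is synchronizing because
its presence certifies a synchronizing word of `Y` (`PerSys.toZeroSys`). Determinism makes the phase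
of a run of zeros rigid (`run`, `align_left`, `align_right`), and synchronization allows the
contents between two runs of zeros to be exchanged freely (`glue_mem`, `replace_mem`).

Gliders. Take two distinct kernels P and Q of equal length. The involution `I1` exchanges P and Q
inside wide zero contexts, and `I2` exchanges 0P and Q0. Under `I2` after `I1` an isolated Q becomes
P and then Q one period further left, while an isolated P travels right (`LF.step`, `RF.step`).

Emission. Two further reversible rules act beforehand by cyclically permuting words in windows of
length `m`. Rule `C` permutes words with equal follower sets, of which soficity leaves finitely
many, and serves where no long run of zeros follows soon. Rule `D` permutes words enclosed by long
runs of zeros. Each nonempty cycle contains an emitting word: it begins with Q for `C`, and it is a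
train of Qs closed by one P for `D`. Words beginning with a free kernel are left out of the cycles
unless they emit, so gliders are not disturbed. For `D` the train must have the right length modulo
`p`; the kernel length is therefore chosen to generate the group of all lengths modulo `p`
(`exists_kernels`), and the number of kernels adjusts the length (`exists_eD`).

Convergence. The head is the first nonzero letter behind the leftbound fleet. As the fleet recedes,
the gap in front of the head grows until the head either moves as a kernel or has its word cycled to
an emitting one. In both regimes a level built from the head and the next long run of zeros strictly
increases (`up_long`, `up_short`, `progress`). Right of the original support only rightbound gliders
ever appear (`RF.iterate`), so once the head has passed that point the configuration is sorted
(`exists_sorted`). The two fleets then separate at speed `p`, which leaves an arbitrarily wide block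
of zeros (`decompose`). -/

namespace GliderCA

/-! ### Gluing, phases of runs of zeros, and synchronization. -/

section gluing

variable {B : Type*}

/-- The configuration equal to `x` to the left of `c` and to `y` from `c` on. -/
def glue (x y : ℤ → B) (c : ℤ) : ℤ → B := fun k => if k < c then x k else y k

/-- The configuration `x` translated by `c`. -/
def shf (x : ℤ → B) (c : ℤ) : ℤ → B := fun k => x (k + c)

@[simp] lemma shf_apply (x : ℤ → B) (c k : ℤ) : shf x c k = x (k + c) := rfl

lemma shf_shf (x : ℤ → B) (c d : ℤ) : shf (shf x c) d = shf x (c + d) := by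
  funext k; simp only [shf_apply]; congr 1; ring

lemma glue_lt {x y : ℤ → B} {c k : ℤ} (h : k < c) : glue x y c k = x k := if_pos h

lemma glue_ge {x y : ℤ → B} {c k : ℤ} (h : c ≤ k) : glue x y c k = y k := if_neg (not_lt.mpr h)

/-- The right-infinite continuations of the left half of `x`. -/
def Fol (X : Set (ℤ → B)) (x : ℤ → B) : Set (ℤ → B) := {y | glue x y 0 ∈ X}

end gluing

variable {B : Type}

/-- A subshift with a distinguished periodic point `z` whose repeated word of length `p` is
synchronizing and deterministic. -/
structure ZeroSys (B : Type) where
  X : Set (ℤ → B)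
  p : ℕ
  z : ℤ → B
  hp : 0 < p
  shift_mem : ∀ x ∈ X, ∀ c, shf x c ∈ X
  closed : ∀ x : ℤ → B, (∀ N : ℕ, ∃ y ∈ X, ∀ k : ℤ, -N ≤ k → k ≤ N → y k = x k) → x ∈ X
  z_mem : z ∈ X
  z_eq : ∀ a b : ℤ, z a = z b ↔ (p : ℤ) ∣ a - b
  det_succ : ∀ x ∈ X, ∀ k a : ℤ, x k = z a → ¬ (p : ℤ) ∣ a + 1 → x (k + 1) = z (a + 1)
  det_pred : ∀ x ∈ X, ∀ k a : ℤ, x k = z a → ¬ (p : ℤ) ∣ a → x (k - 1) = z (a - 1)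
  sync : ∀ x ∈ X, ∀ y ∈ X, ∀ i : ℤ, (∀ k, i - p ≤ k → k < i → x k = z (k - i)) →
    (∀ k, i - p ≤ k → k < i → y k = z (k - i)) → glue x y i ∈ X
  fol_finite : (Fol X '' X).Finite
  exists_nonzero : ∃ x ∈ X, (∃ A, ∀ k < A, ∃ a, x k = z a) ∧ (∃ A, ∀ k ≥ A, ∃ a, x k = z a) ∧
    ∃ k, ∀ a, x k ≠ z a

namespace ZeroSys

variable (S : ZeroSys B)

/-- The letters of the repeated word. -/
def Z (b : B) : Prop := ∃ k, b = S.z k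

/-- All letters of `x` in `[a, b)` are letters of the repeated word. -/
def Zr (x : ℤ → B) (a b : ℤ) : Prop := ∀ k, a ≤ k → k < b → S.Z (x k)

variable {S}

lemma Zr.mono {x : ℤ → B} {a b c d : ℤ} (h : S.Zr x a b) (h1 : a ≤ c) (h2 : d ≤ b) :
    S.Zr x c d := fun k hk hk' => h k (by omega) (by omega)

lemma Zr.append {x : ℤ → B} {a b c : ℤ} (h : S.Zr x a b) (h1 : S.Zr x b c) : S.Zr x a c :=
  fun k hk hk' => (lt_or_ge k b).elim (fun h2 => h k hk h2) fun h2 => h1 k h2 hk'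

lemma Zr.congr {x y : ℤ → B} {a b : ℤ} (h : S.Zr x a b) (h1 : ∀ k, a ≤ k → k < b → y k = x k) :
    S.Zr y a b := fun k hk hk' => by rw [h1 k hk hk']; exact h k hk hk'

lemma Zr.shf_iff {x : ℤ → B} {a b c : ℤ} : S.Zr (shf x c) a b ↔ S.Zr x (a + c) (b + c) := by
  constructor
  · intro h k h1 h2
    have := h (k - c) (by omega) (by omega)
    simpa using this
  · intro h k h1 h2
    exact h (k + c) (by omega) (by omega)

lemma Z_z (a : ℤ) : S.Z (S.z a) := ⟨a, rfl⟩

lemma z_congr {a b : ℤ} (h : (S.p : ℤ) ∣ a - b) : S.z a = S.z b := (S.z_eq a b).2 h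

/-- Even where the successor is not forced, a zero of nonzero phase would force its predecessor and
contradict the phase already present. Hence phases advance by one throughout every run of zeros. -/
lemma next {x : ℤ → B} (hx : x ∈ S.X) {k a : ℤ} (h : x k = S.z a) (h1 : S.Z (x (k + 1))) :
    x (k + 1) = S.z (a + 1) := by
  by_cases hd : (S.p : ℤ) ∣ a + 1
  · obtain ⟨b, hb⟩ := h1
    rw [hb]
    apply z_congr
    by_contra hc
    have hb' : ¬ (S.p : ℤ) ∣ b := fun h2 => hc (dvd_sub h2 hd)
    have := S.det_pred x hx _ _ hb hb'
    rw [add_sub_cancel_right, h, S.z_eq] at this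
    apply hb'
    have h3 := dvd_sub hd this
    ring_nf at h3
    simpa using h3
  · exact S.det_succ x hx _ _ h hd

lemma run {x : ℤ → B} (hx : x ∈ S.X) {a b e : ℤ} (h : S.Zr x a b) (he : x a = S.z e) :
    ∀ k, a ≤ k → k < b → x k = S.z (e + k - a) := by
  intro k hk
  induction k, hk using Int.leInduction with
  | base => intro _; rw [he]; congr 1; ring
  | succ k hk ih =>
    intro hb
    rw [next hx (ih (by omega)) (h _ (by omega) hb)]
    congr 1; ring

/-- A zero of phase other than 0 forces a zero before it, so a run can follow a nonzero letter only
at phase 0; dually it can end before one only at phase -1. Any run touching a nonzero letter thus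
has a known phase, and a run between two nonzero letters has length divisible by `p`. -/
lemma pred_nonzero {x : ℤ → B} (hx : x ∈ S.X) {k e : ℤ} (h : x k = S.z e)
    (h1 : ¬ S.Z (x (k - 1))) : (S.p : ℤ) ∣ e := by
  by_contra hc
  exact h1 ⟨_, S.det_pred x hx _ _ h hc⟩

lemma succ_nonzero {x : ℤ → B} (hx : x ∈ S.X) {k e : ℤ} (h : x k = S.z e)
    (h1 : ¬ S.Z (x (k + 1))) : (S.p : ℤ) ∣ e + 1 := by
  by_contra hc
  exact h1 ⟨_, S.det_succ x hx _ _ h hc⟩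

lemma align_right {x : ℤ → B} (hx : x ∈ S.X) {a b : ℤ} (h : S.Zr x a b)
    (h1 : ¬ S.Z (x (a - 1))) : ∀ k, a ≤ k → k < b → x k = S.z (k - a) := by
  intro k hk hk'
  obtain ⟨e, he⟩ := h a le_rfl (by omega)
  rw [run hx h he k hk hk']
  apply z_congr
  have := pred_nonzero hx he h1
  ring_nf
  exact this

lemma align_left {x : ℤ → B} (hx : x ∈ S.X) {a b : ℤ} (h : S.Zr x a b)
    (h1 : ¬ S.Z (x b)) : ∀ k, a ≤ k → k < b → x k = S.z (k - b) := by
  intro k hk hk'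
  obtain ⟨e, he⟩ := h k hk hk'
  have h2 := run hx (h.mono hk le_rfl) he (b - 1) (by omega) (by omega)
  have := succ_nonzero hx h2 (by rwa [sub_add_cancel])
  rw [he]
  apply z_congr
  ring_nf at this ⊢
  exact this

/-- Any `2p` consecutive zeros contain a complete copy of the synchronizing word with the correct
phase. The gluing is made at the end of that copy; the agreement of `x` and `y` up to `c` makes this
the same as gluing at `c`. -/
lemma glue_mem {x y : ℤ → B} (hx : x ∈ S.X) (hy : y ∈ S.X) {c : ℤ}
    (h : S.Zr x (c - 2 * S.p) c) (h1 : ∀ k, c - 2 * S.p ≤ k → k < c → y k = x k) :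
    glue x y c ∈ S.X := by
  have hp : (0 : ℤ) < S.p := by exact_mod_cast S.hp
  obtain ⟨e, he⟩ := h (c - 2 * S.p) le_rfl (by omega)
  have hr := run hx h he
  have hm := Int.emod_nonneg e hp.ne'
  have hm' := Int.emod_lt_of_pos e hp
  -- The position `c - e % p` has phase 0, since `c - 2p` has phase `e`.
  have key : ∀ k, (c - e % S.p) - S.p ≤ k → k < c - e % S.p → x k = S.z (k - (c - e % S.p)) := by
    intro k h2 h3
    rw [hr k (by omega) (by omega)]
    apply z_congr
    have : (S.p : ℤ) ∣ e - e % S.p := Int.dvd_self_sub_emod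
    obtain ⟨d, hd⟩ := this
    exact ⟨d + 2, by linarith⟩
  have h4 := S.sync x hx y hy (c - e % S.p) key
    (fun k h2 h3 => by rw [h1 k (by omega) (by omega), key k h2 h3])
  convert h4 using 1
  funext k
  unfold glue
  split_ifs with h5 h6 h6
  · rfl
  · exact (h1 k (by omega) h5).symm
  · omega
  · rfl

/-- The windows are rewritten one at a time from left to right. Since they are `R` apart, the
surroundings of the next window still agree with `x` when its turn comes; closedness passes from
finitely many windows to all. -/
lemma mem_of_windows {x : ℤ → B} (hx : x ∈ S.X) (y : ℤ → B) (V : ℤ → Prop) {n R : ℤ}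
    (hn : 0 ≤ n) (hsp : ∀ s s', V s → V s' → s < s' → s + n + R ≤ s')
    (hout : ∀ k, (∀ s, V s → ¬ (s ≤ k ∧ k < s + n)) → y k = x k)
    (hstep : ∀ s, V s → ∀ y0 ∈ S.X, (∀ k, s - R ≤ k → k < s + n + R → y0 k = x k) →
      (fun k => if s ≤ k ∧ k < s + n then y k else y0 k) ∈ S.X) : y ∈ S.X := by
  classical
  have main : ∀ (L : ℤ) (j : ℕ),
      (fun k => if ∃ s, V s ∧ s ≤ k ∧ k < s + n ∧ L ≤ s ∧ s < L + j then y k else x k) ∈ S.X := by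
    intro L j
    induction j with
    | zero =>
      convert hx using 1
      funext k
      rw [if_neg]
      rintro ⟨s, -, -, -, h1, h2⟩
      simp at h2
      omega
    | succ j ih =>
      by_cases hV : V (L + j)
      · have := hstep (L + j) hV _ ih (by
          intro k h1 h2
          rw [if_neg]
          rintro ⟨s, hs, h3, h4, h5, h6⟩
          have := hsp s _ hs hV h6
          omega)
        convert this using 1
        funext k
        by_cases h1 : L + j ≤ k ∧ k < L + j + n
        · rw [if_pos h1, if_pos]
          exact ⟨L + j, hV, h1.1, h1.2, by omega, by push_cast; omega⟩
        · rw [if_neg h1]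
          congr 1
          apply propext
          constructor
          · rintro ⟨s, hs, h3, h4, h5, h6⟩
            refine ⟨s, hs, h3, h4, h5, ?_⟩
            by_contra h7
            have : s = L + j := by push_cast at h6; omega
            subst this
            exact h1 ⟨h3, h4⟩
          · rintro ⟨s, hs, h3, h4, h5, h6⟩
            exact ⟨s, hs, h3, h4, h5, by push_cast; omega⟩
      · convert ih using 1
        funext k
        congr 1
        apply propext
        constructor
        · rintro ⟨s, hs, h3, h4, h5, h6⟩
          refine ⟨s, hs, h3, h4, h5, ?_⟩
          by_contra h7
          have : s = L + j := by push_cast at h6; omega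
          subst this
          exact hV hs
        · rintro ⟨s, hs, h3, h4, h5, h6⟩
          exact ⟨s, hs, h3, h4, h5, by push_cast; omega⟩
  apply S.closed
  intro N
  refine ⟨_, main (-N - n) (2 * N + n + 1).toNat, ?_⟩
  intro k h1 h2
  split_ifs with h3
  · rfl
  · refine (hout k fun s hs h4 => h3 ⟨s, hs, h4.1, h4.2, by omega, ?_⟩).symm
    rw [Int.toNat_of_nonneg (by omega)]
    omega

end ZeroSys

/-! ### Local maps and simultaneous rewriting of separated windows. -/

/-- A shift-equivariant map on configurations which is given by a local rule. -/
structure LocalMap (F : (ℤ → B) → ℤ → B) : Prop where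
  equiv : ∀ x c k, F (shf x c) k = F x (k + c)
  loc : ∃ R : ℕ, ∀ x y : ℤ → B, (∀ k : ℤ, -R ≤ k → k ≤ R → x k = y k) → F x 0 = F y 0

lemma LocalMap.comp {F F' : (ℤ → B) → ℤ → B} (h : LocalMap F) (h' : LocalMap F') :
    LocalMap fun x => F (F' x) := by
  obtain ⟨R, hR⟩ := h.loc
  obtain ⟨R', hR'⟩ := h'.loc
  refine ⟨fun x c k => ?_, R + R', fun x y hxy => ?_⟩
  · have : F' (shf x c) = shf (F' x) c := by funext j; exact h'.equiv x c j
    simp only [this, h.equiv]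
  · apply hR
    intro k h1 h2
    have e1 := h'.equiv x k 0
    have e2 := h'.equiv y k 0
    rw [zero_add] at e1 e2
    rw [← e1, ← e2]
    apply hR'
    intro j h3 h4
    exact hxy _ (by push_cast; omega) (by push_cast; omega)

lemma LocalMap.isMorphism [TopologicalSpace B] [Nonempty B] {F : (ℤ → B) → ℤ → B} (h : LocalMap F)
    {X : Subshift B ℤ} (G : X.carrier → X.carrier) (hG : ∀ x, (G x).1 = F x.1) :
    IsMorphism G := by
  classical
  obtain ⟨R, hR⟩ := h.loc
  refine ⟨-R, R, by omega, fun w => F (fun k => if hk : k ∈ Set.Icc (-R : ℤ) R then w ⟨k, hk⟩ else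
    Classical.arbitrary B) 0, fun x i => ?_⟩
  rw [hG]
  have := h.equiv x.1 i 0
  rw [zero_add] at this
  rw [← this]
  apply hR
  intro k h1 h2
  rw [dif_pos ⟨h1, h2⟩, shf_apply, add_comm]

/-- Replace the contents of all windows `[s, s + n)` for which the local condition `v` holds
at `s`; the new contents are given by `t`. -/
noncomputable def app (n : ℤ) (v : (ℤ → B) → Prop) (t : (ℤ → B) → ℤ → B) (x : ℤ → B) : ℤ → B :=
  open Classical in fun k =>
  if ∃ a, 0 ≤ a ∧ a < n ∧ v (shf x (k - a)) then
    t (shf x (k - Classical.epsilon fun a => 0 ≤ a ∧ a < n ∧ v (shf x (k - a))))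
      (Classical.epsilon fun a => 0 ≤ a ∧ a < n ∧ v (shf x (k - a)))
  else x k

section app

variable {n : ℤ} {v : (ℤ → B) → Prop} {t : (ℤ → B) → ℤ → B}

lemma app_out {x : ℤ → B} {k : ℤ} (h : ∀ s, v (shf x s) → ¬ (s ≤ k ∧ k < s + n)) :
    app n v t x k = x k := by
  unfold app
  rw [if_neg]
  rintro ⟨a, h1, h2, h3⟩
  exact h _ h3 ⟨by omega, by omega⟩

lemma app_in {x : ℤ → B} (hsp : ∀ s s', v (shf x s) → v (shf x s') → s < s' → s + n ≤ s')
    {s k : ℤ} (hs : v (shf x s)) (h1 : s ≤ k) (h2 : k < s + n) :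
    app n v t x k = t (shf x s) (k - s) := by
  unfold app
  have hex : ∃ a, 0 ≤ a ∧ a < n ∧ v (shf x (k - a)) :=
    ⟨k - s, by omega, by omega, by rwa [sub_sub_cancel]⟩
  rw [if_pos hex]
  obtain ⟨h3, h4, h5⟩ := Classical.epsilon_spec hex
  set a := Classical.epsilon fun a => 0 ≤ a ∧ a < n ∧ v (shf x (k - a)) with ha
  have : k - a = s := by
    rcases lt_trichotomy (k - a) s with h6 | h6 | h6
    · have := hsp _ _ h5 hs h6; omega
    · exact h6
    · have := hsp _ _ hs h5 h6; omega
  rw [this]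
  congr 1; omega

lemma app_localMap (hR : ∃ R : ℕ, ∀ x y : ℤ → B, (∀ k : ℤ, -R ≤ k → k ≤ R → x k = y k) →
    (v x → v y) ∧ ∀ a, t x a = t y a) : LocalMap (app n v t) := by
  obtain ⟨R, hR⟩ := hR
  constructor
  · intro x c k
    unfold app
    have : ∀ a, shf (shf x c) (k - a) = shf x (k + c - a) := by
      intro a; rw [shf_shf]; congr 1; ring
    -- The chosen offset depends only on the predicate, so equal predicates give equal choices.
    have hP : (fun a => 0 ≤ a ∧ a < n ∧ v (shf (shf x c) (k - a))) =
        fun a => 0 ≤ a ∧ a < n ∧ v (shf x (k + c - a)) := by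
      funext a; rw [this]
    rw [hP]
    simp only [this, shf_apply]
  · refine ⟨R + n.toNat, fun x y hxy => ?_⟩
    have key : ∀ a, 0 ≤ a → a < n → ∀ k : ℤ, -R ≤ k → k ≤ R →
        shf x (0 - a) k = shf y (0 - a) k := by
      intro a h1 h2 k h3 h4
      exact hxy _ (by push_cast; omega) (by push_cast; omega)
    have hP : (fun a => 0 ≤ a ∧ a < n ∧ v (shf x (0 - a))) =
        fun a => 0 ≤ a ∧ a < n ∧ v (shf y (0 - a)) := by
      funext a
      apply propext
      constructor
      · rintro ⟨h1, h2, h3⟩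
        exact ⟨h1, h2, (hR _ _ (key a h1 h2)).1 h3⟩
      · rintro ⟨h1, h2, h3⟩
        exact ⟨h1, h2, (hR _ _ fun k h4 h5 => (key a h1 h2 k h4 h5).symm).1 h3⟩
    unfold app
    rw [hP]
    split_ifs with hex
    · obtain ⟨h3, h4, -⟩ := Classical.epsilon_spec hex
      exact (hR _ _ (key _ h3 h4)).2 _
    · exact hxy 0 (by omega) (by omega)

end app


namespace ZeroSys

variable (S : ZeroSys B)

lemma app_mem {n R : ℤ} (hn : 0 ≤ n) (hR : 0 ≤ R) {v : (ℤ → B) → Prop} {t : (ℤ → B) → ℤ → B}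
    (hsp : ∀ x ∈ S.X, ∀ s s', v (shf x s) → v (shf x s') → s < s' → s + n + R ≤ s')
    (hmem : ∀ u ∈ S.X, v u → ∀ y ∈ S.X, (∀ k, -R ≤ k → k < n + R → y k = u k) →
      (fun k => if 0 ≤ k ∧ k < n then t u k else y k) ∈ S.X)
    {x : ℤ → B} (hx : x ∈ S.X) : app n v t x ∈ S.X := by
  have hsp' : ∀ s s', v (shf x s) → v (shf x s') → s < s' → s + n ≤ s' :=
    fun s s' h h' h3 => by have := hsp x hx s s' h h' h3; omega
  refine S.mem_of_windows hx _ (fun s => v (shf x s)) hn (hsp x hx) (fun k h => app_out h) ?_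
  intro s hs y hy hyx
  have := hmem _ (S.shift_mem x hx s) hs _ (S.shift_mem y hy s) (fun k h1 h2 => by
    simp only [shf_apply]; exact hyx _ (by omega) (by omega))
  have h2 := S.shift_mem _ this (-s)
  convert h2 using 1
  funext k
  simp only [shf_apply, neg_add_cancel_right]
  by_cases h3 : s ≤ k ∧ k < s + n
  · rw [if_pos h3, if_pos (by omega), app_in hsp' hs h3.1 h3.2]
    congr 1
  · rw [if_neg h3, if_neg (by omega)]

/-- The point is that `x` and `y` have the same sites. Old sites survive; a new site of `y` would be
far from all old ones because the sites of `y` are separated, so its surroundings were never changed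
and it was already a site of `x`. -/
lemma app_inv {n R : ℤ} (hR : 0 ≤ R) {v : (ℤ → B) → Prop} {t t' : (ℤ → B) → ℤ → B} {x y : ℤ → B}
    (hy : y = app n v t x)
    (hspy : ∀ s s', v (shf y s) → v (shf y s') → s < s' → s + n + R ≤ s')
    (h2 : ∀ s, v (shf x s) → v (shf y s))
    (h3 : ∀ s, v (shf y s) → (∀ s', v (shf x s') → s' + n + R ≤ s ∨ s + n + R ≤ s') →
      v (shf x s))
    (h4 : ∀ s, v (shf x s) → ∀ a, 0 ≤ a → a < n → t' (shf y s) a = x (s + a)) :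
    app n v t' y = x := by
  have hv : ∀ s, v (shf y s) → v (shf x s) := by
    intro s hs
    by_contra hc
    refine hc (h3 s hs fun s' hs' => ?_)
    rcases lt_trichotomy s' s with h | h | h
    · exact Or.inl (hspy _ _ (h2 _ hs') hs h)
    · subst h; exact absurd hs' hc
    · exact Or.inr (hspy _ _ hs (h2 _ hs') h)
  funext k
  by_cases hk : ∃ s, v (shf x s) ∧ s ≤ k ∧ k < s + n
  · obtain ⟨s, hs, h5, h6⟩ := hk
    rw [app_in (fun s s' a b c => by have := hspy s s' a b c; omega) (h2 s hs) h5 h6,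
      h4 s hs _ (by omega) (by omega)]
    congr 1; omega
  · push Not at hk
    rw [app_out fun s hs h5 => absurd h5.2 (not_lt.mpr (hk s (hv s hs) h5.1)), hy,
      app_out fun s hs h5 => absurd h5.2 (not_lt.mpr (hk s hs h5.1))]

lemma app_ctx {n R : ℤ} (hR : 0 ≤ R) {v : (ℤ → B) → Prop} {t : (ℤ → B) → ℤ → B} {x : ℤ → B}
    (hsp : ∀ s s', v (shf x s) → v (shf x s') → s < s' → s + n + R ≤ s') {s : ℤ}
    (hs : v (shf x s)) (k : ℤ) (hk : (-R ≤ k ∧ k < 0) ∨ (n ≤ k ∧ k < n + R)) :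
    shf (app n v t x) s k = shf x s k := by
  simp only [shf_apply]
  refine app_out fun s' hs' h => ?_
  rcases lt_trichotomy s' s with h1 | h1 | h1
  · have := hsp _ _ hs' hs h1; omega
  · subst h1; omega
  · have := hsp _ _ hs hs' h1; omega

lemma app_win {n R : ℤ} (hR : 0 ≤ R) {v : (ℤ → B) → Prop} {t : (ℤ → B) → ℤ → B} {x : ℤ → B}
    (hsp : ∀ s s', v (shf x s) → v (shf x s') → s < s' → s + n + R ≤ s') {s : ℤ}
    (hs : v (shf x s)) (k : ℤ) (h1 : 0 ≤ k) (h2 : k < n) :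
    shf (app n v t x) s k = t (shf x s) k := by
  rw [shf_apply, app_in (fun s s' h h' h3 => by have := hsp s s' h h' h3; omega) hs
    (by omega) (by omega), add_sub_cancel_right]

/-- The local form of `app_inv`. -/
lemma app_inv' {n R : ℤ} (hn : 0 ≤ n) (hR : 0 ≤ R) {v : (ℤ → B) → Prop}
    {t t' : (ℤ → B) → ℤ → B}
    (hsp : ∀ x ∈ S.X, ∀ s s', v (shf x s) → v (shf x s') → s < s' → s + n + R ≤ s')
    (hmem : ∀ u ∈ S.X, v u → ∀ y ∈ S.X, (∀ k, -R ≤ k → k < n + R → y k = u k) →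
      (fun k => if 0 ≤ k ∧ k < n then t u k else y k) ∈ S.X)
    (hstep : ∀ u ∈ S.X, v u → ∀ w, (∀ k, -R ≤ k → k < 0 → w k = u k) →
      (∀ k, n ≤ k → k < n + R → w k = u k) → (∀ k, 0 ≤ k → k < n → w k = t u k) →
      v w ∧ ∀ a, 0 ≤ a → a < n → t' w a = u a)
    (hback : ∀ u w, v w → (∀ k, -R ≤ k → k < n + R → u k = w k) → v u)
    {x : ℤ → B} (hx : x ∈ S.X) : app n v t' (app n v t x) = x := by
  have hy := S.app_mem hn hR hsp hmem hx
  have hctx := fun s (hs : v (shf x s)) => app_ctx (t := t) hR (hsp x hx) hs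
  have hwin := fun s (hs : v (shf x s)) => app_win (t := t) hR (hsp x hx) hs
  have hst := fun s (hs : v (shf x s)) => hstep _ (S.shift_mem x hx s) hs _
    (fun k h1 h2 => hctx s hs k (Or.inl ⟨h1, h2⟩)) (fun k h1 h2 => hctx s hs k (Or.inr ⟨h1, h2⟩))
    (hwin s hs)
  refine app_inv hR rfl (hsp _ hy) (fun s hs => (hst s hs).1) ?_ ?_
  · intro s hs hfar
    refine hback _ _ hs fun k h1 h2 => ?_
    simp only [shf_apply]
    refine (app_out fun s' hs' h => ?_).symm
    rcases hfar s' hs' with h3 | h3 <;> omega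
  · intro s hs a h1 h2
    rw [(hst s hs).2 a h1 h2, shf_apply, add_comm]

end ZeroSys

/-! ### Glider kernels and the two involutions. -/

/-- A `ZeroSys` with two words `P`, `Q` of equal length `l` (the kernels of the gliders) and
length parameters. -/
structure GliderBase (B : Type) extends ZeroSys B where
  l : ℤ
  kap : ℤ
  K : ℤ
  m : ℕ
  P : ℤ → B
  Q : ℤ → B
  P_mem : P ∈ X
  Q_mem : Q ∈ X
  P_left : ∀ k < 0, P k = z k
  Q_left : ∀ k < 0, Q k = z k
  P_right : ∀ k ≥ l, P k = z (k - l)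
  Q_right : ∀ k ≥ l, Q k = z (k - l)
  P_first : ∀ a, P 0 ≠ z a
  Q_first : ∀ a, Q 0 ≠ z a
  P_last : ∀ a, P (l - 1) ≠ z a
  Q_last : ∀ a, Q (l - 1) ≠ z a
  PQ_ne : ∃ k, 0 ≤ k ∧ k < l ∧ P k ≠ Q k
  hl : 0 < l
  hlk : l ≤ kap
  hpk : 2 * (p : ℤ) ≤ kap
  dvd_kap : (p : ℤ) ∣ kap
  hm : 2 * (l + kap) ≤ m
  hK : m + l + 2 * kap ≤ K
  dvd_K : (p : ℤ) ∣ K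

namespace GliderBase

open ZeroSys

variable (S : GliderBase B)

/-- One period more than `K`: after `I1` has produced a P, the window 0P of `I2` uses up `p` of the
zeros in front of it, and `K` of them must remain as context. -/
abbrev K1 : ℤ := S.K + S.p

/-- `P` occurs in `x` at `s`. -/
def AtP (x : ℤ → B) (s : ℤ) : Prop := ∀ k, 0 ≤ k → k < S.l → x (s + k) = S.P k

/-- `Q` occurs in `x` at `s`. -/
def AtQ (x : ℤ → B) (s : ℤ) : Prop := ∀ k, 0 ≤ k → k < S.l → x (s + k) = S.Q k

/-- An occurrence of a glider kernel followed by `kap` letters of zeros. -/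
def Free (x : ℤ → B) (s : ℤ) : Prop :=
  (S.AtP x s ∨ S.AtQ x s) ∧ S.Zr x (s + S.l) (s + S.l + S.kap)

variable {S}

lemma pp : (0 : ℤ) < S.p := by exact_mod_cast S.hp

lemma AtP.congr {x y : ℤ → B} {s s' : ℤ} (h : S.AtP x s)
    (h1 : ∀ k, 0 ≤ k → k < S.l → y (s' + k) = x (s + k)) : S.AtP y s' :=
  fun k hk hk' => by rw [h1 k hk hk', h k hk hk']

lemma AtQ.congr {x y : ℤ → B} {s s' : ℤ} (h : S.AtQ x s)
    (h1 : ∀ k, 0 ≤ k → k < S.l → y (s' + k) = x (s + k)) : S.AtQ y s' :=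
  fun k hk hk' => by rw [h1 k hk hk', h k hk hk']

lemma AtP.shf_iff {x : ℤ → B} {s c : ℤ} : S.AtP (shf x c) s ↔ S.AtP x (s + c) :=
  ⟨fun h => h.congr fun k _ _ => by simp only [shf_apply]; congr 1; ring,
    fun h => h.congr fun k _ _ => by simp only [shf_apply]; congr 1; ring⟩

lemma AtQ.shf_iff {x : ℤ → B} {s c : ℤ} : S.AtQ (shf x c) s ↔ S.AtQ x (s + c) :=
  ⟨fun h => h.congr fun k _ _ => by simp only [shf_apply]; congr 1; ring,
    fun h => h.congr fun k _ _ => by simp only [shf_apply]; congr 1; ring⟩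

lemma Free.shf_iff {x : ℤ → B} {s c : ℤ} : S.Free (shf x c) s ↔ S.Free x (s + c) := by
  unfold Free
  rw [AtP.shf_iff, AtQ.shf_iff, Zr.shf_iff]
  have e1 : s + S.l + c = s + c + S.l := by ring
  have e2 : s + S.l + S.kap + c = s + c + S.l + S.kap := by ring
  rw [e1, e2]

lemma not_AtP_AtQ {x : ℤ → B} {s : ℤ} (h : S.AtP x s) (h' : S.AtQ x s) : False := by
  obtain ⟨k, h1, h2, h3⟩ := S.PQ_ne
  exact h3 ((h k h1 h2).symm.trans (h' k h1 h2))

lemma AtP.first {x : ℤ → B} {s : ℤ} (h : S.AtP x s) : ¬ S.Z (x s) := by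
  rintro ⟨a, ha⟩
  have := h 0 le_rfl S.hl
  rw [add_zero, ha] at this
  exact S.P_first a this.symm

lemma AtQ.first {x : ℤ → B} {s : ℤ} (h : S.AtQ x s) : ¬ S.Z (x s) := by
  rintro ⟨a, ha⟩
  have := h 0 le_rfl S.hl
  rw [add_zero, ha] at this
  exact S.Q_first a this.symm

lemma AtP.last {x : ℤ → B} {s : ℤ} (h : S.AtP x s) : ¬ S.Z (x (s + S.l - 1)) := by
  rintro ⟨a, ha⟩
  have hl := S.hl
  have := h (S.l - 1) (by omega) (by omega)
  rw [← add_sub_assoc, ha] at this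
  exact S.P_last a this.symm

lemma AtQ.last {x : ℤ → B} {s : ℤ} (h : S.AtQ x s) : ¬ S.Z (x (s + S.l - 1)) := by
  rintro ⟨a, ha⟩
  have hl := S.hl
  have := h (S.l - 1) (by omega) (by omega)
  rw [← add_sub_assoc, ha] at this
  exact S.Q_last a this.symm

lemma Free.first {x : ℤ → B} {s : ℤ} (h : S.Free x s) : ¬ S.Z (x s) :=
  h.1.elim (fun h => h.first) fun h => h.first

lemma Free.last {x : ℤ → B} {s : ℤ} (h : S.Free x s) : ¬ S.Z (x (s + S.l - 1)) :=
  h.1.elim (fun h => h.last) fun h => h.last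

lemma Free.congr {x y : ℤ → B} {s : ℤ} (h : S.Free x s)
    (h1 : ∀ k, s ≤ k → k < s + S.l + S.kap → y k = x k) : S.Free y s := by
  have := S.hl
  have := S.hlk
  refine ⟨h.1.imp (fun h => h.congr ?_) (fun h => h.congr ?_), h.2.congr ?_⟩ <;>
  · intro k h2 h3
    exact h1 _ (by omega) (by omega)

lemma nonzero_or {x : ℤ → B} {a b k : ℤ} (h : S.Zr x a b) (hk : ¬ S.Z (x k)) : k < a ∨ b ≤ k := by
  by_contra hc
  push Not at hc
  exact hk (h k hc.1 hc.2)

variable (S)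

/-- The rule exchanging `P` and `Q`. -/
def v1 (x : ℤ → B) : Prop := S.Zr x (-S.K1) 0 ∧ S.Free x 0

open Classical in
noncomputable def t1 (x : ℤ → B) (a : ℤ) : B := if S.AtP x 0 then S.Q a else S.P a

noncomputable def I1 : (ℤ → B) → ℤ → B := app S.l S.v1 S.t1

/-- An occurrence of `0P` or of `Q0`. -/
def Mid (x : ℤ → B) (s : ℤ) : Prop :=
  (S.Zr x s (s + S.p) ∧ S.AtP x (s + S.p)) ∨ (S.AtQ x s ∧ S.Zr x (s + S.l) (s + S.l + S.p))

/-- The rule exchanging `0P` and `Q0`. -/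
def v2 (x : ℤ → B) : Prop := S.Zr x (-S.K) 0 ∧ S.Mid x 0 ∧
  S.Zr x (S.l + S.p) (S.l + S.p + S.kap) ∧ ¬ S.AtQ x (-S.K - S.l)

open Classical in
noncomputable def t2 (x : ℤ → B) (a : ℤ) : B := if S.AtQ x 0 then S.P (a - S.p) else S.Q a

noncomputable def I2 : (ℤ → B) → ℤ → B := app (S.l + S.p) S.v2 S.t2

variable {S}

lemma v1_shf {x : ℤ → B} {s : ℤ} :
    S.v1 (shf x s) ↔ S.Zr x (s - S.K1) s ∧ S.Free x s := by
  unfold v1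
  rw [Zr.shf_iff, Free.shf_iff, zero_add, neg_add_eq_sub]

lemma Mid.shf_iff {x : ℤ → B} {s c : ℤ} : S.Mid (shf x c) s ↔ S.Mid x (s + c) := by
  unfold Mid
  rw [Zr.shf_iff, AtP.shf_iff, AtQ.shf_iff, Zr.shf_iff]
  have e1 : s + S.l + c = s + c + S.l := by ring
  have e2 : s + S.l + S.p + c = s + c + S.l + S.p := by ring
  have e3 : s + S.p + c = s + c + S.p := by ring
  rw [e1, e2, e3]

lemma v2_shf {x : ℤ → B} {s : ℤ} :
    S.v2 (shf x s) ↔ S.Zr x (s - S.K) s ∧ S.Mid x s ∧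
      S.Zr x (s + S.l + S.p) (s + S.l + S.p + S.kap) ∧ ¬ S.AtQ x (s - S.K - S.l) := by
  unfold v2
  rw [Zr.shf_iff, Mid.shf_iff, Zr.shf_iff, AtQ.shf_iff, zero_add, neg_add_eq_sub]
  have e1 : S.l + S.p + s = s + S.l + S.p := by ring
  have e2 : S.l + S.p + S.kap + s = s + S.l + S.p + S.kap := by ring
  have e3 : -S.K - S.l + s = s - S.K - S.l := by ring
  rw [e1, e2, e3]

lemma P_mid (x : ℤ → B) (s : ℤ) (h : ∀ a, 0 ≤ a → a < S.l + S.p → x (s + a) = S.P (a - S.p)) :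
    S.Zr x s (s + S.p) ∧ S.AtP x (s + S.p) := by
  have := S.pp
  have hl := S.hl
  constructor
  · intro k h1 h2
    have := h (k - s) (by omega) (by omega)
    rw [add_sub_cancel, S.P_left _ (by omega)] at this
    exact ⟨_, this⟩
  · intro k h1 h2
    have := h (k + S.p) (by omega) (by omega)
    rw [add_sub_cancel_right, ← add_assoc] at this
    rw [← this]; congr 1; ring

lemma Q_mid (x : ℤ → B) (s : ℤ) (h : ∀ a, 0 ≤ a → a < S.l + S.p → x (s + a) = S.Q a) :
    S.AtQ x s ∧ S.Zr x (s + S.l) (s + S.l + S.p) := by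
  have := S.pp
  have hl := S.hl
  constructor
  · intro k h1 h2
    exact h k h1 (by omega)
  · intro k h1 h2
    have := h (k - s) (by omega) (by omega)
    rw [add_sub_cancel, S.Q_right _ (by omega)] at this
    exact ⟨_, this⟩

lemma eq_mid_P {x : ℤ → B} (hx : x ∈ S.X) {s : ℤ} (h : S.Zr x s (s + S.p))
    (h' : S.AtP x (s + S.p)) : ∀ a, 0 ≤ a → a < S.l + S.p → x (s + a) = S.P (a - S.p) := by
  intro a h1 h2
  by_cases h3 : a < S.p
  · rw [S.P_left _ (by omega), align_left hx h h'.first _ (by omega) (by omega)]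
    congr 1; ring
  · rw [← h' _ (by omega) (by omega)]; congr 1; ring

lemma eq_mid_Q {x : ℤ → B} (hx : x ∈ S.X) {s : ℤ} (h' : S.AtQ x s)
    (h : S.Zr x (s + S.l) (s + S.l + S.p)) :
    ∀ a, 0 ≤ a → a < S.l + S.p → x (s + a) = S.Q a := by
  intro a h1 h2
  by_cases h3 : a < S.l
  · exact h' a h1 h3
  · rw [S.Q_right _ (by omega), align_right hx h h'.last _ (by omega) (by omega)]
    congr 1; ring

lemma v1_sp {x : ℤ → B} {s s' : ℤ} (h : S.v1 (shf x s)) (h' : S.v1 (shf x s')) (hs : s < s') :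
    s + S.l + S.K1 ≤ s' := by
  rw [v1_shf] at h h'
  have := S.hl
  have := S.hlk
  have := S.hK
  have := S.pp
  unfold K1 at *
  rcases nonzero_or h'.1 h.2.first with h3 | h3
  · rcases nonzero_or h'.1 h.2.last with h4 | h4 <;> omega
  · omega

/-- The critical case is a window Q0 whose trailing zeros merge with the left context of the next
site. The zeros between have length at least `K` and divisible by `p`. Length exactly `K` is what
the clause on `AtQ` in `v2` rules out, so there are at least `K + p`, which pays for the `p` zeros
inside the first window. -/
lemma v2_sp {x : ℤ → B} (hx : x ∈ S.X) {s s' : ℤ} (h : S.v2 (shf x s)) (h' : S.v2 (shf x s'))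
    (hs : s < s') : s + (S.l + S.p) + S.K ≤ s' := by
  rw [v2_shf] at h h'
  obtain ⟨h1, h2, h3, h4⟩ := h
  obtain ⟨h1', h2', h3', h4'⟩ := h'
  have hl := S.hl
  have hlk := S.hlk
  have hK := S.hK
  have hp := S.pp
  have hpk := S.hpk
  rcases h2 with ⟨ha, hb⟩ | ⟨ha, hb⟩
  · have : s + S.p < s' - S.K := by
      rcases nonzero_or h1' hb.first with h5 | h5
      · exact h5
      exfalso
      rcases h2' with ⟨hc, hd⟩ | ⟨hc, hd⟩
      · exact hb.first (hc _ h5 (by omega))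
      · rcases nonzero_or ha hc.first with h6 | h6
        · omega
        have : s' = s + S.p := by omega
        subst this
        exact not_AtP_AtQ hb hc
    rcases nonzero_or h1' hb.last with h4 | h4 <;> omega
  · have : s < s' - S.K := by
      rcases nonzero_or h1' ha.first with h5 | h5 <;> omega
    have h6 : s + S.l < s' - S.K := by
      rcases nonzero_or h1' ha.last with h5 | h5
      · rcases (show s + S.l ≤ s' - S.K by omega).lt_or_eq with h7 | h7
        · exact h7
        · exfalso; apply h4'; rwa [← h7, add_sub_cancel_right]
      · omega
    by_contra hc
    have hz : S.Zr x (s + S.l) s' := by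
      intro k h7 h8
      by_cases h9 : k < s + S.l + S.p
      · exact hb k h7 h9
      · exact h1' k (by omega) h8
    -- If the second site is of the form 0P, the run extends `p` letters beyond `s'`, which is
    -- harmless modulo `p`.
    have hd : (S.p : ℤ) ∣ s' - s - S.l := by
      rcases h2' with ⟨hc, hd⟩ | ⟨hc, hd⟩
      · have h7 := align_right hx (hz.append hc) ha.last (s' + S.p - 1) (by omega) (by omega)
        have h8 := succ_nonzero hx h7 (by rw [sub_add_cancel]; exact hd.first)
        have : s' - s - S.l = s' + S.p - 1 - (s + S.l) + 1 - S.p := by ring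
        rw [this]
        exact dvd_sub h8 dvd_rfl
      · have h7 := align_right hx hz ha.last (s' - 1) (by omega) (by omega)
        have h8 := succ_nonzero hx h7 (by rw [sub_add_cancel]; exact hc.first)
        have : s' - s - S.l = s' - 1 - (s + S.l) + 1 := by ring
        rw [this]
        exact h8
    have := Int.le_of_dvd (by omega) (dvd_sub hd S.dvd_K)
    omega

/-- Substituting a finite word bordered by zeros. -/
lemma replace_mem {y W : ℤ → B} (hy : y ∈ S.X) (hW : W ∈ S.X) {n : ℤ}
    (h1 : S.Zr y (-(2 * S.p)) 0) (h2 : ∀ k, -(2 * S.p : ℤ) ≤ k → k < 0 → W k = y k)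
    (h3 : S.Zr y n (n + 2 * S.p)) (h4 : ∀ k, n ≤ k → k < n + 2 * S.p → W k = y k) :
    (fun k => if 0 ≤ k ∧ k < n then W k else y k) ∈ S.X := by
  have hp := S.pp
  by_cases hn : 0 ≤ n
  swap
  · convert hy using 2 with k
    rw [if_neg (by omega)]
  have e1 : glue W y (n + 2 * S.p) ∈ S.X := by
    refine glue_mem hW hy (c := n + 2 * S.p) ?_ ?_
    · exact (h3.mono (by omega) le_rfl).congr (fun k h5 h6 => h4 k (by omega) h6)
    · intro k h5 h6
      exact (h4 k (by omega) h6).symm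
  have := glue_mem hy e1 (c := 0) (h1.mono (by omega) le_rfl) (fun k h5 h6 => by
    rw [glue_lt (by omega), h2 k (by omega) h6])
  convert this using 1
  funext k
  unfold glue
  by_cases h5 : k < 0
  · rw [if_neg (by omega), if_pos h5]
  · rw [if_neg h5]
    by_cases h6 : k < n
    · rw [if_pos (by omega), if_pos (by omega)]
    · rw [if_neg (by omega)]
      split_ifs with h7
      · exact (h4 k (by omega) h7).symm
      · rfl

end GliderBase

namespace GliderBase

open ZeroSys

variable {S : GliderBase B}

lemma t1_P {u : ℤ → B} (h : S.AtP u 0) : S.t1 u = S.Q := by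
  funext a; unfold t1; rw [if_pos h]

lemma t1_Q {u : ℤ → B} (h : S.AtQ u 0) : S.t1 u = S.P := by
  funext a; unfold t1; rw [if_neg fun h' => not_AtP_AtQ h' h]

lemma t2_Q {u : ℤ → B} (h : S.AtQ u 0) : S.t2 u = shf S.P (-S.p) := by
  funext a; unfold t2; rw [if_pos h]; rfl

lemma t2_P {u : ℤ → B} (h : ¬ S.AtQ u 0) : S.t2 u = S.Q := by
  funext a; unfold t2; rw [if_neg h]

lemma not_AtQ_of_zr {u : ℤ → B} (h : S.Zr u 0 S.p) : ¬ S.AtQ u 0 :=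
  fun h' => h'.first (h 0 le_rfl S.pp)

lemma v1_mem {u : ℤ → B} (hv : S.v1 u) {y : ℤ → B} (hy : y ∈ S.X)
    (hyu : ∀ k, -S.K1 ≤ k → k < S.l + S.K1 → y k = u k) :
    (fun k => if 0 ≤ k ∧ k < S.l then S.t1 u k else y k) ∈ S.X := by
  have := S.hl
  have := S.hlk
  have := S.hK
  have := S.hpk
  have := S.pp
  have hK1 : S.K1 = S.K + S.p := rfl
  have hf := hv.2.first
  have hla := hv.2.last
  rw [← hyu 0 (by omega) (by omega)] at hf
  rw [← hyu _ (by omega) (by omega), zero_add] at hla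
  have z1 : S.Zr y (-(2 * S.p)) 0 :=
    (hv.1.mono (by omega) le_rfl).congr fun k h1 h2 => hyu k (by omega) (by omega)
  have z2 : S.Zr y S.l (S.l + 2 * S.p) :=
    (hv.2.2.mono (by omega) (by omega)).congr fun k h1 h2 => hyu k (by omega) (by omega)
  have a1 := align_left hy z1 hf
  have a2 := align_right hy z2 hla
  rcases hv.2.1 with h | h
  · rw [t1_P h]
    refine replace_mem hy S.Q_mem z1 (fun k h1 h2 => ?_) z2 (fun k h1 h2 => ?_)
    · rw [S.Q_left k h2, a1 k h1 h2, sub_zero]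
    · rw [S.Q_right k h1, a2 k h1 h2]
  · rw [t1_Q h]
    refine replace_mem hy S.P_mem z1 (fun k h1 h2 => ?_) z2 (fun k h1 h2 => ?_)
    · rw [S.P_left k h2, a1 k h1 h2, sub_zero]
    · rw [S.P_right k h1, a2 k h1 h2]

lemma I1_mem {x : ℤ → B} (hx : x ∈ S.X) : S.I1 x ∈ S.X := by
  have := S.hl
  have := S.hlk
  have := S.hK
  have := S.pp
  exact S.app_mem (R := S.K1) S.hl.le (by unfold K1; omega) (fun x _ s s' h h' => v1_sp h h')
    (fun u _ hv y hy h => v1_mem hv hy h) hx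

lemma v1_congr {u w : ℤ → B} (h : S.v1 w)
    (h1 : ∀ k, -S.K1 ≤ k → k < S.l + S.K1 → u k = w k) : S.v1 u := by
  have := S.hl
  have := S.hlk
  have := S.hK
  have := S.pp
  have hK1 : S.K1 = S.K + S.p := rfl
  exact ⟨h.1.congr fun k h2 h3 => h1 _ h2 (by omega),
    h.2.congr fun k h2 h3 => h1 _ (by omega) (by omega)⟩

lemma I1_inv {x : ℤ → B} (hx : x ∈ S.X) : S.I1 (S.I1 x) = x := by
  have := S.hl
  have := S.hlk
  have := S.hK
  have := S.pp
  refine S.app_inv' (R := S.K1) S.hl.le (by unfold K1; omega) (fun x _ s s' h h' => v1_sp h h')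
    (fun u _ hv y hy h => v1_mem hv hy h) ?_ (fun u w => v1_congr) hx
  intro u _ hv w h1 h2 h3
  have z1 : S.Zr w (-S.K1) 0 := hv.1.congr h1
  have z2 : S.Zr w (0 + S.l) (0 + S.l + S.kap) := hv.2.2.congr fun k h4 h5 =>
    h2 k (by omega) (by unfold K1; omega)
  rcases hv.2.1 with h | h
  · rw [t1_P h] at h3
    have hw : S.AtQ w 0 := fun k h4 h5 => by rw [zero_add]; exact h3 k h4 h5
    refine ⟨⟨z1, Or.inr hw, z2⟩, fun a h4 h5 => ?_⟩
    rw [t1_Q hw, ← h a h4 h5, zero_add]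
  · rw [t1_Q h] at h3
    have hw : S.AtP w 0 := fun k h4 h5 => by rw [zero_add]; exact h3 k h4 h5
    refine ⟨⟨z1, Or.inl hw, z2⟩, fun a h4 h5 => ?_⟩
    rw [t1_P hw, ← h a h4 h5, zero_add]

lemma t1_congr {u w : ℤ → B} (h1 : ∀ k, 0 ≤ k → k < S.l → u k = w k) : S.t1 u = S.t1 w := by
  have : S.AtP u 0 ↔ S.AtP w 0 :=
    ⟨fun h => h.congr fun k h2 h3 => by rw [zero_add]; exact (h1 k h2 h3).symm,
      fun h => h.congr fun k h2 h3 => by rw [zero_add]; exact h1 k h2 h3⟩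
  funext a; unfold t1
  by_cases h : S.AtP u 0
  · rw [if_pos h, if_pos (this.1 h)]
  · rw [if_neg h, if_neg (mt this.2 h)]

lemma I1_localMap : LocalMap S.I1 := by
  have := S.hl
  have := S.hlk
  have := S.hK
  have := S.pp
  refine app_localMap ⟨(S.l + S.K1).toNat, fun x y h => ⟨fun hv => v1_congr hv fun k h1 h2 =>
    (h k ?_ ?_).symm, fun a => ?_⟩⟩
  · have hK1 : S.K1 = S.K + S.p := rfl; omega
  · have hK1 : S.K1 = S.K + S.p := rfl; omega
  · rw [t1_congr fun k h1 h2 => h k (by have hK1 : S.K1 = S.K + S.p := rfl; omega) (by have hK1 : S.K1 = S.K + S.p := rfl; omega)]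

lemma Mid.congr {x y : ℤ → B} {s : ℤ} (h : S.Mid x s)
    (h1 : ∀ k, s ≤ k → k < s + S.l + S.p → y k = x k) : S.Mid y s := by
  have := S.hl
  have := S.pp
  refine h.imp (fun h => ⟨h.1.congr ?_, h.2.congr ?_⟩) (fun h => ⟨h.1.congr ?_, h.2.congr ?_⟩) <;>
  · intro k h2 h3
    exact h1 _ (by omega) (by omega)

lemma v2_mem {u : ℤ → B} (hv : S.v2 u) {y : ℤ → B} (hy : y ∈ S.X)
    (hyu : ∀ k, -S.K ≤ k → k < S.l + S.p + S.K → y k = u k) :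
    (fun k => if 0 ≤ k ∧ k < S.l + S.p then S.t2 u k else y k) ∈ S.X := by
  have := S.hl
  have := S.hlk
  have := S.hK
  have := S.hpk
  have := S.pp
  obtain ⟨h1, h2, h3, -⟩ := hv
  have z1 : S.Zr y (-S.K) 0 := h1.congr fun k h1 h2 => hyu k (by omega) (by omega)
  have z3 : S.Zr y (S.l + S.p) (S.l + S.p + S.kap) :=
    h3.congr fun k h1 h2 => hyu k (by omega) (by omega)
  have hm : S.Mid y 0 := h2.congr fun k h1 h2 => hyu k (by omega) (by omega)
  rcases h2 with ⟨ha, hb⟩ | ⟨ha, hb⟩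
  · rw [t2_P (not_AtQ_of_zr (by simpa using ha))]
    rcases hm with ⟨ha', hb'⟩ | ⟨ha', hb'⟩
    swap
    · exact absurd (ha 0 (by omega) (by omega)) (by
        rw [← hyu _ (by omega) (by omega)]; exact ha'.first)
    have a1 := align_left hy (z1.append ha') hb'.first
    have a2 := align_right hy z3 (by convert hb'.last using 4; ring)
    refine replace_mem hy S.Q_mem (z1.mono (by omega) le_rfl) (fun k h1 h2 => ?_)
      (z3.mono (by omega) (by omega)) (fun k h1 h2 => ?_)
    · rw [S.Q_left k h2, a1 k (by omega) (by omega)]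
      exact z_congr ⟨1, by ring⟩
    · rw [S.Q_right k (by omega), a2 k (by omega) (by omega)]
      exact z_congr ⟨1, by ring⟩
  · rw [t2_Q ha]
    rcases hm with ⟨ha', hb'⟩ | ⟨ha', hb'⟩
    · exact absurd (ha' 0 (by omega) (by omega)) (by
        rw [hyu _ (by omega) (by omega)]; exact ha.first)
    have a1 := align_left hy z1 ha'.first
    have a2 := align_right hy ((hb'.append (z3.mono (by omega) le_rfl)).mono
      (show 0 + S.l ≤ S.l by omega) le_rfl) (by convert ha'.last using 4; ring)
    refine replace_mem hy (S.shift_mem _ S.P_mem _) (z1.mono (by omega) le_rfl) (fun k h1 h2 => ?_)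
      (z3.mono (by omega) (by omega)) (fun k h1 h2 => ?_)
    · rw [shf_apply, S.P_left _ (by omega), a1 k (by omega) (by omega)]
      exact z_congr ⟨-1, by ring⟩
    · rw [shf_apply, S.P_right _ (by omega), a2 k (by omega) (by omega)]
      exact z_congr ⟨-1, by ring⟩

lemma I2_mem {x : ℤ → B} (hx : x ∈ S.X) : S.I2 x ∈ S.X := by
  have := S.hl
  have := S.hlk
  have := S.hK
  have := S.pp
  exact S.app_mem (R := S.K) (by omega) (by omega) (fun x hx s s' h h' => v2_sp hx h h')
    (fun u _ hv y hy h => v2_mem hv hy h) hx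

/-- Used to see that rewriting neither creates nor destroys the Q forbidden by `v2`. By the spacing,
such a Q does not end before an earlier window overlapping it does, and the `kap ≥ l` zeros after
the window prevent it from ending later. So it would end together with the window, where 0P has P
and Q0 has a zero. -/
lemma AtQ_of_windows {x y : ℤ → B} {V : ℤ → Prop} {s : ℤ}
    (hsp : ∀ s', V s' → s' < s → s' + (S.l + S.p) + S.K ≤ s)
    (hout : ∀ k, (∀ s', V s' → ¬ (s' ≤ k ∧ k < s' + (S.l + S.p))) → x k = y k)
    (hV : ∀ s', V s' → S.Mid y s' ∧ S.Zr y (s' + S.l + S.p) (s' + S.l + S.p + S.kap))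
    (h : S.AtQ y (s - S.K - S.l)) : S.AtQ x (s - S.K - S.l) := by
  have := S.hl
  have := S.hlk
  have := S.hK
  have hp := S.pp
  refine h.congr fun k h1 h2 => hout _ fun s' hs' h3 => ?_
  have h4 : s' < s := by omega
  have h5 := hsp s' hs' h4
  obtain ⟨h6, h7⟩ := hV s' hs'
  rcases nonzero_or h7 h.last with h8 | h8
  · have h9 : s - S.K - S.l = s' + S.p := by
      rcases h6 with ⟨ha, hb⟩ | ⟨ha, hb⟩
      · have := nonzero_or ha h.first
        by_contra hc
        have h10 : s - S.K - S.l < s' ∨ s' + S.p < s - S.K - S.l := by omega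
        rcases h10 with h10 | h10
        · rcases nonzero_or ha h.last with h11 | h11
          · omega
          · omega
        · omega
      · rcases nonzero_or hb h.last with h10 | h10 <;> omega
    rcases h6 with ⟨ha, hb⟩ | ⟨ha, hb⟩
    · rw [← h9] at hb
      exact not_AtP_AtQ hb h
    · rcases nonzero_or hb h.last with h10 | h10 <;> omega
  · omega

/-- The negative clause of `v2` looks further left than the `K` letters guarded by the spacing, so
`app_inv'` does not apply; `AtQ_of_windows` carries that clause in both directions. -/
lemma I2_inv {x : ℤ → B} (hx : x ∈ S.X) : S.I2 (S.I2 x) = x := by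
  have hl := S.hl
  have hlk := S.hlk
  have hK := S.hK
  have hp := S.pp
  have hsp : ∀ s s', S.v2 (shf x s) → S.v2 (shf x s') → s < s' → s + (S.l + S.p) + S.K ≤ s' :=
    fun s s' h h' => v2_sp hx h h'
  have hR : 0 ≤ S.K := by omega
  have hout : ∀ k, (∀ s', S.v2 (shf x s') → ¬ (s' ≤ k ∧ k < s' + (S.l + S.p))) →
    S.I2 x k = x k := fun k h => app_out h
  have hctx : ∀ s, S.v2 (shf x s) → ∀ k, (s - S.K ≤ k ∧ k < s) ∨ (s + S.l + S.p ≤ k ∧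
      k < s + S.l + S.p + S.K) → S.I2 x k = x k := fun s hs k hk => by
    have := app_ctx (t := S.t2) hR hsp hs (k - s) (by omega)
    rw [shf_apply, shf_apply, sub_add_cancel] at this
    exact this
  have hwin : ∀ s, S.v2 (shf x s) → ∀ a, 0 ≤ a → a < S.l + S.p →
      S.I2 x (s + a) = S.t2 (shf x s) a := fun s hs a h1 h2 => by
    have := app_win (t := S.t2) hR hsp hs a h1 h2
    rw [← this, shf_apply, add_comm]
    rfl
  have hmid : ∀ s, S.v2 (shf x s) → S.Mid (S.I2 x) s ∧ ∀ a, 0 ≤ a → a < S.l + S.p →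
      S.t2 (shf (S.I2 x) s) a = x (s + a) := by
    intro s hs
    have hw := hwin s hs
    rw [v2_shf] at hs
    rcases hs.2.1 with ⟨ha, hb⟩ | ⟨ha, hb⟩
    · rw [t2_P (not_AtQ_of_zr (by rw [Zr.shf_iff]; simpa [add_comm] using ha))] at hw
      have h1 := Q_mid _ _ hw
      refine ⟨Or.inr h1, ?_⟩
      rw [t2_Q (by rw [AtQ.shf_iff]; simpa using h1.1)]
      intro a h2 h3
      rw [eq_mid_P hx ha hb a h2 h3]
      rfl
    · rw [t2_Q (by rw [AtQ.shf_iff]; simpa using ha)] at hw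
      have h1 := P_mid _ _ hw
      refine ⟨Or.inl h1, ?_⟩
      rw [t2_P (not_AtQ_of_zr (by rw [Zr.shf_iff]; simpa [add_comm] using h1.1))]
      intro a h2 h3
      rw [eq_mid_Q hx ha hb a h2 h3]
  have hright : ∀ s, S.v2 (shf x s) →
      S.Zr (S.I2 x) (s + S.l + S.p) (s + S.l + S.p + S.kap) := fun s hs =>
    (v2_shf.1 hs).2.2.1.congr fun k h1 h2 => hctx s hs k (by omega)
  refine app_inv (n := S.l + S.p) (v := S.v2) (t := S.t2) (R := S.K) hR rfl (fun s s' h h' => v2_sp (I2_mem hx) h h') ?_ ?_ ?_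
  · intro s hs
    have hs' := v2_shf.1 hs
    refine v2_shf.2 ⟨hs'.1.congr fun k h1 h2 => hctx s hs k (by omega), (hmid s hs).1,
      hright s hs, fun hc => hs'.2.2.2 ?_⟩
    refine AtQ_of_windows (V := fun s => S.v2 (shf x s)) (fun s' h1 h2 => hsp _ _ h1 hs h2)
      (fun k h => (hout k h).symm) (fun s' h1 => ⟨(hmid s' h1).1, hright s' h1⟩) hc
  · intro s hs hfar
    have hs' := v2_shf.1 hs
    have hk : ∀ k, s - S.K ≤ k → k < s + S.l + S.p + S.K → x k = S.I2 x k := by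
      intro k h1 h2
      refine (hout k fun s' hs' h => ?_).symm
      rcases hfar s' hs' with h3 | h3 <;> omega
    refine v2_shf.2 ⟨hs'.1.congr fun k h1 h2 => hk k (by omega) (by omega),
      hs'.2.1.congr fun k h1 h2 => hk k (by omega) (by omega),
      hs'.2.2.1.congr fun k h1 h2 => hk k (by omega) (by omega), fun hc => hs'.2.2.2 ?_⟩
    refine AtQ_of_windows (V := fun s => S.v2 (shf x s)) (fun s' h1 h2 => ?_)
      hout (fun s' h1 => ⟨(v2_shf.1 h1).2.1, (v2_shf.1 h1).2.2.1⟩) hc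
    rcases hfar s' h1 with h3 | h3 <;> omega
  · exact fun s hs => (hmid s hs).2

lemma t2_congr {u w : ℤ → B} (h1 : ∀ k, 0 ≤ k → k < S.l → u k = w k) : S.t2 u = S.t2 w := by
  have : S.AtQ u 0 ↔ S.AtQ w 0 :=
    ⟨fun h => h.congr fun k h2 h3 => by rw [zero_add]; exact (h1 k h2 h3).symm,
      fun h => h.congr fun k h2 h3 => by rw [zero_add]; exact h1 k h2 h3⟩
  by_cases h : S.AtQ u 0
  · rw [t2_Q h, t2_Q (this.1 h)]
  · rw [t2_P h, t2_P (mt this.2 h)]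

lemma I2_localMap : LocalMap S.I2 := by
  have hl := S.hl
  have hlk := S.hlk
  have hK := S.hK
  have hp := S.pp
  refine app_localMap ⟨(S.l + S.p + S.K + S.kap).toNat, fun x y h => ⟨fun hv => ?_, fun a => ?_⟩⟩
  · obtain ⟨h1, h2, h3, h4⟩ := hv
    have h' : ∀ k, -S.K - S.l ≤ k → k < S.l + S.p + S.kap → y k = x k := fun k h5 h6 =>
      (h k (by omega) (by omega)).symm
    refine ⟨h1.congr fun k h5 h6 => h' k (by omega) (by omega),
      h2.congr fun k h5 h6 => h' k (by omega) (by omega),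
      h3.congr fun k h5 h6 => h' k (by omega) (by omega), fun hc => h4 ?_⟩
    exact hc.congr fun k h5 h6 => (h' _ (by omega) (by omega)).symm
  · rw [t2_congr fun k h1 h2 => h k (by omega) (by omega)]

end GliderBase

/-! ### Cyclic permutation of words in windows. -/

section cyc

variable {W : Type} [Finite W]

lemma exists_cyc (s : Set W) :
    ∃ f : Equiv.Perm W, f.IsCycleOn s ∧ {x | f x ≠ x} ⊆ s :=
  (Set.to_countable s).exists_cycleOn

/-- A permutation which is a cycle on `s` and fixes all other elements. -/
noncomputable def cyc (s : Set W) : Equiv.Perm W := (exists_cyc s).choose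

lemma cyc_zpow_mem {s : Set W} (ε : ℤ) {w : W} (h : w ∈ s) : (cyc s ^ ε) w ∈ s :=
  ((exists_cyc s).choose_spec.1.1.perm_zpow ε).mapsTo h

lemma cyc_zpow_out {s : Set W} (ε : ℤ) {w : W} (h : w ∉ s) : (cyc s ^ ε) w = w := by
  have : cyc s w = w := by
    by_contra hc
    exact h ((exists_cyc s).choose_spec.2 hc)
  exact Function.IsFixedPt.perm_zpow this ε

/-- The exponent is positive even if `w = e`, since the orbits below are counted in time steps of
which at least one is performed. -/
lemma cyc_reach {s : Set W} {w e : W} (h : w ∈ s) (he : e ∈ s) :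
    ∃ n : ℕ, (cyc s ^ (n + 1)) w = e := by
  obtain ⟨i, hi, -, h1⟩ := ((exists_cyc s).choose_spec.1.2 h he).exists_pow_eq''
  obtain ⟨n, rfl⟩ : ∃ n, i = n + 1 := ⟨i - 1, by omega⟩
  exact ⟨n, h1⟩

end cyc

namespace GliderBase

open ZeroSys

variable (S : GliderBase B)

/-- The word occurring in `x` in the window `[0, m)`. -/
def word (x : ℤ → B) : Fin S.m → B := fun i => x i

/-- Write the word `w` into the window `[0, m)` of `x`. -/
def put (w : Fin S.m → B) (x : ℤ → B) : ℤ → B := fun k =>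
  if h : 0 ≤ k ∧ k < S.m then w ⟨k.toNat, by omega⟩ else x k

variable {S}

lemma put_out {w : Fin S.m → B} {x : ℤ → B} {k : ℤ} (h : k < 0 ∨ S.m ≤ k) :
    S.put w x k = x k := dif_neg (by omega)

lemma put_in {w : Fin S.m → B} {x y : ℤ → B} {k : ℤ} (h : 0 ≤ k) (h' : k < S.m) :
    S.put w x k = S.put w y k := by
  unfold put
  rw [dif_pos ⟨h, h'⟩, dif_pos ⟨h, h'⟩]

lemma put_word {x y : ℤ → B} {k : ℤ} (h : 0 ≤ k) (h' : k < S.m) :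
    S.put (S.word x) y k = x k := by
  unfold put word
  rw [dif_pos ⟨h, h'⟩]
  congr 1
  simp only
  omega

lemma word_eq {x : ℤ → B} {w : Fin S.m → B} {y : ℤ → B}
    (h : ∀ k : ℤ, 0 ≤ k → k < S.m → x k = S.put w y k) : S.word x = w := by
  funext i
  unfold word
  rw [h _ (by omega) (by omega)]
  unfold put
  rw [dif_pos ⟨by omega, by omega⟩]
  rfl

lemma word_congr {x y : ℤ → B} (h : ∀ k : ℤ, 0 ≤ k → k < S.m → x k = y k) : S.word x = S.word y := by
  funext i
  exact h _ (by omega) (by omega)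

variable (S) in
/-- The map which permutes, for all sites at which `v` holds, the words in the window `[0, m)`
cyclically within the set `T`. -/
noncomputable def wapp [Finite B] (v : (ℤ → B) → Prop) (T : (ℤ → B) → Set (Fin S.m → B)) (ε : ℤ) :
    (ℤ → B) → ℤ → B :=
  app S.m v fun u a => S.put ((cyc (T u) ^ ε) (S.word u)) u a

variable (S) in
/-- The conditions under which `wapp` is a bijection. -/
structure WordRule (v : (ℤ → B) → Prop) (T : (ℤ → B) → Set (Fin S.m → B)) : Prop where
  sp : ∀ x ∈ S.X, ∀ s s', v (shf x s) → v (shf x s') → s < s' → s + S.m + S.K1 ≤ s'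
  inv : ∀ u ∈ S.X, v u → ∀ w, (∀ k, -S.K1 ≤ k → k < 0 → w k = u k) →
    (∀ k : ℤ, S.m ≤ k → k < S.m + S.K1 → w k = u k) → S.word u ∈ T u → S.word w ∈ T u →
    v w ∧ T w = T u
  loc : ∀ u w, (∀ k, -S.K1 ≤ k → k < S.m + S.K1 → w k = u k) → v u → v w ∧ T w = T u
  mem : ∀ u ∈ S.X, v u → ∀ w ∈ T u, ∀ y ∈ S.X,
    (∀ k, -S.K1 ≤ k → k < S.m + S.K1 → y k = u k) → S.put w y ∈ S.X

lemma K1_nonneg : 0 ≤ S.K1 := by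
  have := S.hl
  have := S.hlk
  have := S.hK
  have := S.pp
  have hK1 : S.K1 = S.K + S.p := rfl
  omega

namespace WordRule

variable [Finite B] {v : (ℤ → B) → Prop} {T : (ℤ → B) → Set (Fin S.m → B)}

lemma hmem (h : S.WordRule v T) (ε : ℤ) (u : ℤ → B) (hu : u ∈ S.X) (hv : v u) (y : ℤ → B)
    (hy : y ∈ S.X) (hyu : ∀ k, -S.K1 ≤ k → k < S.m + S.K1 → y k = u k) :
    (fun k : ℤ => if 0 ≤ k ∧ k < S.m then S.put ((cyc (T u) ^ ε) (S.word u)) u k else y k) ∈ S.X := by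
  have hK1 := K1_nonneg (S := S)
  by_cases hw : S.word u ∈ T u
  · convert h.mem u hu hv _ (cyc_zpow_mem ε hw) y hy hyu using 1
    funext k
    split_ifs with h1
    · exact put_in h1.1 h1.2
    · exact (put_out (by omega)).symm
  · rw [cyc_zpow_out ε hw]
    convert hy using 1
    funext k
    split_ifs with h1
    · rw [put_word h1.1 h1.2, hyu k (by omega) (by omega)]
    · rfl

lemma app_mem (h : S.WordRule v T) (ε : ℤ) {x : ℤ → B} (hx : x ∈ S.X) : S.wapp v T ε x ∈ S.X :=
  S.toZeroSys.app_mem (by omega) K1_nonneg h.sp (h.hmem ε) hx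

lemma app_inv (h : S.WordRule v T) (ε : ℤ) {x : ℤ → B} (hx : x ∈ S.X) :
    S.wapp v T (-ε) (S.wapp v T ε x) = x := by
  refine S.toZeroSys.app_inv' (by omega) K1_nonneg h.sp (h.hmem ε) ?_
    (fun u w hv hk => (h.loc w u hk hv).1) hx
  intro u hu hv w h1 h2 h3
  have hww : S.word w = (cyc (T u) ^ ε) (S.word u) := word_eq h3
  have key : v w ∧ T w = T u := by
    by_cases hw : S.word u ∈ T u
    · exact h.inv u hu hv w h1 h2 hw (by rw [hww]; exact cyc_zpow_mem ε hw)
    · refine h.loc u w (fun k h4 h5 => ?_) hv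
      by_cases h6 : k < 0
      · exact h1 k h4 h6
      · by_cases h7 : k < S.m
        · rw [h3 k (by omega) h7, cyc_zpow_out ε hw, put_word (by omega) h7]
        · exact h2 k (by omega) h5
  refine ⟨key.1, fun a h4 h5 => ?_⟩
  rw [key.2, hww, ← Equiv.Perm.mul_apply, ← zpow_add, neg_add_cancel, zpow_zero,
    Equiv.Perm.one_apply, put_word h4 h5]

lemma localMap (h : S.WordRule v T) (ε : ℤ) : LocalMap (S.wapp v T ε) := by
  have hK1 := K1_nonneg (S := S)
  have hT : ∀ u w, (∀ k, -S.K1 ≤ k → k < S.m + S.K1 → w k = u k) → v u → v w ∧ T w = T u := h.loc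
  unfold wapp
  -- Off the window the inserted word defers to the whole of `u` and is not local. Those values are
  -- never read by `app`, so they are replaced by a constant.
  have : app S.m v (fun u a => S.put ((cyc (T u) ^ ε) (S.word u)) u a) =
      app S.m v (fun u a => open Classical in if v u ∧ 0 ≤ a ∧ a < S.m then
        S.put ((cyc (T u) ^ ε) (S.word u)) u a else S.z 0) := by
    funext x k
    unfold app
    by_cases h1 : ∃ a, 0 ≤ a ∧ a < (S.m : ℤ) ∧ v (shf x (k - a))
    · rw [if_pos h1, if_pos h1]
      have h2 := Classical.epsilon_spec h1
      simp only
      rw [if_pos ⟨h2.2.2, h2.1, h2.2.1⟩]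
    · rw [if_neg h1, if_neg h1]
  rw [this]
  refine app_localMap ⟨(S.m + S.K1).toNat, fun x y hxy => ?_⟩
  have hxy' : ∀ k, -S.K1 ≤ k → k < S.m + S.K1 → y k = x k := fun k h1 h2 =>
    (hxy k (by omega) (by omega)).symm
  refine ⟨fun hv => (hT _ _ hxy' hv).1, fun a => ?_⟩
  by_cases hv : v x
  · obtain ⟨hv', hTT⟩ := hT _ _ hxy' hv
    by_cases ha : 0 ≤ a ∧ a < S.m
    · rw [if_pos ⟨hv, ha⟩, if_pos ⟨hv', ha⟩, hTT,
        word_congr (S := S) (x := x) (y := y) fun k h1 h2 => (hxy' k (by omega) (by omega)).symm]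
      exact put_in ha.1 ha.2
    · rw [if_neg (fun h => ha h.2), if_neg (fun h => ha h.2)]
  · have hv' : ¬ v y := fun hc => hv (hT _ _ (fun k h1 h2 => (hxy' k h1 h2).symm) hc).1
    rw [if_neg (fun h => hv h.1), if_neg (fun h => hv' h.1)]

lemma out (h : S.WordRule v T) {ε : ℤ} {x : ℤ → B} (hx : x ∈ S.X) {k : ℤ}
    (hk : ∀ s, v (shf x s) → s ≤ k → k < s + S.m → S.word (shf x s) ∉ T (shf x s)) :
    S.wapp v T ε x k = x k := by
  have hK1 := K1_nonneg (S := S)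
  by_cases hs : ∃ s, v (shf x s) ∧ s ≤ k ∧ k < s + S.m
  · obtain ⟨s, hs, h1, h2⟩ := hs
    unfold wapp
    rw [app_in (fun s s' a b c => by have := h.sp x hx s s' a b c; omega) hs h1 h2]
    rw [cyc_zpow_out ε (hk s hs h1 h2), put_word (by omega) (by omega), shf_apply, sub_add_cancel]
  · exact app_out fun s h1 h2 => hs ⟨s, h1, h2⟩

lemma win (h : S.WordRule v T) {ε : ℤ} {x : ℤ → B} (hx : x ∈ S.X) {s : ℤ} (hs : v (shf x s)) :
    S.word (shf (S.wapp v T ε x) s) = (cyc (T (shf x s)) ^ ε) (S.word (shf x s)) :=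
  word_eq (y := shf x s) fun k h1 h2 => app_win K1_nonneg (h.sp x hx) hs k h1 h2

end WordRule

variable (S)

/-- The right-infinite continuations of `w`. -/
def FolC (w : Fin S.m → B) : Set (ℤ → B) := Fol S.X (shf (S.put w S.z) S.m)

open Classical in
/-- The phase of a letter of the repeated word. -/
noncomputable def ph (b : B) : ℤ := if h : S.Z b then h.choose else 0

/-- The word `w` with zeros to the left, starting from the letter `b`, and to the right. -/
noncomputable def extD (b : B) (w : Fin S.m → B) : ℤ → B :=
  S.put w fun k => if k < 0 then S.z (k + 1 + S.ph b) else S.z (k - S.m)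

/-- `x` has the word `(Q 0^kap)^n P` at `[i, j)`. -/
def QP (x : ℤ → B) : ℕ → ℤ → ℤ → Prop
  | 0, i, j => S.AtP x i ∧ j = i + S.l
  | n + 1, i, j => S.AtQ x i ∧ S.Zr x (i + S.l) (i + S.l + S.kap) ∧
      QP x n (i + S.l + S.kap) j

variable {S}

lemma z_ph {b : B} (h : S.Z b) : S.z (S.ph b) = b := by
  unfold ph
  rw [dif_pos h]
  exact h.choose_spec.symm

end GliderBase

/-! ### Emitting words, the rules `C` and `D`, and the automaton. -/

/-- A `GliderBase` together with the words `eC F`, `eD b` which emit gliders. -/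
structure GliderSys (B : Type) extends GliderBase B where
  eC : Set (ℤ → B) → (Fin m → B)
  eD : B → (Fin m → B)
  eC_spec : ∀ w, ¬ toGliderBase.Z (toGliderBase.put w z 0) → (toGliderBase.FolC w).Nonempty →
    toGliderBase.AtQ (toGliderBase.put (eC (toGliderBase.FolC w)) z) 0 ∧
    toGliderBase.Zr (toGliderBase.put (eC (toGliderBase.FolC w)) z) l (l + kap) ∧
    ¬ toGliderBase.Z (toGliderBase.put (eC (toGliderBase.FolC w)) z (l + kap)) ∧
    toGliderBase.FolC (eC (toGliderBase.FolC w)) = toGliderBase.FolC w ∧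
    ∀ a : ℤ, 0 ≤ a → a < m → toGliderBase.Zr (toGliderBase.put (eC (toGliderBase.FolC w)) z) a m →
      toGliderBase.Zr (toGliderBase.put w z) a m
  eD_spec : ∀ b w, toGliderBase.Z b → toGliderBase.extD b w ∈ X →
    ¬ toGliderBase.Z (toGliderBase.extD b w (m - 1)) →
    toGliderBase.extD b (eD b) ∈ X ∧ ∃ n : ℕ, ∃ f : ℤ, 0 ≤ f ∧
      toGliderBase.Zr (toGliderBase.extD b (eD b)) 0 f ∧
      toGliderBase.QP (toGliderBase.extD b (eD b)) (n + 1) f m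

namespace GliderSys

open ZeroSys GliderBase

variable (S : GliderSys B)

/-- The lengths of the runs of zeros starting at `m`, up to `K`. -/
def Lam (u : ℤ → B) : Set ℤ := {c | c ≤ S.K ∧ S.Zr u S.m (S.m + c)}

/-- Equal follower sets keep the configuration in the subshift. The clause on `L` forbids trailing
zeros that would join the zeros to the right into a run of length `K`, so the condition `vC`
survives the exchange. The last clause freezes words beginning with a free kernel, with the emitting
word as the only exception. -/
def SC (F : Set (ℤ → B)) (L : Set ℤ) : Set (Fin S.m → B) :=
  {w | ¬ S.Z (S.put w S.z 0) ∧ S.FolC w = F ∧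
    (∀ a : ℤ, 0 ≤ a → a < S.m → S.Zr (S.put w S.z) a S.m → a + S.K - S.m ∉ L) ∧
    (¬ S.Free (S.put w S.z) 0 ∨ w = S.eC F)}

def vC (u : ℤ → B) : Prop :=
  S.Zr u (-S.K1) 0 ∧ ¬ S.Z (u 0) ∧ ∀ a : ℤ, 0 ≤ a → a ≤ S.m → ¬ S.Zr u a (a + S.K)

def TC (u : ℤ → B) : Set (Fin S.m → B) := S.SC (S.FolC (S.word u)) (S.Lam u)

/-- The letter `b` stands just left of the window and fixes the phase of the zeros there. The window
may begin with zeros, so freezing refers to the first nonzero letter. -/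
def SD (b : B) : Set (Fin S.m → B) :=
  {w | S.extD b w ∈ S.X ∧ ¬ S.Z (S.extD b w (S.m - 1)) ∧
    ((¬ ∃ f : ℤ, 0 ≤ f ∧ f < S.m ∧ S.Zr (S.extD b w) 0 f ∧ S.Free (S.extD b w) f) ∨ w = S.eD b)}

def vD (u : ℤ → B) : Prop :=
  S.Zr u (-S.K1) 0 ∧ S.Zr u S.m (S.m + S.K) ∧ ¬ S.Z (u (S.m - 1))

def TD (u : ℤ → B) : Set (Fin S.m → B) := S.SD (u (-1))

variable {S}

lemma vC_shf {x : ℤ → B} {s : ℤ} : S.vC (shf x s) ↔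
    S.Zr x (s - S.K1) s ∧ ¬ S.Z (x s) ∧ ∀ a : ℤ, s ≤ a → a ≤ s + S.m → ¬ S.Zr x a (a + S.K) := by
  unfold vC
  rw [Zr.shf_iff, zero_add, neg_add_eq_sub, shf_apply, zero_add]
  refine and_congr_right fun _ => and_congr_right fun _ => ⟨fun h a h1 h2 h3 => ?_,
    fun h a h1 h2 h3 => ?_⟩
  · refine h (a - s) (by omega) (by omega) (Zr.shf_iff.2 (h3.mono (by omega) (by omega)))
  · exact h (a + s) (by omega) (by omega) ((Zr.shf_iff.1 h3).mono (by omega) (by omega))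

lemma vD_shf {x : ℤ → B} {s : ℤ} : S.vD (shf x s) ↔
    S.Zr x (s - S.K1) s ∧ S.Zr x (s + S.m) (s + S.m + S.K) ∧ ¬ S.Z (x (s + S.m - 1)) := by
  unfold vD
  rw [Zr.shf_iff, Zr.shf_iff, zero_add, neg_add_eq_sub, shf_apply]
  have e1 : S.m + s = s + S.m := by ring
  have e2 : S.m + S.K + s = s + S.m + S.K := by ring
  have e3 : S.m - 1 + s = s + S.m - 1 := by ring
  rw [e1, e2, e3]

lemma vC.congr {u w : ℤ → B} (hv : S.vC u) (hz : S.Zr w (-S.K1) 0)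
    (h : ∀ k : ℤ, 0 ≤ k → k < S.m + S.K → w k = u k) : S.vC w ∧ S.TC w = S.TC u := by
  have hl := S.hl
  have hlk := S.hlk
  have hm := S.hm
  have hK := S.hK
  refine ⟨⟨hz, ?_, ?_⟩, ?_⟩
  · rw [h 0 (by omega) (by omega)]; exact hv.2.1
  · intro a h3 h4 h5
    exact hv.2.2 a h3 h4 (h5.congr fun k h7 h8 => (h k (by omega) (by omega)).symm)
  · unfold TC
    rw [word_congr (S := S.toGliderBase) fun k h1 h2 => h k h1 (by omega)]
    congr 1
    ext c
    refine and_congr_right fun h3 => ⟨fun h4 => h4.congr ?_, fun h4 => h4.congr ?_⟩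
    · intro k h4 h5; exact (h k (by omega) (by omega)).symm
    · intro k h4 h5; exact h k (by omega) (by omega)

/-- The zeros preceding the word are aligned with it, so everything further left can be replaced by
zeros without affecting what may follow. -/
lemma folC_word {y : ℤ → B} (hy : y ∈ S.X) (z1 : S.Zr y (-S.K1) 0) (hy0 : ¬ S.Z (y 0)) :
    shf y S.m ∈ S.FolC (S.word y) := by
  have hK1 : S.K1 = S.K + S.p := rfl
  have := S.pp
  have hl := S.hl
  have hlk := S.hlk
  have hm := S.hm
  have hK := S.hK
  have hpk := S.hpk
  have a1 := align_left hy z1 hy0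
  have g1 : glue S.z y 0 ∈ S.X := glue_mem S.z_mem hy (fun k _ _ => Z_z k)
    fun k h1 h2 => by rw [a1 k (by omega) h2, sub_zero]
  have := S.shift_mem _ g1 S.m
  change glue _ _ 0 ∈ S.X
  convert this using 1
  funext k
  unfold glue
  simp only [shf_apply]
  split_ifs with h1 h2 h2
  · exact put_out (by omega)
  · rw [put_word (by omega) (by omega)]
  · omega
  · rfl

/-- A second site too close to the first is impossible because the zeros in front of it would form a
run of length `K` starting within `m` of the first. An exchange stays in the subshift because the
new word has the same follower set, tested on the actual right continuation. -/
lemma ruleC : S.WordRule S.vC S.TC where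
  sp x _ s s' h h' hs := by
    rw [vC_shf] at h h'
    have hK1 : S.K1 = S.K + S.p := rfl
    have := S.pp
    rcases nonzero_or h'.1 h.2.1 with h3 | h3
    · by_contra hc
      exact h.2.2 (s' - S.K1) h3.le (by omega) (h'.1.mono le_rfl (by omega))
    · omega
  inv u _ hv w h1 h2 hu hw := by
    have hK1 : S.K1 = S.K + S.p := rfl
    have := S.pp
    have hpw : ∀ k : ℤ, 0 ≤ k → k < S.m → S.put (S.word w) S.z k = w k := fun k => put_word
    have hL : S.Lam w = S.Lam u := by
      ext c
      refine and_congr_right fun h3 => ⟨fun h => h.congr ?_, fun h => h.congr ?_⟩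
      · intro k h4 h5; exact (h2 k h4 (by omega)).symm
      · intro k h4 h5; exact h2 k h4 (by omega)
    have hl := S.hl
    have hlk := S.hlk
    have hm := S.hm
    have hK := S.hK
    refine ⟨⟨hv.1.congr h1, ?_, ?_⟩, ?_⟩
    · have := hw.1
      rwa [hpw 0 le_rfl (by omega)] at this
    · intro a h3 h4 h5
      rcases h4.lt_or_eq with h6 | h6
      · refine hw.2.2.1 a h3 h6 ((h5.mono le_rfl (by omega)).congr
          fun k h7 h8 => hpw k (by omega) h8) ?_
        rw [← hL]
        exact ⟨by omega, h5.mono (by omega) (by omega)⟩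
      · subst h6
        exact hv.2.2 _ h3 h4 (h5.congr fun k h7 h8 => (h2 k h7 (by omega)).symm)
    · unfold TC
      rw [hL, hw.2.1]
  loc u w h hv := by
    have hK1 : S.K1 = S.K + S.p := rfl
    have := S.pp
    have := S.hl
    have := S.hlk
    have := S.hK
    exact hv.congr (hv.1.congr fun k h1 h2 => h k h1 (by omega))
      fun k h1 h2 => h k (by omega) (by omega)
  mem u hu hv w hw y hy h := by
    have hK1 : S.K1 = S.K + S.p := rfl
    have := S.pp
    have hl := S.hl
    have hlk := S.hlk
    have hm := S.hm
    have hK := S.hK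
    have hpk := S.hpk
    have z1 : S.Zr y (-S.K1) 0 := hv.1.congr fun k h1 h2 => h k h1 (by omega)
    have hy0 : ¬ S.Z (y 0) := by rw [h 0 (by omega) (by omega)]; exact hv.2.1
    have a1 := align_left hy z1 hy0
    have g2 : shf y S.m ∈ S.FolC w := by
      rw [hw.2.1, ← word_congr (S := S.toGliderBase) fun k h1 h2 => h k (by omega) (by omega)]
      exact folC_word hy z1 hy0
    have g3 := S.shift_mem _ g2 (-S.m)
    have g4 := glue_mem hy g3 (c := 0) (z1.mono (by omega) le_rfl) (fun k h1 h2 => by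
      rw [shf_apply, glue_lt (by omega), shf_apply, put_out (by omega), a1 k (by omega) h2]
      congr 1; ring)
    convert g4 using 1
    funext k
    by_cases h1 : k < 0
    · rw [put_out (by omega), glue_lt h1]
    · rw [glue_ge (by omega), shf_apply]
      by_cases h2 : k < S.m
      · rw [glue_lt (by omega), shf_apply, neg_add_cancel_right]
        exact put_in (by omega) h2
      · rw [glue_ge (by omega), shf_apply, neg_add_cancel_right, put_out (by omega)]

/-- The window is bordered by zeros on both sides, so membership is a matter of phases only, and the
permuted set depends on nothing but the letter before the window. -/
lemma ruleD : S.WordRule S.vD S.TD where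
  sp x _ s s' h h' hs := by
    rw [vD_shf] at h h'
    have hl := S.hl
    have hlk := S.hlk
    have hm := S.hm
    have hK := S.hK
    have hK1 : S.K1 = S.K + S.p := rfl
    have := S.pp
    rcases nonzero_or h'.1 h.2.2 with h3 | h3
    · omega
    · rcases nonzero_or h.2.1 h'.2.2 with h4 | h4 <;> omega
  inv u _ hv w h1 h2 hu hw := by
    have hl := S.hl
    have hlk := S.hlk
    have hm := S.hm
    have hK := S.hK
    have hK1 : S.K1 = S.K + S.p := rfl
    have := S.pp
    refine ⟨⟨hv.1.congr h1, hv.2.1.congr fun k h3 h4 => h2 k h3 (by omega), ?_⟩, ?_⟩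
    · have := hw.2.1
      rw [extD, put_word (by omega) (by omega)] at this
      exact this
    · unfold TD; rw [h1 _ (by omega) (by omega)]
  loc u w h hv := by
    have hl := S.hl
    have hlk := S.hlk
    have hm := S.hm
    have hK := S.hK
    have hK1 : S.K1 = S.K + S.p := rfl
    have := S.pp
    refine ⟨⟨hv.1.congr fun k h1 h2 => h k h1 (by omega),
      hv.2.1.congr fun k h3 h4 => h k (by omega) (by omega), ?_⟩, ?_⟩
    · rw [h _ (by omega) (by omega)]; exact hv.2.2
    · unfold TD; rw [h _ (by omega) (by omega)]
  mem u hu hv w hw y hy h := by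
    have hK1 : S.K1 = S.K + S.p := rfl
    have := S.pp
    have hl := S.hl
    have hlk := S.hlk
    have hm := S.hm
    have hK := S.hK
    have hpk := S.hpk
    have z1 : S.Zr y (-S.K1) 0 := hv.1.congr fun k h1 h2 => h k h1 (by omega)
    have z2 : S.Zr y S.m (S.m + S.K) := hv.2.1.congr fun k h1 h2 => h k (by omega) (by omega)
    have hlast : ¬ S.Z (y (S.m - 1)) := by rw [h _ (by omega) (by omega)]; exact hv.2.2
    have a2 := align_right hy z2 hlast
    have hb : S.z (S.ph (u (-1))) = y (-1) := by
      rw [z_ph (hv.1 _ (by omega) (by omega)), h _ (by omega) (by omega)]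
    have a1 : ∀ k, -(2 * S.p : ℤ) ≤ k → k < 0 → S.z (k + 1 + S.ph (u (-1))) = y k := by
      intro k h1 h2
      obtain ⟨e, he⟩ := z1 k (by omega) h2
      have := run hy (z1.mono (by omega) le_rfl) he (-1) (by omega) (by omega)
      rw [← hb, S.z_eq] at this
      rw [he]
      apply z_congr
      convert this using 1; ring
    have := replace_mem hy hw.1 (z1.mono (by omega) le_rfl) (n := S.m) (fun k h1 h2 => ?_)
      (z2.mono (by omega) (by omega)) (fun k h1 h2 => ?_)
    · convert this using 1
      funext k
      split_ifs with h1
      · exact put_in h1.1 h1.2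
      · exact put_out (by omega)
    · rw [extD, put_out (by omega), if_pos h2, a1 k h1 h2]
    · rw [extD, put_out (by omega), if_neg (by omega), a2 k (by omega) (by omega)]

variable [Finite B]

variable (S) in
noncomputable def C (ε : ℤ) : (ℤ → B) → ℤ → B := S.wapp S.vC S.TC ε

variable (S) in
noncomputable def D (ε : ℤ) : (ℤ → B) → ℤ → B := S.wapp S.vD S.TD ε

variable (S) in
/-- The glider automaton. -/
noncomputable def G (x : ℤ → B) : ℤ → B := S.I2 (S.I1 (S.C 1 (S.D 1 x)))

variable (S) in
noncomputable def Ginv (x : ℤ → B) : ℤ → B := S.D (-1) (S.C (-1) (S.I1 (S.I2 x)))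

lemma G_mem {x : ℤ → B} (hx : x ∈ S.X) : S.G x ∈ S.X :=
  I2_mem (I1_mem (ruleC.app_mem 1 (ruleD.app_mem 1 hx)))

lemma Ginv_mem {x : ℤ → B} (hx : x ∈ S.X) : S.Ginv x ∈ S.X :=
  ruleD.app_mem _ (ruleC.app_mem _ (I1_mem (I2_mem hx)))

lemma Ginv_G {x : ℤ → B} (hx : x ∈ S.X) : S.Ginv (S.G x) = x := by
  unfold G Ginv C D
  have h1 := ruleD.app_mem 1 hx
  have h2 := ruleC.app_mem 1 h1
  rw [I2_inv (I1_mem h2), I1_inv h2, ruleC.app_inv 1 h1, ruleD.app_inv 1 hx]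

lemma G_Ginv {x : ℤ → B} (hx : x ∈ S.X) : S.G (S.Ginv x) = x := by
  unfold G Ginv C D
  have h1 := I2_mem hx
  have h2 := I1_mem h1
  have h3 := ruleC.app_mem (-1) h2
  have e1 := ruleD.app_inv (-1) h3
  have e2 := ruleC.app_inv (-1) h2
  rw [neg_neg] at e1 e2
  rw [e1, e2, I1_inv h1, I2_inv hx]

lemma G_localMap : LocalMap S.G :=
  I2_localMap.comp (I1_localMap.comp ((ruleC.localMap 1).comp (ruleD.localMap 1)))

end GliderSys

/-! ### Motion of leftbound fleets and of the first kernel behind them. -/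

namespace GliderBase

open ZeroSys

variable {S : GliderBase B}

variable (S) in
lemma par : (0 : ℤ) < S.p ∧ 0 < S.l ∧ S.l ≤ S.kap ∧ 2 * (S.p : ℤ) ≤ S.kap ∧
    2 * (S.l + S.kap) ≤ S.m ∧ S.m + S.l + 2 * S.kap ≤ S.K ∧ S.K1 = S.K + S.p :=
  ⟨S.pp, S.hl, S.hlk, S.hpk, S.hm, S.hK, rfl⟩

lemma I1_out {x : ℤ → B} {k : ℤ}
    (h : ∀ s, S.Zr x (s - S.K1) s → S.Free x s → ¬ (s ≤ k ∧ k < s + S.l)) : S.I1 x k = x k :=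
  app_out fun s hs => h s (v1_shf.1 hs).1 (v1_shf.1 hs).2

lemma I1_in {x : ℤ → B} {s : ℤ} (h : S.Zr x (s - S.K1) s) (h' : S.Free x s) {k : ℤ} (h1 : 0 ≤ k)
    (h2 : k < S.l) : S.I1 x (s + k) = S.t1 (shf x s) k := by
  have := app_in (n := S.l) (v := S.v1) (t := S.t1) (x := x) (s := s) (k := s + k)
    (fun s s' a b c => by
      have := v1_sp a b c
      have := S.par
      omega) (v1_shf.2 ⟨h, h'⟩) (by omega) (by omega)
  rw [add_sub_cancel_left] at this
  exact this

lemma I1_Q {x : ℤ → B} {s : ℤ} (h : S.Zr x (s - S.K1) s) (h' : S.AtQ x s)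
    (h2 : S.Zr x (s + S.l) (s + S.l + S.kap)) : S.AtP (S.I1 x) s := fun k h3 h4 => by
  rw [I1_in h ⟨Or.inr h', h2⟩ h3 h4, t1_Q (by rw [AtQ.shf_iff, zero_add]; exact h')]

lemma I1_P {x : ℤ → B} {s : ℤ} (h : S.Zr x (s - S.K1) s) (h' : S.AtP x s)
    (h2 : S.Zr x (s + S.l) (s + S.l + S.kap)) : S.AtQ (S.I1 x) s := fun k h3 h4 => by
  rw [I1_in h ⟨Or.inl h', h2⟩ h3 h4, t1_P (by rw [AtP.shf_iff, zero_add]; exact h')]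

lemma I1_run {x : ℤ → B} {a b : ℤ} (h : S.Zr x a b) (hab : S.l ≤ b - a) :
    ∀ k, a ≤ k → k < b → S.I1 x k = x k := by
  intro k h1 h2
  refine I1_out fun s hs hf hk => ?_
  have := S.par
  rcases nonzero_or h hf.first with h3 | h3 <;> rcases nonzero_or h hf.last with h4 | h4 <;> omega

lemma I1_zr {x : ℤ → B} {a b : ℤ} (h : S.Zr x a b) (hab : S.l ≤ b - a) : S.Zr (S.I1 x) a b :=
  h.congr (I1_run h hab)

lemma zr_I1 {x : ℤ → B} (hx : x ∈ S.X) {a b : ℤ} (h : S.Zr (S.I1 x) a b) (hab : S.l ≤ b - a) :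
    S.Zr x a b := by
  have := I1_zr h hab
  rwa [I1_inv hx] at this

/-- All nonzero letters of `x` to the left of `a` belong to leftbound gliders. -/
def LF (S : GliderBase B) (x : ℤ → B) (a : ℤ) : Prop :=
  (∃ A, ∀ k < A, S.Z (x k)) ∧ ∀ k < a, ¬ S.Z (x k) → ∃ q, q ≤ k ∧ k < q + S.l ∧ S.AtQ x q ∧
    S.Zr x (q - S.K1) q ∧ S.Zr x (q + S.l) (q + S.l + S.kap) ∧ q + S.l + S.kap ≤ a

lemma LF.congr {x y : ℤ → B} {a : ℤ} (h : S.LF x a) (hxy : ∀ k < a, y k = x k) : S.LF y a := by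
  have := S.par
  obtain ⟨⟨A, hA⟩, h⟩ := h
  refine ⟨⟨min A a, fun k hk => ?_⟩, fun k hk hz => ?_⟩
  · rw [hxy k (by omega)]; exact hA k (by omega)
  · rw [hxy k hk] at hz
    obtain ⟨q, h1, h2, h3, h4, h5, h6⟩ := h k hk hz
    exact ⟨q, h1, h2, h3.congr fun k _ _ => hxy _ (by omega),
      h4.congr fun k _ _ => hxy _ (by omega), h5.congr fun k _ _ => hxy _ (by omega), h6⟩

lemma LF.extend {x : ℤ → B} {a b : ℤ} (h : S.LF x a) (hz : S.Zr x a b) (hab : a ≤ b) :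
    S.LF x b := by
  refine ⟨h.1, fun k hk hkz => ?_⟩
  rcases nonzero_or hz hkz with h1 | h1
  · obtain ⟨q, h1, h2, h3, h4, h5, h6⟩ := h.2 k h1 hkz
    exact ⟨q, h1, h2, h3, h4, h5, by omega⟩
  · omega

lemma LF.zr {x : ℤ → B} {a : ℤ} (h : S.LF x a) : S.Zr x (a - S.kap) a := by
  intro k h1 h2
  by_contra hc
  obtain ⟨q, h1, h2, h3, h4, h5, h6⟩ := h.2 k h2 hc
  omega

/-- A nonzero letter preceded by many zeros in a fleet starts a glider. -/
lemma LF.start {x : ℤ → B} {a : ℤ} (h : S.LF x a) {s : ℤ} (hs : s < a) (hz : ¬ S.Z (x s))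
    {n : ℤ} (hn : S.l ≤ n) (h0 : S.Zr x (s - n) s) : S.AtQ x s ∧ S.Zr x (s - S.K1) s ∧
    S.Zr x (s + S.l) (s + S.l + S.kap) ∧ s + S.l + S.kap ≤ a := by
  obtain ⟨q, h1, h2, h3, h4, h5, h6⟩ := h.2 s hs hz
  have : q = s := by
    rcases nonzero_or h0 h3.first with h7 | h7 <;> omega
  subst this
  exact ⟨h3, h4, h5, h6⟩

lemma LF.add {x : ℤ → B} {a : ℤ} (h : S.LF x a) (h1 : S.AtQ x a) (h2 : S.Zr x (a - S.K1) a)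
    (h3 : S.Zr x (a + S.l) (a + S.l + S.kap)) : S.LF x (a + S.l + S.kap) := by
  have := S.par
  refine ⟨h.1, fun k hk hkz => ?_⟩
  by_cases hk' : k < a
  · obtain ⟨q, h1, h2, h3, h4, h5, h6⟩ := h.2 k hk' hkz
    exact ⟨q, h1, h2, h3, h4, h5, by omega⟩
  · refine ⟨a, by omega, ?_, h1, h2, h3, le_rfl⟩
    rcases nonzero_or h3 hkz with h4 | h4 <;> omega

variable {u : ℤ → B} {a : ℤ}

/-- Within a fleet `I1` acts on every kernel and on nothing else, so afterwards all kernels are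
copies of P. -/
lemma LF.I1_nonzero (h : S.LF u a) {c : ℤ} (hc : c < a) (hz : ¬ S.Z (S.I1 u c)) :
    ∃ q, q ≤ c ∧ c < q + S.l ∧ S.AtQ u q ∧ S.AtP (S.I1 u) q ∧ S.Zr u (q - S.K1) q ∧
      S.Zr u (q + S.l) (q + S.l + S.kap) ∧ q + S.l + S.kap ≤ a := by
  have hp := S.par
  by_cases hs : ∃ s, S.Zr u (s - S.K1) s ∧ S.Free u s ∧ (s ≤ c ∧ c < s + S.l)
  · obtain ⟨s, h1, h2, h3, h4⟩ := hs
    obtain ⟨h5, h6, h7, h8⟩ := h.start (by omega) h2.first (n := S.K1) (by omega) h1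
    exact ⟨s, h3, h4, h5, I1_Q h6 h5 h7, h6, h7, h8⟩
  · push Not at hs
    rw [I1_out fun s h1 h2 h3 => absurd h3.2 (not_lt.2 (hs s h1 h2 h3.1))] at hz
    obtain ⟨q, h1, h2, h3, h4, h5, h6⟩ := h.2 c hc hz
    exact ⟨q, h1, h2, h3, I1_Q h4 h3 h5, h4, h5, h6⟩

/-- Verifies the negative clause of `v2` behind a fleet: after `I1` no kernel of the fleet is a Q.
-/
lemma LF.not_AtQ (h : S.LF u a) {s : ℤ} (hs : s ≤ a) (hz : S.Zr (S.I1 u) s (s + S.l)) :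
    ¬ S.AtQ (S.I1 u) (s - S.l) := by
  have hp := S.par
  intro hq
  have hla := hq.last
  rw [sub_add_cancel] at hla
  obtain ⟨q, h1, h2, h3, h4, h5, h6, h7⟩ := h.I1_nonzero (by omega) hla
  have : q = s - S.l := by
    rcases nonzero_or hz h4.last with h8 | h8 <;> omega
  subst this
  exact not_AtP_AtQ h4 hq

lemma I2_out {x : ℤ → B} {k : ℤ} (h : ∀ s, S.Zr x (s - S.K) s → S.Mid x s →
    S.Zr x (s + S.l + S.p) (s + S.l + S.p + S.kap) → ¬ (s ≤ k ∧ k < s + S.l + S.p)) :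
    S.I2 x k = x k :=
  app_out fun s hs => by
    have := h s (v2_shf.1 hs).1 (v2_shf.1 hs).2.1 (v2_shf.1 hs).2.2.1
    rwa [add_assoc] at this

lemma I2_in {x : ℤ → B} (hx : x ∈ S.X) {s : ℤ} (h : S.v2 (shf x s)) {k : ℤ} (h1 : 0 ≤ k)
    (h2 : k < S.l + S.p) : S.I2 x (s + k) = S.t2 (shf x s) k := by
  have := app_in (n := S.l + S.p) (v := S.v2) (t := S.t2) (x := x) (s := s) (k := s + k)
    (fun s s' a b c => by
      have := v2_sp hx a b c
      have := S.par
      omega) h (by omega) (by omega)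
  rw [add_sub_cancel_left] at this
  exact this

lemma I2_P {x : ℤ → B} (hx : x ∈ S.X) {s : ℤ} (h : S.Zr x (s - S.K1) s) (h' : S.AtP x s)
    (h2 : S.Zr x (s + S.l) (s + S.l + S.kap)) (h3 : ¬ S.AtQ x (s - S.K1 - S.l)) {k : ℤ}
    (hk : 0 ≤ k) (hk' : k < S.l + S.p) : S.I2 x (s - S.p + k) = S.Q k := by
  have hp := S.par
  have h4 : S.Zr x (s - S.p) s := h.mono (by omega) le_rfl
  have e : s - S.p + S.p = s := by ring
  rw [I2_in hx (v2_shf.2 ⟨h.mono (by omega) (by omega), Or.inl ⟨by rwa [e], by rwa [e]⟩,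
    h2.mono (by omega) (by omega), by convert h3 using 2; omega⟩) hk hk', t2_P]
  intro hq
  rw [AtQ.shf_iff, zero_add] at hq
  exact hq.first (h4 _ le_rfl (by omega))

lemma I2_Q {x : ℤ → B} (hx : x ∈ S.X) {s : ℤ} (h : S.Zr x (s - S.K) s) (h' : S.AtQ x s)
    (h2 : S.Zr x (s + S.l) (s + S.l + S.kap + S.p)) (h3 : ¬ S.AtQ x (s - S.K - S.l)) {k : ℤ}
    (hk : 0 ≤ k) (hk' : k < S.l + S.p) : S.I2 x (s + k) = S.P (k - S.p) := by
  have hp := S.par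
  rw [I2_in hx (v2_shf.2 ⟨h, Or.inr ⟨h', h2.mono le_rfl (by omega)⟩,
    h2.mono (by omega) (by omega), h3⟩) hk hk', t2_Q (by rw [AtQ.shf_iff, zero_add]; exact h')]
  rfl

/-- Sites of the second rule in a fleet. -/
lemma LF.site (h : S.LF u a) {s : ℤ} (hs : s < a - S.p) (h1 : S.Zr (S.I1 u) (s - S.K) s)
    (h2 : S.Mid (S.I1 u) s) : S.AtQ u (s + S.p) ∧ s + S.p + S.l + S.kap ≤ a := by
  have hp := S.par
  rcases h2 with ⟨h3, h4⟩ | ⟨h3, h4⟩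
  · obtain ⟨q, h5, h6, h7, h8, -, -, h9⟩ := h.I1_nonzero (by omega) h4.first
    have : q = s + S.p := by
      rcases nonzero_or (h1.append h3) h8.first with h8 | h8 <;> omega
    subst this
    exact ⟨h7, by omega⟩
  · obtain ⟨q, h5, h6, h7, h8, -, -, h9⟩ := h.I1_nonzero (by omega) h3.first
    have : q = s := by
      rcases nonzero_or h1 h8.first with h8 | h8 <;> omega
    subst this
    exact (not_AtP_AtQ h8 h3).elim

/-- Fleets of leftbound gliders move left. -/
lemma LF.step (hu : u ∈ S.X) (h : S.LF u a) {k : ℤ} (hk : k < a - S.p) :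
    S.I2 (S.I1 u) k = u (k + S.p) := by
  have hp := S.par
  by_cases hq : ∃ q, q - S.p ≤ k ∧ k < q + S.l ∧ q < a ∧ S.AtQ u q ∧ S.Zr u (q - S.K1) q ∧
      S.Zr u (q + S.l) (q + S.l + S.kap)
  · obtain ⟨q, h1, h2, h3, h4, h5, h6⟩ := hq
    have := I2_P (I1_mem hu) (I1_zr h5 (by omega)) (I1_Q h5 h4 h6) (I1_zr h6 (by omega))
      (h.not_AtQ (by omega) (I1_zr (h5.mono le_rfl (by omega)) (by omega)))
      (k := k - q + S.p) (by omega) (by omega)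
    rw [show q - S.p + (k - q + S.p) = k by ring] at this
    rw [this, ← eq_mid_Q hu h4 (h6.mono le_rfl (by omega)) _ (by omega) (by omega)]
    congr 1; ring
  -- Away from the kernels all letters from `k` to `k + p` are zeros, and a shift by one period is
  -- invisible there.
  · have hz : S.Zr u k (k + S.p + 1) := by
      intro c h1 h2
      by_contra hc
      obtain ⟨q, h3, h4, h5, h6, h7, h8⟩ := h.2 c (by omega) hc
      exact hq ⟨q, by omega, by omega, by omega, h5, h6, h7⟩
    rw [I2_out, I1_out]
    · obtain ⟨e, he⟩ := hz k le_rfl (by omega)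
      rw [run hu hz he (k + S.p) (by omega) (by omega), he]
      exact z_congr ⟨-1, by ring⟩
    · intro s h1 h2 h3
      obtain ⟨h4, h5, h6, h7⟩ := h.start (by omega) h2.first (n := S.K1) (by omega) h1
      exact hq ⟨s, by omega, by omega, by omega, h4, h5, h6⟩
    · intro s h1 h2 h3 h4
      obtain ⟨h5, h6⟩ := h.site (by omega) h1 h2
      obtain ⟨q, h7, h8, h9, h10, h11, h12⟩ := h.2 (s + S.p) (by omega) h5.first
      refine hq ⟨s + S.p, by omega, by omega, by omega, h5, ?_⟩
      have : q = s + S.p := by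
        have h1' := zr_I1 hu h1 (by omega)
        rcases nonzero_or h1' h9.first with h13 | h13
        · omega
        · by_contra hne
          rcases h2 with ⟨h3, h4⟩ | ⟨h3, h4⟩
          · have := I1_Q h10 h9 h11
            rcases nonzero_or h3 this.first with h14 | h14 <;> omega
          · obtain ⟨q', g1, g2, g3, g4, g5, g6, g7⟩ := h.I1_nonzero (by omega) h3.first
            have : q' = s := by rcases nonzero_or h1 g4.first with h14 | h14 <;> omega
            subst this
            exact not_AtP_AtQ g4 h3
      subst this
      exact ⟨h10, h11⟩

lemma LF.next (hu : u ∈ S.X) (h : S.LF u a) : S.LF (S.I2 (S.I1 u)) (a - S.p) := by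
  have hp := S.par
  obtain ⟨A, hA⟩ := h.1
  have hs := fun k (hk : k < a - S.p) => h.step hu hk
  refine ⟨⟨min (A - S.p) (a - S.p), fun k hk => ?_⟩, fun k hk hz => ?_⟩
  · rw [hs k (by omega)]; exact hA _ (by omega)
  · rw [hs k hk] at hz
    obtain ⟨q, h1, h2, h3, h4, h5, h6⟩ := h.2 _ (by omega) hz
    refine ⟨q - S.p, by omega, by omega, h3.congr fun j h7 h8 => ?_, fun j h7 h8 => ?_,
      fun j h7 h8 => ?_, by omega⟩
    · rw [hs _ (by omega)]; congr 1; ring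
    · rw [hs _ (by omega)]; exact h4 _ (by omega) (by omega)
    · rw [hs _ (by omega)]; exact h5 _ (by omega) (by omega)

/-- No site starts in the open interval from `i` to `E`. -/
def NS (S : GliderBase B) (x : ℤ → B) (i E : ℤ) : Prop := ∀ s, i < s → s < E → ¬ S.Zr x (s - S.K) s

lemma NS.congr {x y : ℤ → B} {i E : ℤ} (h : S.NS x i E) (hxy : ∀ k < E, y k = x k) :
    S.NS y i E := fun s h1 h2 h3 => h s h1 h2 (h3.congr fun k _ _ => (hxy k (by omega)).symm)

lemma NS.mono {x : ℤ → B} {i j E : ℤ} (h : S.NS x i E) (hij : i ≤ j) : S.NS x j E :=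
  fun s h1 => h s (by omega)

variable {E : ℤ}

/-- Sites left of `a` belong to the fleet and end at least `kap` before `a`; sites right of `a` are
excluded by `NS`. Only `a` itself could be a site, and `hv` excludes it. -/
lemma I1_head (h : S.LF u a) (hns : S.NS u a E)
    (hv : ¬ (S.Zr u (a - S.K1) a ∧ S.Free u a)) {k : ℤ} (hk : a - S.kap ≤ k) (hk' : k < E) :
    S.I1 u k = u k := by
  have hp := S.par
  refine I1_out fun s h1 h2 h3 => ?_
  rcases lt_trichotomy s a with h4 | h4 | h4
  · have := (h.start h4 h2.first (n := S.K1) (by omega) h1).2.2.2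
    omega
  · subst h4; exact hv ⟨h1, h2⟩
  · exact hns s h4 (by omega) (h1.mono (by omega) le_rfl)

lemma I1_head' (h : S.LF u a) (hns : S.NS u a E) {k : ℤ} (hk : a - S.kap ≤ k) (hk' : k < E)
    (hka : k < a ∨ a + S.l ≤ k) : S.I1 u k = u k := by
  have hp := S.par
  refine I1_out fun s h1 h2 h3 => ?_
  rcases lt_trichotomy s a with h4 | h4 | h4
  · have := (h.start h4 h2.first (n := S.K1) (by omega) h1).2.2.2
    omega
  · omega
  · exact hns s h4 (by omega) (h1.mono (by omega) le_rfl)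

/-- Only two windows of `I2` can reach this region: 0P with its P at `a`, and Q0 with its Q at `a`.
The hypotheses `hP` and `hQ` say that `k` avoids these windows whenever they are present. -/
lemma I2_head (hu : u ∈ S.X) (h : S.LF u a) (ha : ¬ S.Z (S.I1 u a)) (hns : S.NS u a E)
    {k : ℤ} (hk : a - S.p ≤ k) (hk' : k < E)
    (hP : S.Zr u (a - S.K1) a → S.AtP (S.I1 u) a → S.Zr u (a + S.l) (a + S.l + S.kap) →
      a + S.l ≤ k)
    (hQ : S.Zr u (a - S.K) a → S.AtQ (S.I1 u) a → S.Zr u (a + S.l) (a + S.l + S.kap + S.p) →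
      k < a ∨ a + S.l + S.p ≤ k) :
    S.I2 (S.I1 u) k = S.I1 u k := by
  have hp := S.par
  refine I2_out fun s h1 h2 h3 h4 => ?_
  have h1' := zr_I1 hu h1 (by omega)
  have h3' := zr_I1 hu h3 (by omega)
  rcases lt_trichotomy s a with h5 | h5 | h5
  · rcases lt_trichotomy s (a - S.p) with h6 | h6 | h6
    · have := (h.site h6 h1 h2).2
      omega
    · rcases h2 with ⟨h7, h8⟩ | ⟨h7, h8⟩
      · have e : s + S.p = a := by omega
        rw [e] at h8 h7
        have := hP (zr_I1 hu ((h1.append h7).mono (by omega) le_rfl) (by omega)) h8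
          (h3'.mono (by omega) (by omega))
        omega
      · exact h7.first (I1_zr (h.zr) (by omega) s (by omega) (by omega))
    · rcases h2 with ⟨h7, h8⟩ | ⟨h7, h8⟩
      · rcases nonzero_or (h1.append h7) ha with h9 | h9 <;> omega
      · exact h7.first (I1_zr (h.zr) (by omega) s (by omega) (by omega))
  · subst h5
    rcases h2 with ⟨h7, h8⟩ | ⟨h7, h8⟩
    · exact ha (h7 _ le_rfl (by omega))
    · have := hQ h1' h7 (zr_I1 hu ((h8.append h3).mono le_rfl (by omega)) (by omega))
      omega
  · exact hns s h5 (by omega) h1'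

/-- Static heads. -/
lemma head_static (hu : u ∈ S.X) (h : S.LF u a) (ha : ¬ S.Z (u a)) (hns : S.NS u a E)
    (hE : a + S.l ≤ E) (hv : ¬ (S.Zr u (a - S.K1) a ∧ S.Free u a))
    (hQ : ¬ (S.Zr u (a - S.K) a ∧ S.AtQ u a ∧ S.Zr u (a + S.l) (a + S.l + S.kap + S.p)))
    {k : ℤ} (hk : a - S.p ≤ k) (hk' : k < E) : S.I2 (S.I1 u) k = u k := by
  have hp := S.par
  have h1 := fun k => I1_head h hns hv (k := k)
  rw [I2_head hu h (by rwa [h1 a (by omega) (by omega)]) hns hk hk', h1 k (by omega) hk']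
  · intro h2 h3 h4
    exact absurd ⟨h2, Or.inl (h3.congr fun j _ _ => (h1 _ (by omega) (by omega)).symm), h4⟩ hv
  · intro h2 h3 h4
    exact absurd ⟨h2, h3.congr fun j _ _ => (h1 _ (by omega) (by omega)).symm, h4⟩ hQ

/-- A free kernel `P` followed by few zeros turns into `Q`. -/
lemma head_flip (hu : u ∈ S.X) (h : S.LF u a) (hns : S.NS u a E)
    (h0 : S.Zr u (a - S.K1) a) (hP : S.AtP u a)
    (h1 : S.Zr u (a + S.l) (a + S.l + S.kap)) (h2 : ¬ S.Zr u (a + S.l) (a + S.l + S.kap + S.p)) :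
    (a + S.l ≤ E → S.AtQ (S.I2 (S.I1 u)) a) ∧
    ∀ k, a - S.p ≤ k → k < E → (k < a ∨ a + S.l ≤ k) → S.I2 (S.I1 u) k = u k := by
  have hp := S.par
  have hq := I1_P h0 hP h1
  have key : ∀ k, a - S.p ≤ k → k < E → S.I2 (S.I1 u) k = S.I1 u k := fun k h3 h4 =>
    I2_head hu h hq.first hns h3 h4 (fun _ h5 _ => (not_AtP_AtQ h5 hq).elim)
      (fun _ _ h5 => absurd h5 h2)
  refine ⟨fun hE => hq.congr fun k h3 h4 => key _ (by omega) (by omega), fun k h3 h4 h5 => ?_⟩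
  rw [key k h3 h4, I1_head' h hns (by omega) h4 h5]

/-- A free kernel moves right. -/
lemma head_move (hu : u ∈ S.X) (h : S.LF u a) (hns : S.NS u a E) (hE : a + S.l ≤ E)
    (h1 : S.Zr u (a + S.l) (a + S.l + S.kap + S.p))
    (hh : (S.Zr u (a - S.K1) a ∧ S.AtP u a) ∨
      (S.Zr u (a - S.K) a ∧ ¬ S.Zr u (a - S.K1) a ∧ S.AtQ u a)) :
    (∀ k, 0 ≤ k → k < S.l + S.p → S.I2 (S.I1 u) (a + k) = S.P (k - S.p)) ∧
    ∀ k, a - S.p ≤ k → k < E → (k < a ∨ a + S.l + S.p ≤ k) → S.I2 (S.I1 u) k = u k := by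
  have hp := S.par
  have hz : S.Zr u (a - S.K) a := hh.elim (fun h => h.1.mono (by omega) le_rfl) fun h => h.1
  have hq : S.AtQ (S.I1 u) a := by
    rcases hh with ⟨h2, h3⟩ | ⟨h2, h3, h4⟩
    · exact I1_P h2 h3 (h1.mono le_rfl (by omega))
    · exact h4.congr fun k h5 h6 => I1_head h hns (fun h => h3 h.1) (by omega) (by omega)
  refine ⟨fun k h2 h3 => I2_Q (I1_mem hu) (I1_zr hz (by omega)) hq (I1_zr h1 (by omega))
    (h.not_AtQ (by omega) (I1_zr (hz.mono le_rfl (by omega)) (by omega))) h2 h3, ?_⟩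
  intro k h2 h3 h4
  rw [I2_head hu h hq.first hns h2 h3 (fun _ h5 _ => (not_AtP_AtQ h5 hq).elim)
    (fun _ _ _ => h4), I1_head' h hns (by omega) h3 (by omega)]

end GliderBase

/-! ### The head behind the leftbound fleet and its possible moves. -/

namespace GliderBase

open ZeroSys

/-- The first nonzero letter of `x` which does not belong to the fleet of leftbound gliders
is at `i`. -/
structure Head (S : GliderBase B) (x : ℤ → B) (i : ℤ) : Prop where
  mem : x ∈ S.X
  lf : S.LF x (i - S.p)
  zr : S.Zr x (i - S.p) i
  ne : ¬ S.Z (x i)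
  nf : ¬ (S.Zr x (i - S.K1) i ∧ S.AtQ x i ∧ S.Zr x (i + S.l) (i + S.l + S.kap + S.p))

variable {S : GliderBase B}

lemma Head.lf' {x : ℤ → B} {i : ℤ} (h : S.Head x i) : S.LF x i :=
  h.lf.extend h.zr (by have := S.par; omega)

lemma Head.congr {x y : ℤ → B} {i E : ℤ} (h : S.Head x i) (hy : y ∈ S.X)
    (hE : i + S.l + S.kap + S.p ≤ E) (hxy : ∀ k < E, y k = x k) : S.Head y i := by
  have hp := S.par
  refine ⟨hy, h.lf.congr fun k _ => hxy k (by omega), h.zr.congr fun k _ _ => hxy k (by omega),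
    by rw [hxy i (by omega)]; exact h.ne, fun hn => h.nf ⟨?_, ?_, ?_⟩⟩
  · exact hn.1.congr fun k _ _ => (hxy k (by omega)).symm
  · exact hn.2.1.congr fun k _ _ => (hxy _ (by omega)).symm
  · exact hn.2.2.congr fun k _ _ => (hxy _ (by omega)).symm

variable {u : ℤ → B} {i E : ℤ}

lemma step_mem (hu : u ∈ S.X) : S.I2 (S.I1 u) ∈ S.X := I2_mem (I1_mem hu)

lemma Head.shift (h : S.Head u i) {k : ℤ} (hk : k < i - S.p) : S.I2 (S.I1 u) k = u (k + S.p) :=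
  h.lf'.step h.mem hk

lemma Head.lf_next (h : S.Head u i) : S.LF (S.I2 (S.I1 u)) (i - S.p) := h.lf'.next h.mem

/-- The fleet recedes by `p` in every step, so an idle head sees its gap grow by `p`. This drives
all waiting inductions below. -/
lemma Head.gap_iff (h : S.Head u i) (hy : S.Zr (S.I2 (S.I1 u)) (i - S.p) i) {c : ℤ} :
    S.Zr (S.I2 (S.I1 u)) c i ↔ S.Zr u (c + S.p) i := by
  have hp := S.par
  constructor
  · intro h1 k h2 h3
    have := h1 (k - S.p) (by omega) (by omega)
    rwa [h.shift (by omega), sub_add_cancel] at this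
  · intro h1 k h2 h3
    by_cases h4 : k < i - S.p
    · rw [h.shift h4]; exact h1 _ (by omega) (by omega)
    · exact hy k (by omega) h3

/-- The only way for an unchanged head to violate `nf` afterwards is a Q whose gap has just grown to
`K1`. Its gap was then at least `K` before the step, which `hQ` excludes. -/
lemma Head.static (h : S.Head u i) (hns : S.NS u i E) (hE : i + S.l + S.kap + S.p ≤ E)
    (hv : ¬ (S.Zr u (i - S.K1) i ∧ S.Free u i))
    (hQ : ¬ (S.Zr u (i - S.K) i ∧ S.AtQ u i ∧ S.Zr u (i + S.l) (i + S.l + S.kap + S.p))) :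
    S.Head (S.I2 (S.I1 u)) i ∧ (∀ k, i - S.p ≤ k → k < E → S.I2 (S.I1 u) k = u k) ∧
      S.Zr (S.I2 (S.I1 u)) (i - S.p) i := by
  have hp := S.par
  have key : ∀ k, i - S.p ≤ k → k < E → S.I2 (S.I1 u) k = u k := fun k =>
    head_static h.mem h.lf' h.ne hns (by omega) hv hQ
  have hz : S.Zr (S.I2 (S.I1 u)) (i - S.p) i := h.zr.congr fun k h1 h2 => key k h1 (by omega)
  refine ⟨⟨step_mem h.mem, h.lf_next, hz, by rw [key i (by omega) (by omega)]; exact h.ne,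
    fun hn => hQ ⟨?_, ?_, ?_⟩⟩, key, hz⟩
  · exact ((h.gap_iff hz).1 hn.1).mono (by omega) le_rfl
  · exact hn.2.1.congr fun k _ _ => (key _ (by omega) (by omega)).symm
  · exact hn.2.2.congr fun k _ _ => (key _ (by omega) (by omega)).symm

/-- `I1` turns P into Q, but `I2` would need `kap + p` zeros behind it to push it right. Lacking
them, the kernel remains a Q, ready to leave to the left. -/
lemma Head.flip (h : S.Head u i) (hns : S.NS u i E) (hE : i + S.l + S.kap + S.p ≤ E)
    (h0 : S.Zr u (i - S.K1) i) (hP : S.AtP u i) (h1 : S.Zr u (i + S.l) (i + S.l + S.kap))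
    (h2 : ¬ S.Zr u (i + S.l) (i + S.l + S.kap + S.p)) :
    S.Head (S.I2 (S.I1 u)) i ∧ S.AtQ (S.I2 (S.I1 u)) i ∧
      (∀ k, i + S.l ≤ k → k < E → S.I2 (S.I1 u) k = u k) ∧
      S.Zr (S.I2 (S.I1 u)) (i - S.p) i := by
  have hp := S.par
  obtain ⟨h3, h4⟩ := head_flip h.mem h.lf' hns h0 hP h1 h2
  replace h3 := h3 (by omega)
  have hz : S.Zr (S.I2 (S.I1 u)) (i - S.p) i := h.zr.congr fun k h5 h6 =>
    h4 k h5 (by omega) (by omega)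
  refine ⟨⟨step_mem h.mem, h.lf_next, hz, h3.first, fun hn => h2 ?_⟩, h3,
    fun k h5 h6 => h4 k (by omega) h6 (by omega), hz⟩
  exact hn.2.2.congr fun k _ _ => (h4 _ (by omega) (by omega) (by omega)).symm

/-- In the first alternative `I1` turns P into Q and `I2` turns Q0 into 0P. In the second the gap is
too short for `I1` but long enough for `I2`, which meets the Q directly. -/
lemma Head.move (h : S.Head u i) (hns : S.NS u i E) (hE : i + S.l + S.kap + S.p ≤ E)
    (h1 : S.Zr u (i + S.l) (i + S.l + S.kap + S.p))
    (hh : (S.Zr u (i - S.K1) i ∧ S.AtP u i) ∨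
      (S.Zr u (i - S.K) i ∧ ¬ S.Zr u (i - S.K1) i ∧ S.AtQ u i)) :
    S.Head (S.I2 (S.I1 u)) (i + S.p) ∧ S.AtP (S.I2 (S.I1 u)) (i + S.p) ∧
      ∀ k, i + S.l + S.p ≤ k → k < E → S.I2 (S.I1 u) k = u k := by
  have hp := S.par
  obtain ⟨h3, h4⟩ := head_move h.mem h.lf' hns (by omega) h1 hh
  obtain ⟨h5, h6⟩ := P_mid _ _ h3
  have hz : S.Zr (S.I2 (S.I1 u)) (i - S.p) i := h.zr.congr fun k h5 h6 =>
    h4 k h5 (by omega) (by omega)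
  refine ⟨⟨step_mem h.mem, ?_, ?_, h6.first, fun hn => not_AtP_AtQ h6 hn.2.1⟩, h6,
    fun k h7 h8 => h4 k (by omega) h8 (by omega)⟩
  · rw [add_sub_cancel_right]
    exact h.lf_next.extend hz (by omega)
  · rwa [add_sub_cancel_right]

/-- The departing Q joins the fleet, and the head becomes the letter behind its `kap` zeros.
Afterwards Q is only `kap + p` away from the new head, so a gap of `K1` has to be rebuilt before
that head can be active. -/
lemma Head.emit (h : S.Head u i) (hns : S.NS u i E)
    (hE : i + 2 * (S.l + S.kap) + S.p ≤ E) (h0 : S.Zr u (i - S.K1) i) (hQ : S.AtQ u i)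
    (h1 : S.Zr u (i + S.l) (i + S.l + S.kap)) (h2 : ¬ S.Z (u (i + S.l + S.kap))) :
    S.Head (S.I2 (S.I1 u)) (i + S.l + S.kap) ∧
      (∀ k, i + S.l + S.kap ≤ k → k < E → S.I2 (S.I1 u) k = u k) ∧
      ¬ S.Zr (S.I2 (S.I1 u)) (i + S.l + S.kap - S.K1) (i + S.l + S.kap) := by
  have hp := S.par
  have hl : S.LF u (i + S.l + S.kap) := h.lf'.add hQ h0 h1
  have hgap : ∀ c, c < i + S.l → ¬ S.Zr u c (i + S.l + S.kap) := fun c hc hz =>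
    hQ.last (hz _ (by omega) (by omega))
  have key : ∀ k, i + S.l + S.kap - S.p ≤ k → k < E → S.I2 (S.I1 u) k = u k := fun k =>
    head_static h.mem hl h2 (hns.mono (by omega)) (by omega) (fun hn => hgap _ (by omega) hn.1)
      (fun hn => hgap _ (by omega) hn.1)
  have hq : ¬ S.Z (S.I2 (S.I1 u) (i + S.l - 1 - S.p)) := by
    rw [hl.step h.mem (by omega), sub_add_cancel]
    exact hQ.last
  have hgap' : ¬ S.Zr (S.I2 (S.I1 u)) (i + S.l + S.kap - S.K1) (i + S.l + S.kap) :=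
    fun hz => hq (hz _ (by omega) (by omega))
  refine ⟨⟨step_mem h.mem, hl.next h.mem, fun k h3 h4 => ?_, ?_, fun hn => hgap' hn.1⟩,
    fun k h3 h4 => key k (by omega) h4, hgap'⟩
  · rw [key k h3 (by omega)]; exact h1 k (by omega) h4
  · rw [key _ (by omega) (by omega)]; exact h2

/-- Runs of zeros following a nonzero letter have length divisible by `p`. -/
lemma nonzero_at {x : ℤ → B} (hx : x ∈ S.X) {a b : ℤ} (h : S.Zr x a b) (hab : a ≤ b)
    (h1 : ¬ S.Z (x (a - 1))) (hd : (S.p : ℤ) ∣ b - a) (h2 : ¬ S.Zr x a (b + S.p)) :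
    ¬ S.Z (x b) := by
  intro hb
  have hp := S.pp
  have key : ∀ n : ℕ, (n : ℤ) < S.p → S.Zr x b (b + n + 1) := by
    intro n
    induction n with
    | zero =>
      intro _ k h3 h4
      have : k = b := by push_cast at h4; omega
      rwa [this]
    | succ n ih =>
      intro hn
      push_cast at hn ⊢
      have ih := ih (by omega)
      intro k h3 h4
      by_cases hk : k < b + n + 1
      · exact ih k h3 hk
      have hk' : k = b + n + 1 := by omega
      by_contra hc
      rw [hk'] at hc
      have h5 := align_right hx (h.append ih) h1 (b + n) (by omega) (by omega)
      have h6 := succ_nonzero hx h5 hc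
      have h7 : (S.p : ℤ) ∣ n + 1 := by
        have := dvd_sub h6 hd
        ring_nf at this ⊢
        exact this
      have := Int.le_of_dvd (by omega) h7
      omega
  refine h2 (h.append ((key (S.p - 1) (by omega)).mono le_rfl (by omega)))

lemma Head.nonzero_at (h : S.Head u i) (hf : S.Free u i)
    (h2 : ¬ S.Zr u (i + S.l) (i + S.l + S.kap + S.p)) : ¬ S.Z (u (i + S.l + S.kap)) := by
  have hp := S.par
  exact GliderBase.nonzero_at h.mem hf.2 (by omega) hf.last
    (by rw [add_sub_cancel_left]; exact S.dvd_kap) h2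

end GliderBase

namespace ZeroSys

variable {S : ZeroSys B}

lemma exists_first {x : ℤ → B} {a k : ℤ} (hk : a ≤ k) (h : ¬ S.Z (x k)) :
    ∃ f, a ≤ f ∧ f ≤ k ∧ ¬ S.Z (x f) ∧ S.Zr x a f := by
  obtain ⟨f, ⟨h1, h2⟩, h3⟩ := Int.exists_least_of_bdd (P := fun f => a ≤ f ∧ ¬ S.Z (x f))
    ⟨a, fun f hf => hf.1⟩ ⟨k, hk, h⟩
  refine ⟨f, h1, h3 k ⟨hk, h⟩, h2, fun c h4 h5 => ?_⟩
  by_contra hc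
  have := h3 c ⟨h4, hc⟩
  omega

lemma exists_last {x : ℤ → B} {k b : ℤ} (hk : k < b) (h : ¬ S.Z (x k)) :
    ∃ f, k < f ∧ f ≤ b ∧ ¬ S.Z (x (f - 1)) ∧ S.Zr x f b := by
  obtain ⟨f, ⟨h1, h2⟩, h3⟩ := Int.exists_greatest_of_bdd (P := fun f => f < b ∧ ¬ S.Z (x f))
    ⟨b, fun f hf => hf.1.le⟩ ⟨k, hk, h⟩
  have := h3 k ⟨hk, h⟩
  refine ⟨f + 1, by omega, by omega, by rwa [add_sub_cancel_right], fun c h4 h5 => ?_⟩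
  by_contra hc
  have := h3 c ⟨h5, hc⟩
  omega

end ZeroSys

namespace GliderBase

open ZeroSys

variable {S : GliderBase B}

lemma QP.first {x : ℤ → B} {n : ℕ} {i j : ℤ} (h : S.QP x n i j) : ¬ S.Z (x i) := by
  cases n with
  | zero => exact h.1.first
  | succ n => exact h.1.first

lemma QP.length {x : ℤ → B} {n : ℕ} {i j : ℤ} (h : S.QP x n i j) :
    j = i + n * (S.l + S.kap) + S.l := by
  induction n generalizing i with
  | zero => rw [h.2]; push_cast; ring
  | succ n ih => rw [ih h.2.2]; push_cast; ring

lemma QP.le {x : ℤ → B} {n : ℕ} {i j : ℤ} (h : S.QP x n i j) : i + S.l ≤ j := by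
  have hp := S.par
  have : 0 ≤ (n : ℤ) * (S.l + S.kap) := mul_nonneg (by omega) (by omega)
  have := h.length
  omega

lemma QP.last {x : ℤ → B} {n : ℕ} {i j : ℤ} (h : S.QP x n i j) : ¬ S.Z (x (j - 1)) := by
  induction n generalizing i with
  | zero => rw [h.2]; exact h.1.last
  | succ n ih => exact ih h.2.2

lemma QP.congr {x y : ℤ → B} {n : ℕ} {i j d : ℤ} (h : S.QP x n i j)
    (hxy : ∀ k, i ≤ k → k < j → y (k + d) = x k) : S.QP y n (i + d) (j + d) := by
  have hp := S.par
  have hj := h.le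
  induction n generalizing i with
  | zero =>
    refine ⟨h.1.congr fun k h1 h2 => ?_, by rw [h.2]; ring⟩
    rw [← hxy _ (by omega) (by omega)]; congr 1; ring
  | succ n ih =>
    have := h.2.2.le
    refine ⟨h.1.congr fun k h1 h2 => ?_, fun k h1 h2 => ?_, ?_⟩
    · rw [← hxy _ (by omega) (by omega)]; congr 1; ring
    · have := hxy (k - d) (by omega) (by omega)
      rw [sub_add_cancel] at this
      rw [this]; exact h.2.1 _ (by omega) (by omega)
    · have := ih h.2.2 (fun k h1 h2 => hxy k (by omega) h2) h.2.2.le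
      convert this using 1; ring

/-- Fleets are separated by many zeros. -/
lemma Head.start {x : ℤ → B} {i : ℤ} (h : S.Head x i) {s : ℤ} (hs : s < i) (hz : ¬ S.Z (x s))
    {n : ℤ} (hn : S.l ≤ n) (h0 : S.Zr x (s - n) s) :
    S.AtQ x s ∧ S.Zr x (s + S.l) (s + S.l + S.kap + S.p) := by
  have hp := S.par
  have hs' : s < i - S.p := by rcases nonzero_or h.zr hz with h1 | h1 <;> omega
  obtain ⟨h1, h2, h3, h4⟩ := h.lf.start hs' hz hn h0
  refine ⟨h1, fun k h5 h6 => ?_⟩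
  by_contra hc
  obtain ⟨q, h7, h8, h9, h10, h11, h12⟩ := h.lf'.2 k (by omega) hc
  have := nonzero_or h3 hc
  rcases nonzero_or h10 h1.last with h13 | h13 <;> omega

end GliderBase

/-! ### Which rules act near the head. -/

namespace GliderSys

open ZeroSys GliderBase

variable {S : GliderSys B} {x : ℤ → B} {i E : ℤ}

lemma extD_eq (hx : x ∈ S.X) {s : ℤ} (h : S.vD (shf x s)) {k : ℤ} (h1 : -S.K1 ≤ k)
    (h2 : k < S.m + S.K) : S.extD (x (s - 1)) (S.word (shf x s)) k = x (k + s) := by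
  have hp := S.toGliderBase.par
  rw [vD_shf] at h
  unfold extD
  by_cases h3 : k < 0
  · rw [put_out (by omega), if_pos h3]
    have hb : S.z (S.ph (x (s - 1))) = x (s - 1) := z_ph (h.1 _ (by omega) (by omega))
    obtain ⟨e, he⟩ := h.1 (k + s) (by omega) (by omega)
    have := run hx (h.1.mono (by omega) le_rfl) he (s - 1) (by omega) (by omega)
    rw [← hb, S.z_eq] at this
    rw [he]
    apply z_congr
    convert this using 1; ring
  · by_cases h4 : k < S.m
    · rw [put_word (by omega) h4, shf_apply]
    · rw [put_out (by omega), if_neg h3,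
        align_right hx h.2.1 h.2.2 _ (by omega) (by omega)]
      congr 1; ring

lemma extD_zr (hx : x ∈ S.X) {s : ℤ} (h : S.vD (shf x s)) {a b : ℤ} (ha : s - S.K1 ≤ a)
    (hb : b ≤ s + S.m + S.K) (hz : S.Zr x a b) :
    S.Zr (S.extD (x (s - 1)) (S.word (shf x s))) (a - s) (b - s) := fun k h1 h2 => by
  rw [extD_eq hx h (by omega) (by omega)]
  exact hz _ (by omega) (by omega)

lemma extD_free (hx : x ∈ S.X) {s : ℤ} (h : S.vD (shf x s)) {a : ℤ} (ha : s - S.K1 ≤ a)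
    (hb : a + S.l + S.kap ≤ s + S.m + S.K) :
    S.Free (S.extD (x (s - 1)) (S.word (shf x s))) (a - s) ↔ S.Free x a := by
  have hp := S.toGliderBase.par
  have e : S.Free x a ↔ S.Free (shf x s) (a - s) := by rw [Free.shf_iff, sub_add_cancel]
  rw [e]
  constructor <;> intro h1 <;> refine h1.congr fun k h2 h3 => ?_
  · rw [shf_apply, extD_eq hx h (by omega) (by omega)]
  · rw [shf_apply, extD_eq hx h (by omega) (by omega)]

lemma extD_mem (hx : x ∈ S.X) {s : ℤ} (h : S.vD (shf x s)) :
    S.extD (x (s - 1)) (S.word (shf x s)) ∈ S.X := by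
  have hp := S.toGliderBase.par
  have h' := vD_shf.1 h
  have he := fun k => extD_eq hx h (k := k)
  set w := S.extD (x (s - 1)) (S.word (shf x s)) with hw
  have hl : ∀ k < 0, w k = shf S.z (1 + S.ph (x (s - 1))) k := fun k hk => by
    rw [hw, extD, put_out (by omega), if_pos hk, shf_apply]; congr 1; ring
  have hr : ∀ k : ℤ, S.m ≤ k → w k = shf S.z (-S.m) k := fun k hk => by
    rw [hw, extD, put_out (by omega), if_neg (by omega), shf_apply]; congr 1
  have g1 := glue_mem (S.shift_mem _ S.z_mem (1 + S.ph (x (s - 1)))) (S.shift_mem _ hx s)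
    (c := 0) (fun k _ _ => Z_z _) fun k h1 h2 => by
      rw [shf_apply, ← he k (by omega) (by omega), hl k h2]
  have g2 := glue_mem g1 (S.shift_mem _ S.z_mem (-S.m)) (c := S.m + 2 * S.p)
    (fun k h1 h2 => by
      rw [glue_ge (by omega), shf_apply, ← he k (by omega) (by omega), hr k (by omega)]
      exact Z_z _) fun k h1 h2 => by
      rw [glue_ge (by omega), shf_apply x, ← he k (by omega) (by omega), hr k (by omega)]
  convert g2 using 1
  funext k
  by_cases h1 : k < 0
  · rw [glue_lt (by omega), glue_lt h1, hl k h1]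
  · by_cases h2 : k < S.m + 2 * S.p
    · rw [glue_lt h2, glue_ge (by omega), he k (by omega) (by omega), shf_apply]
    · rw [glue_ge (by omega), hr k (by omega)]

/-- At an actual site, `extD` reproduces `x` on the window and the adjacent zeros, so the
admissibility clauses hold automatically and only the freezing clause is left. -/
lemma mem_TD_iff (hx : x ∈ S.X) {s f : ℤ} (h : S.vD (shf x s)) (hf : s ≤ f) (hfm : f < s + S.m)
    (hz : S.Zr x s f) (hnz : ¬ S.Z (x f)) : S.word (shf x s) ∈ S.TD (shf x s) ↔
    ¬ S.Free x f ∨ S.word (shf x s) = S.eD (x (s - 1)) := by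
  have hp := S.toGliderBase.par
  have h' := vD_shf.1 h
  have hb : (shf x s) (-1) = x (s - 1) := by rw [shf_apply]; congr 1; ring
  have he := fun k => extD_eq hx h (k := k)
  unfold TD SD
  rw [hb]
  have hla : ¬ S.Z (S.extD (x (s - 1)) (S.word (shf x s)) (S.m - 1)) := by
    rw [he _ (by omega) (by omega)]
    convert h'.2.2 using 3; ring
  constructor
  · intro hw
    refine hw.2.2.imp (fun h1 h2 => h1 ⟨f - s, by omega, by omega, ?_, ?_⟩) id
    · have := extD_zr hx h (by omega) (by omega) hz
      rwa [sub_self] at this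
    · exact (extD_free hx h (by omega) (by omega)).2 h2
  · refine fun hw => ⟨extD_mem hx h, hla, hw.imp (fun h1 => ?_) id⟩
    rintro ⟨g, h2, h3, h4, h5⟩
    have : g + s = f := by
      have h6 : ¬ S.Z (x (g + s)) := by
        rw [← he g (by omega) (by omega)]; exact h5.first
      have h7 : ¬ S.Z (S.extD (x (s - 1)) (S.word (shf x s)) (f - s)) := by
        rw [he _ (by omega) (by omega), sub_add_cancel]; exact hnz
      rcases nonzero_or hz h6 with h8 | h8 <;> rcases nonzero_or h4 h7 with h9 | h9 <;> omega
    subst this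
    exact h1 ((extD_free hx h (by omega) (by omega)).1 (by rwa [add_sub_cancel_right]))

/-- The emitting word contains a train of gliders. -/
lemma QP_of_eD (hx : x ∈ S.X) {s f : ℤ} (h : S.vD (shf x s)) (hf : s ≤ f) (hfm : f < s + S.m)
    (hz : S.Zr x s f) (hnz : ¬ S.Z (x f)) (hw : S.word (shf x s) = S.eD (x (s - 1))) :
    ∃ n, S.QP x (n + 1) f (s + S.m) := by
  have hp := S.toGliderBase.par
  have h' := vD_shf.1 h
  have he := fun k => extD_eq hx h (k := k)
  obtain ⟨-, n, g, h1, h2, h3⟩ := S.eD_spec (x (s - 1)) (S.word (shf x s))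
    (h'.1 _ (by omega) (by omega)) (extD_mem hx h) (by
      rw [he _ (by omega) (by omega)]
      convert h'.2.2 using 3; ring)
  rw [← hw] at h2 h3
  have hle := h3.le
  have h4 := h3.congr (y := x) (d := s) fun k h4 h5 => (he k (by omega) (by omega)).symm
  have : g + s = f := by
    have h6 := h4.first
    have h7 : ¬ S.Z (S.extD (x (s - 1)) (S.word (shf x s)) (f - s)) := by
      rw [he _ (by omega) (by omega), sub_add_cancel]; exact hnz
    rcases nonzero_or hz h6 with h8 | h8 <;> rcases nonzero_or h2 h7 with h9 | h9 <;> omega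
  rw [this, add_comm (S.m : ℤ)] at h4
  exact ⟨n, h4⟩

/-- A window whose first nonzero letter precedes the head begins with a glider Q followed by `kap +
p` zeros. It is frozen: its kernel is free, and it is not emitting, since in an emitting word the
next kernel comes right after `kap` zeros. -/
lemma D_site (h : S.Head x i) (hns : S.NS x i E) {s : ℤ} (hs : s < E) (hv : S.vD (shf x s))
    (hw : S.word (shf x s) ∈ S.TD (shf x s)) : s ≤ i ∧ i < s + S.m ∧ S.Zr x (s - S.K1) i := by
  have hp := S.toGliderBase.par
  have hv' := vD_shf.1 hv
  have hsi : s ≤ i := by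
    by_contra hc
    exact hns s (by omega) hs (hv'.1.mono (by omega) le_rfl)
  obtain ⟨f, h1, h2, h3, h4⟩ := exists_first (S := S.toZeroSys) (by omega) hv'.2.2 (a := s)
  rcases lt_or_ge f i with h5 | h5
  · exfalso
    obtain ⟨h6, h7⟩ := h.start h5 h3 (n := S.K1) (by omega)
      ((hv'.1.append h4).mono (by omega) le_rfl)
    rw [mem_TD_iff h.mem hv h1 (by omega) h4 h3] at hw
    rcases hw with hw | hw
    · exact hw ⟨Or.inr h6, h7.mono le_rfl (by omega)⟩
    · obtain ⟨n, h8⟩ := QP_of_eD h.mem hv h1 (by omega) h4 h3 hw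
      exact h8.2.2.first (h7 _ (by omega) (by omega))
  · have : f ≤ i := by rcases nonzero_or h4 h.ne with h6 | h6 <;> omega
    have : f = i := by omega
    subst this
    exact ⟨hsi, by omega, hv'.1.append h4⟩

lemma eC_free {F : Set (ℤ → B)} {w : Fin S.m → B} (h : ¬ S.Z (S.put w S.z 0))
    (hF : S.FolC w = F) (hne : F.Nonempty) : S.AtQ (S.put (S.eC F) S.z) 0 ∧
    S.Zr (S.put (S.eC F) S.z) S.l (S.l + S.kap) ∧
    ¬ S.Z (S.put (S.eC F) S.z (S.l + S.kap)) := by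
  have := S.eC_spec w h (by rwa [hF])
  rw [hF] at this
  exact ⟨this.1, this.2.1, this.2.2.1⟩

lemma put_word_free {u : ℤ → B} : S.Free (S.put (S.word u) S.z) 0 ↔ S.Free u 0 := by
  have hp := S.toGliderBase.par
  constructor <;> intro h <;> refine h.congr fun k h1 h2 => ?_
  · exact (put_word (by omega) (by omega)).symm
  · exact put_word (by omega) (by omega)

/-- The condition `vC` already forbids the long runs of zeros mentioned in `SC`, so only the
freezing clause is left. -/
lemma mem_TC_iff {u : ℤ → B} (hv : S.vC u) :
    S.word u ∈ S.TC u ↔ ¬ S.Free u 0 ∨ S.word u = S.eC (S.FolC (S.word u)) := by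
  have hp := S.toGliderBase.par
  unfold TC SC
  rw [Set.mem_ofPred_eq, put_word_free, put_word le_rfl (by omega)]
  refine ⟨fun h => h.2.2.2, fun h => ⟨hv.2.1, rfl, fun a h1 h2 h3 h4 => ?_, h⟩⟩
  have h5 : S.Zr u a S.m := h3.congr fun k h6 h7 => (put_word (by omega) h7).symm
  exact hv.2.2 a h1 h2.le ((h5.append h4.2).mono le_rfl (by omega))

lemma eC_of_word {u : ℤ → B} (hu : u ∈ S.X) (hv : S.vC u)
    (hw : S.word u = S.eC (S.FolC (S.word u))) :
    S.AtQ u 0 ∧ S.Zr u S.l (S.l + S.kap) ∧ ¬ S.Z (u (S.l + S.kap)) := by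
  have hp := S.toGliderBase.par
  obtain ⟨h1, h2, h3⟩ := eC_free (S := S) (w := S.word u)
    (by rw [put_word le_rfl (by omega)]; exact hv.2.1) rfl
    ⟨_, folC_word hu hv.1 hv.2.1⟩
  rw [← hw] at h1 h2 h3
  rw [put_word (by omega) (by omega)] at h3
  refine ⟨h1.congr fun k h4 h5 => (put_word (by omega) (by omega)).symm,
    h2.congr fun k h4 h5 => (put_word (by omega) (by omega)).symm, h3⟩

lemma eC_of_word' (hx : x ∈ S.X) (hv : S.vC (shf x i))
    (hw : S.word (shf x i) = S.eC (S.FolC (S.word (shf x i)))) :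
    S.AtQ x i ∧ S.Zr x (i + S.l) (i + S.l + S.kap) ∧ ¬ S.Z (x (i + S.l + S.kap)) := by
  obtain ⟨h1, h2, h3⟩ := eC_of_word (S.shift_mem _ hx _) hv hw
  rw [AtQ.shf_iff, zero_add] at h1
  rw [Zr.shf_iff] at h2
  rw [shf_apply] at h3
  refine ⟨h1, ?_, ?_⟩
  · convert h2 using 1 <;> ring
  · convert h3 using 3; ring

/-- As for `D`: words at gliders of the fleet are frozen, because a Q of the fleet has a zero where
the emitting word has its second kernel. -/
lemma C_site (h : S.Head x i) (hns : S.NS x i E) {s : ℤ} (hs : s < E) (hv : S.vC (shf x s))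
    (hw : S.word (shf x s) ∈ S.TC (shf x s)) : s = i := by
  have hp := S.toGliderBase.par
  have hv' := vC_shf.1 hv
  rcases lt_trichotomy s i with h1 | h1 | h1
  · exfalso
    obtain ⟨h2, h3⟩ := h.start h1 hv'.2.1 (n := S.K1) (by omega) hv'.1
    rw [mem_TC_iff hv] at hw
    rcases hw with hw | hw
    · exact hw (by rw [Free.shf_iff, zero_add]; exact ⟨Or.inr h2, h3.mono le_rfl (by omega)⟩)
    · exact (eC_of_word' h.mem hv hw).2.2 (h3 _ (by omega) (by omega))
  · exact h1
  · exact absurd (hv'.1.mono (by omega) le_rfl) (hns s h1 hs)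

variable [Finite B]

lemma D_out (h : S.Head x i) (hns : S.NS x i E) {k : ℤ} (hk : k < E)
    (hD : ∀ s, s ≤ i → i < s + S.m → S.vD (shf x s) → S.Zr x (s - S.K1) i → s ≤ k →
      k < s + S.m → S.word (shf x s) ∉ S.TD (shf x s)) : S.D 1 x k = x k := by
  refine ruleD.out h.mem fun s hs h1 h2 hw => ?_
  obtain ⟨h3, h4, h5⟩ := D_site h hns (by omega) hs hw
  exact hD s h3 h4 hs h5 h1 h2 hw

lemma C_out (h : S.Head x i) (hns : S.NS x i E) {k : ℤ} (hk : k < E)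
    (hC : S.vC (shf x i) → i ≤ k → k < i + S.m → S.word (shf x i) ∉ S.TC (shf x i)) :
    S.C 1 x k = x k := by
  refine ruleC.out h.mem fun s hs h1 h2 hw => ?_
  have h3 := C_site h hns (by omega) hs hw
  subst h3
  exact hC hs h1 h2 hw

lemma D_mem (hx : x ∈ S.X) : S.D 1 x ∈ S.X := ruleD.app_mem 1 hx

lemma C_mem (hx : x ∈ S.X) : S.C 1 x ∈ S.X := ruleC.app_mem 1 hx

/-- The first two rules do not act near an inactive head. -/
lemma inactive (h : S.Head x i) (hns : S.NS x i E) (hE : i + S.l + S.kap + S.p ≤ E)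
    (hD : ∀ s, s ≤ i → i < s + S.m → S.vD (shf x s) → S.Zr x (s - S.K1) i →
      S.word (shf x s) ∉ S.TD (shf x s))
    (hC : ∀ y, (∀ k < E, y k = x k) → S.vC (shf y i) → S.word (shf y i) ∉ S.TC (shf y i)) :
    S.Head (S.C 1 (S.D 1 x)) i ∧ S.NS (S.C 1 (S.D 1 x)) i E ∧
      ∀ k < E, S.C 1 (S.D 1 x) k = x k := by
  have h1 : ∀ k < E, S.D 1 x k = x k := fun k hk =>
    D_out h hns hk fun s a b c d _ _ => hD s a b c d
  have h2 := h.congr (D_mem h.mem) hE h1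
  have h3 := hns.congr h1
  have h4 : ∀ k < E, S.C 1 (S.D 1 x) k = x k := fun k hk => by
    rw [C_out h2 h3 hk fun a _ _ => hC _ h1 a, h1 k hk]
  exact ⟨h.congr (C_mem h2.mem) hE h4, hns.congr h4, h4⟩

end GliderSys

/-! ### Progress when no long run of zeros follows the head soon. -/

namespace GliderSys

open ZeroSys GliderBase

variable {S : GliderSys B} {x : ℤ → B} {i j E : ℤ}

lemma word_shf_congr {x y : ℤ → B} {s : ℤ} (h : ∀ k, s ≤ k → k < s + S.m → y k = x k) :
    S.word (shf y s) = S.word (shf x s) :=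
  word_congr fun k h1 h2 => h _ (by omega) (by omega)

/-- No long run of zeros starts shortly after `i`. -/
def Long (S : GliderSys B) (x : ℤ → B) (i : ℤ) : Prop :=
  ∀ a, i ≤ a → a ≤ i + S.m → ¬ S.Zr x a (a + S.K)

lemma Long.congr {y : ℤ → B} (h : S.Long x i)
    (hxy : ∀ k, i ≤ k → k < i + S.m + S.K + 1 → y k = x k) : S.Long y i :=
  fun a h1 h2 h3 => h a h1 h2 (h3.congr fun k _ _ => (hxy k (by omega) (by omega)).symm)

lemma Long.ns (h : S.Long x i) (hx : ¬ S.Z (x i)) : S.NS x i (i + S.m + S.K + 1) := by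
  have hp := S.toGliderBase.par
  intro s h1 h2 h3
  rcases nonzero_or h3 hx with h4 | h4
  · exact h (s - S.K) (by omega) (by omega) (by rwa [sub_add_cancel])
  · omega

lemma vC_of_long (h : S.Long x i) (hx : ¬ S.Z (x i)) (h0 : S.Zr x (i - S.K1) i) :
    S.vC (shf x i) := vC_shf.2 ⟨h0, hx, fun a => h a⟩

variable [Finite B]

/-- A later head, with `c1` and `c2` bounding its position and that of the following long run of
zeros. -/
def Up (S : GliderSys B) (x : ℤ → B) (c1 c2 : ℤ) : Prop :=
  ∃ (t : ℕ) (j : ℤ), S.Head (S.G^[t] x) j ∧ c1 ≤ j ∧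
    ∀ a, j ≤ a → S.Zr (S.G^[t] x) a (a + S.K) → c2 ≤ a

lemma Up.of_step {c1 c2 : ℤ} (h : S.Up (S.G x) c1 c2) : S.Up x c1 c2 := by
  obtain ⟨t, j, h⟩ := h
  refine ⟨t + 1, j, ?_⟩
  rw [Function.iterate_succ_apply]
  exact h

lemma Up.of_head {c1 c2 : ℤ} (h : S.Head x j) (h1 : c1 ≤ j)
    (h2 : ∀ a, j ≤ a → S.Zr x a (a + S.K) → c2 ≤ a) : S.Up x c1 c2 := ⟨0, j, h, h1, h2⟩

omit [Finite B] in
lemma long_D (hl : S.Long x i) : ∀ s, s ≤ i → i < s + S.m → S.vD (shf x s) →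
    S.Zr x (s - S.K1) i → S.word (shf x s) ∉ S.TD (shf x s) :=
  fun s h1 h2 h3 _ _ => hl (s + S.m) (by omega) (by omega) (vD_shf.1 h3).2.1

/-- The state after the first two rules, if the rule for long words is active. -/
lemma long_active (h : S.Head x i) (hl : S.Long x i) (h0 : S.Zr x (i - S.K1) i)
    (hw : S.word (shf x i) ∈ S.TC (shf x i)) :
    S.Head (S.C 1 (S.D 1 x)) i ∧ S.Long (S.C 1 (S.D 1 x)) i ∧
    (∀ k < i, S.C 1 (S.D 1 x) k = x k) ∧
    S.TC (shf (S.C 1 (S.D 1 x)) i) = S.TC (shf x i) ∧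
    S.word (shf (S.C 1 (S.D 1 x)) i) = cyc (S.TC (shf x i)) (S.word (shf x i)) := by
  have hp := S.toGliderBase.par
  have hns := hl.ns h.ne
  have e1 : ∀ k < i + S.m + S.K + 1, S.D 1 x k = x k := fun k hk =>
    D_out h hns hk fun s a b c d _ _ => long_D hl s a b c d
  have h1 := h.congr (D_mem h.mem) (by omega) e1
  have hv := vC_of_long hl h.ne h0
  obtain ⟨hv1, hT⟩ := hv.congr (w := shf (S.D 1 x) i)
    (hv.1.congr fun k _ _ => e1 _ (by omega)) (fun k _ _ => e1 _ (by omega))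
  have hw1 : S.word (shf (S.D 1 x) i) = S.word (shf x i) :=
    word_shf_congr fun k _ _ => e1 k (by omega)
  rw [← hT, ← hw1] at hw ⊢
  have hT' := hT
  set x' := S.D 1 x with hx'
  have hw2 : S.word (shf (S.C 1 x') i) = cyc (S.TC (shf x' i)) (S.word (shf x' i)) := by
    have := ruleC.win (ε := 1) h1.mem hv1
    rwa [zpow_one] at this
  have hm2 : S.word (shf (S.C 1 x') i) ∈ S.TC (shf x' i) := by
    have := cyc_zpow_mem 1 hw
    rw [zpow_one] at this
    rw [hw2]; exact this
  have hctx := app_ctx (n := S.m) (t := fun u a =>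
    S.put ((cyc (S.TC u) ^ (1 : ℤ)) (S.word u)) u a) K1_nonneg (ruleC.sp _ h1.mem) hv1
  obtain ⟨hv2, hT2⟩ := ruleC.inv _ (S.shift_mem _ h1.mem i) hv1 (shf (S.C 1 x') i)
    (fun k a b => hctx k (Or.inl ⟨a, b⟩)) (fun k a b => hctx k (Or.inr ⟨a, b⟩)) hw hm2
  have e2 : ∀ k < i, S.C 1 x' k = x k := fun k hk => by
    rw [C_out h1 (hns.congr e1) (E := i + S.m + S.K + 1) (by omega) (by omega), e1 k (by omega)]
  have hv2' := vC_shf.1 hv2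
  refine ⟨⟨C_mem h1.mem, h.lf.congr fun k _ => e2 k (by omega), h.zr.congr fun k _ _ => e2 k
    (by omega), hv2'.2.1, fun hn => ?_⟩, hv2'.2.2, e2, hT2, hw2⟩
  rw [← hT2, mem_TC_iff hv2] at hm2
  rcases hm2 with h3 | h3
  · refine h3 (by rw [Free.shf_iff, zero_add]; exact ⟨Or.inr hn.2.1, hn.2.2.mono le_rfl (by omega)⟩)
  · exact (eC_of_word' (C_mem h1.mem) hv2 h3).2.2 (hn.2.2 _ (by omega) (by omega))

omit [Finite B] in
lemma eC_const {u : ℤ → B} {F : Set (ℤ → B)} {L : Set ℤ} (h : S.word u ∈ S.SC F L) :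
    S.FolC (S.word u) = F := h.2.1

/-- Emission of a glider by a long word. -/
lemma up_long_emit {u : ℤ → B} (h : S.Head u i) (hl : S.Long u i) (h0 : S.Zr u (i - S.K1) i)
    (hQ : S.AtQ u i) (h1 : S.Zr u (i + S.l) (i + S.l + S.kap))
    (h2 : ¬ S.Z (u (i + S.l + S.kap))) : S.Up (S.I2 (S.I1 u)) (i + 1) (i + S.m + 1) := by
  have hp := S.toGliderBase.par
  obtain ⟨h3, h4, -⟩ := h.emit (hl.ns h.ne) (by omega) h0 hQ h1 h2
  refine Up.of_head h3 (by omega) fun a h5 h6 => ?_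
  by_contra hc
  exact hl a (by omega) (by omega) (h6.congr fun k _ _ => (h4 k (by omega) (by omega)).symm)

lemma up_long_move {u : ℤ → B} (h : S.Head u i) (hl : S.Long u i)
    (h1 : S.Zr u (i + S.l) (i + S.l + S.kap + S.p))
    (hh : (S.Zr u (i - S.K1) i ∧ S.AtP u i) ∨
      (S.Zr u (i - S.K) i ∧ ¬ S.Zr u (i - S.K1) i ∧ S.AtQ u i)) :
    S.Up (S.I2 (S.I1 u)) (i + 1) (i + S.m + 1) := by
  have hp := S.toGliderBase.par
  obtain ⟨h3, h4, h5⟩ := h.move (hl.ns h.ne) (by omega) h1 hh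
  refine Up.of_head h3 (by omega) fun a h6 h7 => ?_
  by_contra hc
  rcases nonzero_or h7 h4.last with h8 | h8
  · exact hl a (by omega) (by omega) (h7.congr fun k _ _ => (h5 k (by omega) (by omega)).symm)
  · omega

/-- Induction on the number of rotations left before the emitting word. Intermediate words do not
begin with a free kernel, so `I1` and `I2` leave them alone and each time step performs exactly one
rotation within the same set. -/
lemma up_long_orbit (n : ℕ) : ∀ x, S.Head x i → S.Long x i → S.Zr x (i - S.K1) i →
    S.word (shf x i) ∈ S.TC (shf x i) →
    (cyc (S.TC (shf x i)) ^ (n + 1)) (S.word (shf x i)) = S.eC (S.FolC (S.word (shf x i))) →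
    S.Up x (i + 1) (i + S.m + 1) := by
  have hp := S.toGliderBase.par
  induction n with
  | zero =>
    intro x h hl h0 hw he
    refine Up.of_step ?_
    obtain ⟨h1, h2, h3, h4, h5⟩ := long_active h hl h0 hw
    have h0' : S.Zr (S.C 1 (S.D 1 x)) (i - S.K1) i := h0.congr fun k _ _ => h3 k (by omega)
    have hv := vC_of_long h2 h1.ne h0'
    rw [zero_add, pow_one, ← h5] at he
    have hm : S.word (shf (S.C 1 (S.D 1 x)) i) ∈ S.TC (shf x i) := by
      rw [h5]
      have := cyc_zpow_mem 1 hw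
      rwa [zpow_one] at this
    have hF := eC_const hm
    rw [← hF] at he
    obtain ⟨h6, h7, h8⟩ := eC_of_word' h1.mem hv he
    exact up_long_emit h1 h2 h0' h6 h7 h8
  | succ n ih =>
    intro x h hl h0 hw he
    refine Up.of_step ?_
    obtain ⟨h1, h2, h3, h4, h5⟩ := long_active h hl h0 hw
    have h0' : S.Zr (S.C 1 (S.D 1 x)) (i - S.K1) i := h0.congr fun k _ _ => h3 k (by omega)
    have hv := vC_of_long h2 h1.ne h0'
    have hm : S.word (shf (S.C 1 (S.D 1 x)) i) ∈ S.TC (shf (S.C 1 (S.D 1 x)) i) := by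
      rw [h4, h5]
      have := cyc_zpow_mem 1 hw
      rwa [zpow_one] at this
    have hF : S.FolC (S.word (shf (S.C 1 (S.D 1 x)) i)) = S.FolC (S.word (shf x i)) := by
      rw [h4] at hm
      exact eC_const hm
    rw [pow_succ, Equiv.Perm.mul_apply, ← h5, ← h4, ← hF] at he
    have hm' := hm
    rw [mem_TC_iff hv] at hm'
    unfold G
    generalize S.C 1 (S.D 1 x) = u at *
    -- A word in the cycle that begins with a free kernel can only be the emitting word, met earlier
    -- than counted.
    by_cases hf : S.Free u i
    · rcases hm' with h6 | h6
      · exact absurd (by rwa [Free.shf_iff, zero_add]) h6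
      · obtain ⟨h6, h7, h8⟩ := eC_of_word' h1.mem hv h6
        exact up_long_emit h1 h2 h0' h6 h7 h8
    · obtain ⟨h6, h7, h8⟩ := h1.static (h2.ns h1.ne) (by omega) (fun hn => hf hn.2)
        (fun hn => hf ⟨Or.inr hn.2.1, hn.2.2.mono le_rfl (by omega)⟩)
      have h0'' : S.Zr (S.I2 (S.I1 u)) (i - S.K1) i :=
        (h1.gap_iff h8).2 (h0'.mono (by omega) le_rfl)
      have e := word_shf_congr (S := S) (x := u) (y := S.I2 (S.I1 u)) (s := i)
        fun k a b => h7 k (by omega) (by omega)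
      obtain ⟨-, hT⟩ := hv.congr (w := shf (S.I2 (S.I1 u)) i)
        (Zr.shf_iff.2 (by convert h0'' using 1 <;> ring))
        (fun k a b => h7 _ (by omega) (by omega))
      refine ih _ h6 (h2.congr fun k a b => h7 k (by omega) (by omega)) h0'' ?_ ?_
      · rw [e, hT]; exact hm
      · rw [e, hT]; exact he

-- The emitting word has no more trailing zeros than any word with its follower set, so it inherits
-- the clause about long runs from the word present.
omit [Finite B] in
lemma TC_eC_mem (hx : x ∈ S.X) (hv : S.vC (shf x i))
    (hw : S.word (shf x i) ∈ S.TC (shf x i)) :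
    S.eC (S.FolC (S.word (shf x i))) ∈ S.TC (shf x i) := by
  have hp := S.toGliderBase.par
  have h1 : ¬ S.Z (S.put (S.word (shf x i)) S.z 0) := by
    rw [put_word le_rfl (by omega)]; exact hv.2.1
  obtain ⟨h2, h3, h4, h5, h6⟩ := S.eC_spec _ h1
    ⟨_, folC_word (S.shift_mem _ hx i) hv.1 hv.2.1⟩
  exact ⟨h2.first, h5, fun a ha ha' hz => hw.2.2.1 a ha ha' (h6 a ha ha' hz), Or.inr rfl⟩

lemma up_long_of_mem (h : S.Head x i) (hl : S.Long x i) (h0 : S.Zr x (i - S.K1) i)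
    (hw : S.word (shf x i) ∈ S.TC (shf x i)) : S.Up x (i + 1) (i + S.m + 1) := by
  obtain ⟨n, hn⟩ := cyc_reach hw (TC_eC_mem h.mem (vC_of_long hl h.ne h0) hw)
  exact up_long_orbit n x h hl h0 hw hn

lemma long_inactive (h : S.Head x i) (hl : S.Long x i)
    (hC : S.Zr x (i - S.K1) i → S.word (shf x i) ∉ S.TC (shf x i)) :
    S.Head (S.C 1 (S.D 1 x)) i ∧ S.Long (S.C 1 (S.D 1 x)) i ∧
      ∀ k < i + S.m + S.K + 1, S.C 1 (S.D 1 x) k = x k := by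
  have hp := S.toGliderBase.par
  obtain ⟨h1, -, h3⟩ := inactive h (hl.ns h.ne) (by omega) (long_D hl) fun y hy hv hm => by
    have h0 : S.Zr x (i - S.K1) i :=
      (vC_shf.1 hv).1.congr fun k _ _ => (hy k (by omega)).symm
    refine hC h0 ?_
    rw [word_shf_congr (y := y) (x := x) fun k _ _ => hy k (by omega)] at hm
    rwa [((vC_of_long hl h.ne h0).congr (w := shf y i)
      (hv.1) fun k _ _ => hy _ (by omega)).2] at hm
  exact ⟨h1, hl.congr fun k _ hk => h3 k hk, h3⟩

/-- If the word is frozen, Q leaves as a glider. It is followed by exactly `kap` zeros: with another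
period of zeros it would already count as part of the fleet, contrary to `nf`, and runs end only
after whole periods. -/
lemma up_long_Q (h : S.Head x i) (hl : S.Long x i) (h0 : S.Zr x (i - S.K1) i) (hQ : S.AtQ x i)
    (h1 : S.Zr x (i + S.l) (i + S.l + S.kap)) : S.Up x (i + 1) (i + S.m + 1) := by
  have hp := S.toGliderBase.par
  by_cases hw : S.word (shf x i) ∈ S.TC (shf x i)
  · exact up_long_of_mem h hl h0 hw
  · obtain ⟨h2, h3, h4⟩ := long_inactive h hl fun _ => hw
    have h5 := h.nonzero_at ⟨Or.inr hQ, h1⟩ fun hz => h.nf ⟨h0, hQ, hz⟩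
    refine Up.of_step (up_long_emit h2 h3 (h0.congr fun k _ _ => h4 k (by omega))
      (hQ.congr fun k _ _ => h4 _ (by omega)) (h1.congr fun k _ _ => h4 k (by omega)) ?_)
    rw [h4 _ (by omega)]; exact h5

/-- A frozen P either moves right or, lacking room, flips to Q and then falls under the previous
case. -/
lemma up_long_gap (h : S.Head x i) (hl : S.Long x i) (h0 : S.Zr x (i - S.K1) i) :
    S.Up x (i + 1) (i + S.m + 1) := by
  have hp := S.toGliderBase.par
  by_cases hw : S.word (shf x i) ∈ S.TC (shf x i)
  · exact up_long_of_mem h hl h0 hw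
  · have hv := vC_of_long hl h.ne h0
    rw [mem_TC_iff hv, not_or, not_not, Free.shf_iff, zero_add] at hw
    obtain ⟨hf, hwe⟩ := hw
    have hw : S.word (shf x i) ∉ S.TC (shf x i) := by
      rw [mem_TC_iff hv, not_or, not_not, Free.shf_iff, zero_add]
      exact ⟨hf, hwe⟩
    rcases hf with ⟨hP | hQ, h1⟩
    swap
    · exact up_long_Q h hl h0 hQ h1
    obtain ⟨h2, h3, h4⟩ := long_inactive h hl fun _ => hw
    refine Up.of_step ?_
    unfold G
    have h0' := h0.congr (y := S.C 1 (S.D 1 x)) fun k _ _ => h4 k (by omega)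
    have hP' := hP.congr (y := S.C 1 (S.D 1 x)) (s' := i) fun k _ _ => h4 _ (by omega)
    have h1' := h1.congr (y := S.C 1 (S.D 1 x)) fun k _ _ => h4 k (by omega)
    generalize S.C 1 (S.D 1 x) = u at *
    by_cases h5 : S.Zr u (i + S.l) (i + S.l + S.kap + S.p)
    · exact up_long_move h2 h3 h5 (Or.inl ⟨h0', hP'⟩)
    · obtain ⟨h6, h7, h8, h9⟩ := h2.flip (h3.ns h2.ne) (by omega) h0' hP' h1' h5
      refine up_long_Q h6 (fun a h10 h11 h12 => ?_)
        ((h2.gap_iff h9).2 (h0'.mono (by omega) le_rfl)) h7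
        (h1'.congr fun k _ _ => h8 k (by omega) (by omega))
      rcases nonzero_or h12 h7.last with h13 | h13
      · exact h3 a h10 h11 (h12.congr fun k _ _ => (h8 k (by omega) (by omega)).symm)
      · omega

/-- Here `n` bounds the number of zeros missing from a gap of length `K1`; it drops by `p` in each
idle step. The one event that can interrupt the waiting is a Q pushed to the right by `I2` alone. -/
lemma up_long (n : ℕ) : ∀ x, S.Head x i → S.Long x i → S.Zr x (i - S.K1 + n) i →
    S.Up x (i + 1) (i + S.m + 1) := by
  have hp := S.toGliderBase.par
  induction n using Nat.strong_induction_on with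
  | h n ih =>
    intro x h hl hn
    by_cases h0 : S.Zr x (i - S.K1) i
    · exact up_long_gap h hl h0
    have hn0 : n ≠ 0 := by
      rintro rfl
      exact h0 (by simpa using hn)
    obtain ⟨h2, h3, h4⟩ := long_inactive h hl fun h => absurd h h0
    refine Up.of_step ?_
    unfold G
    have h0' : ¬ S.Zr (S.C 1 (S.D 1 x)) (i - S.K1) i := fun hc =>
      h0 (hc.congr fun k _ _ => (h4 k (by omega)).symm)
    have hn' := hn.congr (y := S.C 1 (S.D 1 x)) fun k _ _ => h4 k (by omega)
    generalize S.C 1 (S.D 1 x) = u at *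
    by_cases h5 : S.Zr u (i - S.K) i ∧ S.AtQ u i ∧ S.Zr u (i + S.l) (i + S.l + S.kap + S.p)
    · exact up_long_move h2 h3 h5.2.2 (Or.inr ⟨h5.1, h0', h5.2.1⟩)
    · obtain ⟨h6, h7, h8⟩ := h2.static (h3.ns h2.ne) (by omega) (fun hn => h0' hn.1) h5
      refine ih (n - S.p) (by omega) _ h6 (h3.congr fun k a b => h7 k (by omega) (by omega))
        ((h2.gap_iff h8).2 (hn'.mono ?_ le_rfl))
      by_cases h9 : S.p ≤ n
      · push_cast [h9]; omega
      · omega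

end GliderSys

/-! ### Progress when a long run of zeros starts soon after the head. -/

namespace GliderSys

open ZeroSys GliderBase

variable {S : GliderSys B} {x u : ℤ → B} {i j E : ℤ}

lemma LF.restrict {x : ℤ → B} {c i : ℤ} (h : S.LF x i) (hz : S.Zr x c i) (hc : c + S.kap ≤ i) :
    S.LF x (c + S.kap) := by
  have hp := S.toGliderBase.par
  refine ⟨h.1, fun k hk hkz => ?_⟩
  obtain ⟨q, h1, h2, h3, h4, h5, h6⟩ := h.2 k (by omega) hkz
  refine ⟨q, h1, h2, h3, h4, h5, ?_⟩
  have := nonzero_or hz hkz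
  rcases nonzero_or hz h3.last with h7 | h7 <;> omega

/-- A long run of zeros starts at `j`, shortly after `i`. -/
def Short (S : GliderSys B) (x : ℤ → B) (i j : ℤ) : Prop :=
  i < j ∧ j ≤ i + S.m ∧ ¬ S.Z (x (j - 1)) ∧ S.Zr x j (j + S.K)

lemma Short.congr {y : ℤ → B} (h : S.Short x i j)
    (hxy : ∀ k, j - 1 ≤ k → k < j + S.K → y k = x k) : S.Short y i j := by
  have hp := S.toGliderBase.par
  exact ⟨h.1, h.2.1, by rw [hxy _ (by omega) (by omega)]; exact h.2.2.1,
    h.2.2.2.congr fun k _ _ => hxy k (by omega) (by omega)⟩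

lemma Short.ns (h : S.Short x i j) (hx : ¬ S.Z (x i)) : S.NS x i (j + S.K) := by
  have hp := S.toGliderBase.par
  obtain ⟨h1, h2, h3, h4⟩ := h
  intro s h5 h6 h7
  rcases nonzero_or h7 hx with h8 | h8 <;> rcases nonzero_or h7 h3 with h9 | h9 <;> omega

/-- A window of `D` has a nonzero last letter followed by `K` zeros, so it must end exactly where
the long run starts. -/
lemma Short.site (h : S.Short x i j) {s : ℤ} (h1 : s ≤ i) (h2 : i < s + S.m)
    (h3 : S.vD (shf x s)) : s = j - S.m := by
  have hp := S.toGliderBase.par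
  obtain ⟨h5, h6, h7, h8⟩ := h
  obtain ⟨-, h10, h11⟩ := vD_shf.1 h3
  rcases nonzero_or h8 h11 with h12 | h12 <;> rcases nonzero_or h10 h7 with h13 | h13 <;> omega

lemma Short.not_vC (h : S.Short x i j) : ¬ S.vC (shf x i) := fun hv =>
  (vC_shf.1 hv).2.2 j h.1.le h.2.1 h.2.2.2

lemma Short.vD (h : S.Short x i j) (h0 : S.Zr x (j - S.m - S.K1) i) :
    S.vD (shf x (j - S.m)) := by
  obtain ⟨h5, h6, h7, h8⟩ := h
  rw [vD_shf, sub_add_cancel]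
  exact ⟨h0.mono le_rfl (by omega), h8, h7⟩

variable [Finite B]

lemma short_inactive (h : S.Head x i) (hs : S.Short x i j) (hD : S.Zr x (j - S.m - S.K1) i →
    S.word (shf x (j - S.m)) ∉ S.TD (shf x (j - S.m))) :
    S.Head (S.C 1 (S.D 1 x)) i ∧ S.Short (S.C 1 (S.D 1 x)) i j ∧
      ∀ k < j + S.K, S.C 1 (S.D 1 x) k = x k := by
  have hp := S.toGliderBase.par
  have hs' := hs
  obtain ⟨h5, h6, h7, h8⟩ := hs'
  obtain ⟨h1, -, h3⟩ := inactive h (hs.ns h.ne) (by omega) (fun s h1 h2 h3 h4 => by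
    have := hs.site h1 h2 h3
    subst this
    exact hD h4) fun y hy hv => absurd hv (hs.congr fun k _ hk => hy k hk).not_vC
  exact ⟨h1, hs.congr fun k _ hk => h3 k hk, h3⟩

/-- The kernel is the last thing before the long run and moves into it, so the next long run starts
later. -/
lemma up_short_move_last (h : S.Head u i) (hs : S.Short u i j) (hj : j = i + S.l)
    (hh : (S.Zr u (i - S.K1) i ∧ S.AtP u i) ∨
      (S.Zr u (i - S.K) i ∧ ¬ S.Zr u (i - S.K1) i ∧ S.AtQ u i)) :
    S.Up (S.I2 (S.I1 u)) (j - S.m) (j + 1) := by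
  have hp := S.toGliderBase.par
  obtain ⟨h3, h4, h5⟩ := h.move (hs.ns h.ne) (by omega)
    (hs.2.2.2.mono (by omega) (by omega)) hh
  refine Up.of_head h3 (by omega) fun a h6 h7 => ?_
  rcases nonzero_or h7 h4.last with h8 | h8 <;> omega

omit [Finite B] in
lemma short_move (h : S.Head u i) (hs : S.Short u i j) (hj : j ≠ i + S.l)
    (h1 : S.Zr u (i + S.l) (i + S.l + S.kap + S.p))
    (hh : (S.Zr u (i - S.K1) i ∧ S.AtP u i) ∨
      (S.Zr u (i - S.K) i ∧ ¬ S.Zr u (i - S.K1) i ∧ S.AtQ u i)) :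
    S.Head (S.I2 (S.I1 u)) (i + S.p) ∧ S.Short (S.I2 (S.I1 u)) (i + S.p) j := by
  have hp := S.toGliderBase.par
  have hla : ¬ S.Z (u (i + S.l - 1)) := hh.elim (fun h => h.2.last) fun h => h.2.2.last
  have hs' := hs
  obtain ⟨h5, h6, h7, h8⟩ := hs'
  have hns := hs.ns h.ne
  have hj1 : i + S.l + S.kap + S.p < j := by
    rcases nonzero_or h8 hla with h9 | h9 <;> rcases nonzero_or h1 h7 with h10 | h10 <;> omega
  obtain ⟨h3, h4, h5⟩ := h.move hns (by omega) h1 hh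
  have := hs.congr fun k h9 h10 => h5 k (by omega) (by omega)
  exact ⟨h3, by omega, by omega, this.2.2⟩

omit [Finite B] in
lemma short_emit (h : S.Head u i) (hs : S.Short u i j) (h0 : S.Zr u (i - S.K1) i)
    (hQ : S.AtQ u i) (h1 : S.Zr u (i + S.l) (i + S.l + S.kap))
    (h2 : ¬ S.Z (u (i + S.l + S.kap))) :
    S.Head (S.I2 (S.I1 u)) (i + S.l + S.kap) ∧ S.Short (S.I2 (S.I1 u)) (i + S.l + S.kap) j ∧
      (∀ k, i + S.l + S.kap ≤ k → k < j + S.K → S.I2 (S.I1 u) k = u k) ∧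
      ¬ S.Zr (S.I2 (S.I1 u)) (i + S.l + S.kap - S.K1) (i + S.l + S.kap) := by
  have hp := S.toGliderBase.par
  have hs' := hs
  obtain ⟨h5, h6, h7, h8⟩ := hs'
  have hj : i + S.l + S.kap < j := by rcases nonzero_or h8 h2 with h9 | h9 <;> omega
  obtain ⟨h9, h10, h11⟩ := h.emit (hs.ns h.ne) (by omega) h0 hQ h1 h2
  have := hs.congr fun k h9 h12 => h10 k (by omega) (by omega)
  exact ⟨h9, ⟨hj, by omega, this.2.2⟩, h10, h11⟩

/-- Trains of gliders are emitted. -/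
lemma up_QP (n : ℕ) : ∀ (N : ℕ) (i : ℤ) (x : ℤ → B), S.Head x i → S.QP x n i j →
    S.Zr x j (j + S.K) → j - i ≤ S.m - S.p → ¬ S.Zr x (i - S.K1 - S.p) i →
    S.Zr x (i - S.K1 + N) i → S.Up x (j - S.m) (j + 1) := by
  have hp := S.toGliderBase.par
  induction n with
  | zero =>
    intro N
    induction N using Nat.strong_induction_on with
    | h N ih =>
      intro i x h hq hz hl hg hN
      have hs : S.Short x i j := ⟨by have := hq.le; omega, by omega, hq.last, hz⟩
      have hij := hs.1
      -- The window of `D` starts at least `p` before the head, so `D` would need `K1 + p` zeros in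
      -- front of the head, which `hg` denies. The train is therefore not disturbed while it waits.
      obtain ⟨h1, h2, h3⟩ := short_inactive h hs fun hc => absurd (hc.mono (by omega) le_rfl) hg
      refine Up.of_step ?_
      unfold G
      have hq' := hq.congr (y := S.C 1 (S.D 1 x)) (d := 0) fun k _ _ => by
        rw [add_zero]; exact h3 k (by omega)
      rw [add_zero, add_zero] at hq'
      have hN' := hN.congr (y := S.C 1 (S.D 1 x)) fun k _ _ => h3 k (by have := hq.le; omega)
      generalize S.C 1 (S.D 1 x) = u at *
      by_cases h0 : S.Zr u (i - S.K1) i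
      · exact up_short_move_last h1 h2 hq'.2 (Or.inl ⟨h0, hq'.1⟩)
      · obtain ⟨h6, h7, h8⟩ := h1.static (h2.ns h1.ne) (by have := hq.le; omega)
          (fun hn => h0 hn.1) (fun hn => not_AtP_AtQ hq'.1 hn.2.1)
        have hN0 : N ≠ 0 := by
          rintro rfl
          exact h0 (by simpa using hN')
        refine ih (N - S.p) (by omega) i _ h6 ?_ (h2.2.2.2.congr fun k _ _ => h7 k (by omega)
          (by omega)) hl (fun hc => h0 (((h1.gap_iff h8).1 hc).mono (by omega) le_rfl))
          ((h1.gap_iff h8).2 (hN'.mono ?_ le_rfl))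
        · have := hq'.congr (y := S.I2 (S.I1 u)) (d := 0) fun k _ _ => by
            rw [add_zero]; exact h7 k (by omega) (by omega)
          rwa [add_zero, add_zero] at this
        · by_cases h9 : S.p ≤ N
          · push_cast [h9]; omega
          · omega
  | succ n ihn =>
    intro N
    induction N using Nat.strong_induction_on with
    | h N ih =>
      intro i x h hq hz hl hg hN
      have hs : S.Short x i j := ⟨by have := hq.le; omega, by omega, hq.last, hz⟩
      have hij := hs.1
      obtain ⟨h1, h2, h3⟩ := short_inactive h hs fun hc => absurd (hc.mono (by omega) le_rfl) hg
      refine Up.of_step ?_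
      unfold G
      have hq' := hq.congr (y := S.C 1 (S.D 1 x)) (d := 0) fun k _ _ => by
        rw [add_zero]; exact h3 k (by omega)
      rw [add_zero, add_zero] at hq'
      have hN' := hN.congr (y := S.C 1 (S.D 1 x)) fun k _ _ => h3 k (by have := hq.le; omega)
      have hle := hq.2.2.le
      generalize S.C 1 (S.D 1 x) = u at *
      by_cases h0 : S.Zr u (i - S.K1) i
      · obtain ⟨h4, h5, h6, h7⟩ := short_emit h1 h2 h0 hq'.1 hq'.2.1 hq'.2.2.first
        refine ihn S.K1.toNat _ _ h4 ?_ h5.2.2.2 (by omega)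
          (fun hc => h7 (hc.mono (by omega) le_rfl)) (fun k _ _ => by omega)
        have := hq'.2.2.congr (y := S.I2 (S.I1 u)) (d := 0) fun k _ _ => by
          rw [add_zero]; exact h6 k (by omega) (by omega)
        rwa [add_zero, add_zero] at this
      · obtain ⟨h6, h7, h8⟩ := h1.static (h2.ns h1.ne) (by omega)
          (fun hn => h0 hn.1) (fun hn => hq'.2.2.first (hn.2.2 _ (by omega) (by omega)))
        have hN0 : N ≠ 0 := by
          rintro rfl
          exact h0 (by simpa using hN')
        refine ih (N - S.p) (by omega) i _ h6 ?_ (h2.2.2.2.congr fun k _ _ => h7 k (by omega)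
          (by omega)) hl (fun hc => h0 (((h1.gap_iff h8).1 hc).mono (by omega) le_rfl))
          ((h1.gap_iff h8).2 (hN'.mono ?_ le_rfl))
        · have := hq'.congr (y := S.I2 (S.I1 u)) (d := 0) fun k _ _ => by
            rw [add_zero]; exact h7 k (by omega) (by omega)
          rwa [add_zero, add_zero] at this
        · by_cases h9 : S.p ≤ N
          · push_cast [h9]; omega
          · omega

lemma up_short_eD (h : S.Head u i) (hs : S.Short u i j) (h0 : S.Zr u (j - S.m - S.K1) i)
    (hw : S.word (shf u (j - S.m)) = S.eD (u (j - S.m - 1))) :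
    S.Up (S.I2 (S.I1 u)) (j - S.m) (j + 1) := by
  have hp := S.toGliderBase.par
  have hs' := hs
  obtain ⟨h5, h6, h7, h8⟩ := hs'
  obtain ⟨n, hq⟩ := QP_of_eD h.mem (hs.vD h0) (by omega) (by omega)
    (h0.mono (by omega) le_rfl) h.ne hw
  rw [sub_add_cancel] at hq
  obtain ⟨h4, h5, h6, h7⟩ := short_emit h hs (h0.mono (by omega) le_rfl) hq.1 hq.2.1 hq.2.2.first
  refine up_QP n S.K1.toNat _ _ h4 ?_ h5.2.2.2 (by omega)
    (fun hc => h7 (hc.mono (by omega) le_rfl)) (fun k _ _ => by omega)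
  have := hq.2.2.congr (y := S.I2 (S.I1 u)) (d := 0) fun k _ _ => by
    rw [add_zero]; exact h6 k (by omega) (by omega)
  rwa [add_zero, add_zero] at this

/-- The state after the first two rules, if the rule for short words is active. -/
lemma short_active (h : S.Head x i) (hs : S.Short x i j) (h0 : S.Zr x (j - S.m - S.K1) i)
    (hw : S.word (shf x (j - S.m)) ∈ S.TD (shf x (j - S.m))) :
    ∃ i', S.Head (S.C 1 (S.D 1 x)) i' ∧ S.Short (S.C 1 (S.D 1 x)) i' j ∧
      S.Zr (S.C 1 (S.D 1 x)) (j - S.m - S.K1) i' ∧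
      S.C 1 (S.D 1 x) (j - S.m - 1) = x (j - S.m - 1) ∧
      S.TD (shf (S.C 1 (S.D 1 x)) (j - S.m)) = S.TD (shf x (j - S.m)) ∧
      S.word (shf (S.C 1 (S.D 1 x)) (j - S.m)) =
        cyc (S.TD (shf x (j - S.m))) (S.word (shf x (j - S.m))) := by
  have hp := S.toGliderBase.par
  have hv := hs.vD h0
  have hs' := hs
  obtain ⟨h5, h6, h7, h8⟩ := hs'
  have e1 : ∀ k < j + S.K, (k < j - S.m ∨ j ≤ k) → S.D 1 x k = x k := fun k hk hk' =>
    D_out h (hs.ns h.ne) hk fun s a b c d e f => by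
      have := hs.site a b c
      omega
  have hw2 : S.word (shf (S.D 1 x) (j - S.m)) =
      cyc (S.TD (shf x (j - S.m))) (S.word (shf x (j - S.m))) := by
    have := ruleD.win (ε := 1) h.mem hv
    rwa [zpow_one] at this
  have hm2 : S.word (shf (S.D 1 x) (j - S.m)) ∈ S.TD (shf x (j - S.m)) := by
    have := cyc_zpow_mem 1 hw
    rw [zpow_one] at this
    rw [hw2]; exact this
  have hctx := app_ctx (n := S.m) (t := fun u a =>
    S.put ((cyc (S.TD u) ^ (1 : ℤ)) (S.word u)) u a) K1_nonneg (ruleD.sp _ h.mem) hv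
  obtain ⟨hv2, hT2⟩ := ruleD.inv _ (S.shift_mem _ h.mem (j - S.m)) hv (shf (S.D 1 x) (j - S.m))
    (fun k a b => hctx k (Or.inl ⟨a, b⟩)) (fun k a b => hctx k (Or.inr ⟨a, b⟩)) hw hm2
  have hdX := D_mem h.mem
  have hv2' := vD_shf.1 hv2
  rw [sub_add_cancel] at hv2'
  obtain ⟨i', h9, h10, h11, h12⟩ := exists_first (S := S.toZeroSys) (a := j - S.m) (by omega)
    hv2'.2.2
  have hlf : S.LF (S.D 1 x) (j - S.m - S.K1 + S.kap) :=
    (LF.restrict h.lf' h0 (by omega)).congr fun k _ => e1 k (by omega) (by omega)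
  have h13 : S.Zr (S.D 1 x) (j - S.m - S.K1) i' := hv2'.1.append h12
  have hhead : S.Head (S.D 1 x) i' := by
    refine ⟨hdX, hlf.extend (h13.mono (by omega) (by omega)) (by omega),
      h13.mono (by omega) le_rfl, h11, fun hn => ?_⟩
    rw [← hT2, mem_TD_iff hdX hv2 h9 (by omega) h12 h11] at hm2
    rcases hm2 with h14 | h14
    · exact h14 ⟨Or.inr hn.2.1, hn.2.2.mono le_rfl (by omega)⟩
    · obtain ⟨n, h15⟩ := QP_of_eD hdX hv2 h9 (by omega) h12 h11 h14
      exact h15.2.2.first (hn.2.2 _ (by omega) (by omega))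
  have hshort : S.Short (S.D 1 x) i' j := ⟨by omega, by omega, hv2'.2.2, hv2'.2.1⟩
  have e2 : ∀ k < j + S.K, S.C 1 (S.D 1 x) k = S.D 1 x k := fun k hk =>
    C_out hhead (hshort.ns h11) hk fun hc => absurd hc hshort.not_vC
  have e3 : S.C 1 (S.D 1 x) (j - S.m - 1) = x (j - S.m - 1) := by
    rw [e2 _ (by omega), e1 _ (by omega) (by omega)]
  refine ⟨i', hhead.congr (C_mem hdX) (E := j + S.K) (by omega) e2,
    hshort.congr fun k _ hk => e2 k hk, h13.congr fun k _ _ => e2 k (by omega), e3, ?_, ?_⟩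
  · unfold TD
    rw [shf_apply, shf_apply, show -1 + (j - S.m) = j - S.m - 1 by ring, e3]
  · rw [word_shf_congr fun k _ _ => e2 k (by omega), hw2]

/-- Analogue of `up_long_orbit`. The head varies during the rotation because words of the cycle may
begin with different numbers of zeros; the window, ending at `j`, is fixed. -/
lemma up_short_orbit (n : ℕ) : ∀ (i : ℤ) (x : ℤ → B), S.Head x i → S.Short x i j →
    S.Zr x (j - S.m - S.K1) i → S.word (shf x (j - S.m)) ∈ S.TD (shf x (j - S.m)) →
    (cyc (S.TD (shf x (j - S.m))) ^ (n + 1)) (S.word (shf x (j - S.m))) =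
      S.eD (x (j - S.m - 1)) → S.Up x (j - S.m) (j + 1) := by
  have hp := S.toGliderBase.par
  induction n with
  | zero =>
    intro i x h hs h0 hw he
    obtain ⟨i', h1, h2, h3, h4, h5, h6⟩ := short_active h hs h0 hw
    refine Up.of_step (up_short_eD h1 h2 h3 ?_)
    rw [h6, h4, ← he, zero_add, pow_one]
  | succ n ih =>
    intro i x h hs h0 hw he
    obtain ⟨i', h1, h2, h3, h4, h5, h6⟩ := short_active h hs h0 hw
    refine Up.of_step ?_
    have hm : S.word (shf (S.C 1 (S.D 1 x)) (j - S.m)) ∈ S.TD (shf x (j - S.m)) := by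
      rw [h6]
      have := cyc_zpow_mem 1 hw
      rwa [zpow_one] at this
    rw [← h5] at hm
    rw [pow_succ, Equiv.Perm.mul_apply, ← h6, ← h5, ← h4] at he
    have hv := h2.vD h3
    have hm' := hm
    have h2' := h2
    obtain ⟨g1, g2, -, g3⟩ := h2'
    rw [mem_TD_iff h1.mem hv (f := i') (by omega) (by omega) (h3.mono (by omega) le_rfl) h1.ne]
      at hm'
    unfold G
    generalize S.C 1 (S.D 1 x) = u at *
    by_cases hf : S.Free u i'
    · exact up_short_eD h1 h2 h3 (hm'.resolve_left fun h => h hf)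
    · obtain ⟨h6, h7, h8⟩ := h1.static (h2.ns h1.ne) (by omega) (fun hn => hf hn.2)
        (fun hn => hf ⟨Or.inr hn.2.1, hn.2.2.mono le_rfl (by omega)⟩)
      have h0' : S.Zr (S.I2 (S.I1 u)) (j - S.m - S.K1) i' :=
        (h1.gap_iff h8).2 (h3.mono (by omega) le_rfl)
      -- The gap is made of zeros before and after the step, with the phase determined by the
      -- unmoved head, so its letters are literally the same.
      have e0 : ∀ k, j - S.m - S.K1 ≤ k → k < i' → S.I2 (S.I1 u) k = u k := fun k a b => by
        rw [align_left h6.mem h0' h6.ne k a b, align_left h1.mem h3 h1.ne k a b]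
      have e1 : ∀ k, j - S.m - S.K1 ≤ k → k < j → S.I2 (S.I1 u) k = u k := fun k a b => by
        by_cases hk : k < i'
        · exact e0 k a hk
        · exact h7 k (by omega) (by omega)
      have e := word_shf_congr (S := S) (x := u) (y := S.I2 (S.I1 u)) (s := j - S.m)
        fun k a b => e1 k (by omega) (by omega)
      have hT : S.TD (shf (S.I2 (S.I1 u)) (j - S.m)) = S.TD (shf u (j - S.m)) := by
        unfold TD
        rw [shf_apply, shf_apply, e1 _ (by omega) (by omega)]
      refine ih i' _ h6 (h2.congr fun k a b => h7 k (by omega) (by omega)) h0' ?_ ?_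
      · rw [e, hT]; exact hm
      · rw [e, hT, e1 _ (by omega) (by omega)]; exact he

lemma up_short_of_mem (h : S.Head x i) (hs : S.Short x i j) (h0 : S.Zr x (j - S.m - S.K1) i)
    (hw : S.word (shf x (j - S.m)) ∈ S.TD (shf x (j - S.m))) : S.Up x (j - S.m) (j + 1) := by
  have hp := S.toGliderBase.par
  have e : (shf x (j - S.m)) (-1) = x (j - S.m - 1) := by rw [shf_apply]; congr 1; ring
  have hs' := hs
  obtain ⟨g1, g2, -, g3⟩ := hs'
  have he : S.eD (x (j - S.m - 1)) ∈ S.TD (shf x (j - S.m)) := by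
    have hw' := hw
    unfold TD at hw' ⊢
    rw [e] at hw' ⊢
    obtain ⟨h1, n, f, h2, h3, h4⟩ := S.eD_spec _ _ (h0 _ (by omega) (by omega)) hw'.1 hw'.2.1
    exact ⟨h1, h4.last, Or.inr rfl⟩
  obtain ⟨n, hn⟩ := cyc_reach hw he
  exact up_short_orbit n i x h hs h0 hw hn

section

variable (IH : ∀ (i' : ℤ) (x : ℤ → B), i < i' → S.Head x i' → S.Short x i' j →
  S.Up x (j - S.m) (j + 1))

include IH

/-- If `D` does not act, emission brings the head closer to `j`, and the induction hypothesis for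
heads further right applies. -/
lemma up_short_Q (h : S.Head x i) (hs : S.Short x i j) (h0 : S.Zr x (i - S.K1) i)
    (hQ : S.AtQ x i) (h1 : S.Zr x (i + S.l) (i + S.l + S.kap)) : S.Up x (j - S.m) (j + 1) := by
  have hp := S.toGliderBase.par
  have hj := hs.1
  by_cases hw : S.Zr x (j - S.m - S.K1) i ∧
    S.word (shf x (j - S.m)) ∈ S.TD (shf x (j - S.m))
  · exact up_short_of_mem h hs hw.1 hw.2
  · obtain ⟨h2, h3, h4⟩ := short_inactive h hs fun a b => hw ⟨a, b⟩
    have h5 := h.nonzero_at ⟨Or.inr hQ, h1⟩ fun hz => h.nf ⟨h0, hQ, hz⟩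
    rw [← h4 _ (by omega)] at h5
    obtain ⟨h6, h7, -⟩ := short_emit h2 h3 (h0.congr fun k _ _ => h4 k (by omega))
      (hQ.congr fun k _ _ => h4 _ (by omega)) (h1.congr fun k _ _ => h4 k (by omega)) h5
    exact Up.of_step (IH _ _ (by omega) h6 h7)

lemma up_short_free (h : S.Head x i) (hs : S.Short x i j) (h0 : S.Zr x (i - S.K1) i)
    (hf : S.Free x i) : S.Up x (j - S.m) (j + 1) := by
  have hp := S.toGliderBase.par
  have hj := hs.1
  obtain ⟨hP | hQ, h1⟩ := hf
  swap
  · exact up_short_Q IH h hs h0 hQ h1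
  by_cases hw : S.Zr x (j - S.m - S.K1) i ∧
    S.word (shf x (j - S.m)) ∈ S.TD (shf x (j - S.m))
  · exact up_short_of_mem h hs hw.1 hw.2
  obtain ⟨h2, h3, h4⟩ := short_inactive h hs fun a b => hw ⟨a, b⟩
  refine Up.of_step ?_
  unfold G
  have h0' := h0.congr (y := S.C 1 (S.D 1 x)) fun k _ _ => h4 k (by omega)
  have hP' := hP.congr (y := S.C 1 (S.D 1 x)) (s' := i) fun k _ _ => h4 _ (by omega)
  have h1' := h1.congr (y := S.C 1 (S.D 1 x)) fun k _ _ => h4 k (by omega)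
  generalize S.C 1 (S.D 1 x) = u at *
  by_cases hl : j = i + S.l
  · exact up_short_move_last h2 h3 hl (Or.inl ⟨h0', hP'⟩)
  by_cases h5 : S.Zr u (i + S.l) (i + S.l + S.kap + S.p)
  · obtain ⟨h6, h7⟩ := short_move h2 h3 hl h5 (Or.inl ⟨h0', hP'⟩)
    exact IH _ _ (by omega) h6 h7
  · obtain ⟨h6, h7, h8, h9⟩ := h2.flip (h3.ns h2.ne) (by omega) h0' hP' h1' h5
    have hl' : i + S.l < j := by
      have h3' := h3
      obtain ⟨g1, g2, g3, g4⟩ := h3'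
      rcases nonzero_or g4 hP'.last with h10 | h10 <;> omega
    exact up_short_Q IH h6 (h3.congr fun k a b => h8 k (by omega) (by omega))
      ((h2.gap_iff h9).2 (h0'.mono (by omega) le_rfl)) h7
      (h1'.congr fun k _ _ => h8 k (by omega) (by omega))

-- A head that is not a free kernel never moves by itself, and its word is never frozen for `D`. It
-- waits until the gap also covers the left context of the window ending at `j`.
omit IH in
lemma up_short_nonfree (N : ℕ) : ∀ x, S.Head x i → S.Short x i j → ¬ S.Free x i →
    S.Zr x (j - S.m - S.K1 + N) i → S.Up x (j - S.m) (j + 1) := by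
  have hp := S.toGliderBase.par
  induction N using Nat.strong_induction_on with
  | h N ih =>
    intro x h hs hf hN
    have hs' := hs
    obtain ⟨g1, g2, g3, g4⟩ := hs'
    by_cases h0 : S.Zr x (j - S.m - S.K1) i
    · refine up_short_of_mem h hs h0 ?_
      rw [mem_TD_iff h.mem (hs.vD h0) (f := i) (by omega) (by omega)
        (h0.mono (by omega) le_rfl) h.ne]
      exact Or.inl hf
    · obtain ⟨h2, h3, h4⟩ := short_inactive h hs fun hc => absurd hc h0
      refine Up.of_step ?_
      unfold G
      have hN' := hN.congr (y := S.C 1 (S.D 1 x)) fun k _ _ => h4 k (by omega)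
      have hf' : ¬ S.Free (S.C 1 (S.D 1 x)) i := fun hc =>
        hf (hc.congr fun k _ _ => (h4 k (by omega)).symm)
      have hN0 : N ≠ 0 := by
        rintro rfl
        exact h0 (by simpa using hN)
      generalize S.C 1 (S.D 1 x) = u at *
      obtain ⟨h6, h7, h8⟩ := h2.static (h3.ns h2.ne) (by omega) (fun hn => hf' hn.2)
        (fun hn => hf' ⟨Or.inr hn.2.1, hn.2.2.mono le_rfl (by omega)⟩)
      refine ih (N - S.p) (by omega) _ h6 (h3.congr fun k a b => h7 k (by omega) (by omega))
        (fun hc => hf' (hc.congr fun k _ _ => (h7 k (by omega) (by omega)).symm))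
        ((h2.gap_iff h8).2 (hN'.mono ?_ le_rfl))
      by_cases h9 : S.p ≤ N
      · push_cast [h9]; omega
      · omega

lemma up_short_wait (N : ℕ) : ∀ x, S.Head x i → S.Short x i j → S.Zr x (i - S.K1 + N) i →
    S.Up x (j - S.m) (j + 1) := by
  have hp := S.toGliderBase.par
  induction N using Nat.strong_induction_on with
  | h N ih =>
    intro x h hs hN
    have hs' := hs
    obtain ⟨g1, g2, g3, g4⟩ := hs'
    by_cases h0 : S.Zr x (i - S.K1) i
    · by_cases hf : S.Free x i
      · exact up_short_free IH h hs h0 hf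
      · exact up_short_nonfree (i - (j - S.m - S.K1)).toNat x h hs hf fun k _ _ => by omega
    · obtain ⟨h2, h3, h4⟩ := short_inactive h hs fun hc => absurd (hc.mono (by omega) le_rfl) h0
      refine Up.of_step ?_
      unfold G
      have hN' := hN.congr (y := S.C 1 (S.D 1 x)) fun k _ _ => h4 k (by omega)
      have h0' : ¬ S.Zr (S.C 1 (S.D 1 x)) (i - S.K1) i := fun hc =>
        h0 (hc.congr fun k _ _ => (h4 k (by omega)).symm)
      have hN0 : N ≠ 0 := by
        rintro rfl
        exact h0 (by simpa using hN)
      generalize S.C 1 (S.D 1 x) = u at *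
      by_cases h5 : S.Zr u (i - S.K) i ∧ S.AtQ u i ∧ S.Zr u (i + S.l) (i + S.l + S.kap + S.p)
      · by_cases hl : j = i + S.l
        · exact up_short_move_last h2 h3 hl (Or.inr ⟨h5.1, h0', h5.2.1⟩)
        · obtain ⟨h6, h7⟩ := short_move h2 h3 hl h5.2.2 (Or.inr ⟨h5.1, h0', h5.2.1⟩)
          exact IH _ _ (by omega) h6 h7
      · obtain ⟨h6, h7, h8⟩ := h2.static (h3.ns h2.ne) (by omega) (fun hn => h0' hn.1) h5
        refine ih (N - S.p) (by omega) _ h6 (h3.congr fun k a b => h7 k (by omega) (by omega))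
          ((h2.gap_iff h8).2 (hN'.mono ?_ le_rfl))
        by_cases h9 : S.p ≤ N
        · push_cast [h9]; omega
        · omega

end

/-- Induction on the distance from the head to the long run, which shrinks whenever a kernel is
emitted or moves right without finishing the job. -/
lemma up_short (n : ℕ) : ∀ (i : ℤ) (x : ℤ → B), j - i ≤ n → S.Head x i → S.Short x i j →
    S.Up x (j - S.m) (j + 1) := by
  have hp := S.toGliderBase.par
  induction n with
  | zero =>
    intro i x hn _ hs
    have := hs.1
    push_cast at hn
    omega
  | succ n ih =>
    intro i x hn h hs
    push_cast at hn
    exact up_short_wait (fun i' x hi => ih i' x (by omega)) S.K1.toNat x h hs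
      fun k _ _ => by omega

end GliderSys

/-! ### Rightbound fleets and sorted configurations. -/

namespace GliderBase

open ZeroSys

/-- All nonzero letters of `x` from `b` on belong to rightbound gliders. -/
def RF (S : GliderBase B) (x : ℤ → B) (b : ℤ) : Prop :=
  (∃ A, ∀ k ≥ A, S.Z (x k)) ∧ ∀ k ≥ b, ¬ S.Z (x k) → ∃ q, q ≤ k ∧ k < q + S.l ∧ S.AtP x q ∧
    S.Zr x (q - S.K1) q

variable {S : GliderBase B} {x u : ℤ → B} {a b : ℤ}

lemma RF.mono (h : S.RF x a) (hab : a ≤ b) : S.RF x b := ⟨h.1, fun k hk => h.2 k (by omega)⟩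

lemma RF.extend (h : S.RF x b) (hz : S.Zr x a b) : S.RF x a := by
  refine ⟨h.1, fun k hk hkz => ?_⟩
  rcases nonzero_or hz hkz with h1 | h1
  · omega
  · exact h.2 k h1 hkz

lemma RF.congr {y : ℤ → B} (h : S.RF x b) (h1 : ∀ k ≥ b, y k = x k)
    (h2 : ∀ q, b < q + S.l → S.AtP x q → S.Zr x (q - S.K1) q → ∀ k, q - S.K1 ≤ k →
      k < q + S.l → y k = x k) : S.RF y b := by
  have hp := S.par
  obtain ⟨⟨A, hA⟩, h⟩ := h
  refine ⟨⟨max A b, fun k hk => ?_⟩, fun k hk hz => ?_⟩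
  · rw [h1 k (by omega)]; exact hA k (by omega)
  · rw [h1 k hk] at hz
    obtain ⟨q, h3, h4, h5, h6⟩ := h k hk hz
    have h7 := h2 q (by omega) h5 h6
    exact ⟨q, h3, h4, h5.congr fun k _ _ => h7 _ (by omega) (by omega),
      h6.congr fun k _ _ => h7 _ (by omega) (by omega)⟩

lemma RF.right (h : S.RF u b) {q : ℤ} (hq : b < q + S.l) (h1 : S.AtP u q)
    (_h2 : S.Zr u (q - S.K1) q) : S.Zr u (q + S.l) (q + S.l + S.K1) := by
  have hp := S.par
  intro k h3 h4
  by_contra hc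
  obtain ⟨r, h5, h6, h7, h8⟩ := h.2 k (by omega) hc
  rcases nonzero_or h8 h1.last with h9 | h9 <;> rcases nonzero_or h8 h1.first with h10 | h10 <;>
    omega

lemma RF.I1_nonzero (h : S.RF u b) {c : ℤ} (hc : b ≤ c) (hz : ¬ S.Z (S.I1 u c)) :
    ∃ q, q ≤ c ∧ c < q + S.l ∧ S.AtP u q ∧ S.Zr u (q - S.K1) q ∧ S.AtQ (S.I1 u) q ∧
      S.Zr u (q + S.l) (q + S.l + S.K1) := by
  have hp := S.par
  have key : ∀ q, b < q + S.l → S.AtP u q → S.Zr u (q - S.K1) q → S.AtQ (S.I1 u) q ∧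
      S.Zr u (q + S.l) (q + S.l + S.K1) := fun q h1 h2 h3 =>
    ⟨I1_P h3 h2 ((h.right h1 h2 h3).mono le_rfl (by omega)), h.right h1 h2 h3⟩
  by_cases hs : ∃ s, S.Zr u (s - S.K1) s ∧ S.Free u s ∧ (s ≤ c ∧ c < s + S.l)
  · obtain ⟨s, h1, h2, h3, h4⟩ := hs
    obtain ⟨q, h5, h6, h7, h8⟩ := h.2 (s + S.l - 1) (by omega) h2.last
    have : q = s := by
      rcases nonzero_or h1 h7.first with h9 | h9 <;>
        rcases nonzero_or h8 h2.first with h10 | h10 <;> omega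
    subst this
    exact ⟨q, h3, h4, h7, h8, key q (by omega) h7 h8⟩
  · push Not at hs
    rw [I1_out fun s h1 h2 h3 => absurd h3.2 (not_lt.2 (hs s h1 h2 h3.1))] at hz
    obtain ⟨q, h1, h2, h3, h4⟩ := h.2 c hc hz
    exact ⟨q, h1, h2, h3, h4, key q (by omega) h3 h4⟩

/-- Rightbound gliders are sites of the second rule. -/
lemma v2_of_RF {q : ℤ} (h1 : S.Zr u (q - S.K1) q) (h2 : S.AtQ (S.I1 u) q)
    (h3 : S.Zr u (q + S.l) (q + S.l + S.K1)) : S.v2 (shf (S.I1 u) q) := by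
  have hp := S.par
  have h4 := I1_zr h1 (by omega)
  have h5 := I1_zr h3 (by omega)
  refine v2_shf.2 ⟨h4.mono (by omega) le_rfl, Or.inr ⟨h2, h5.mono le_rfl (by omega)⟩,
    h5.mono (by omega) (by omega), fun hc => hc.last (h4 _ (by omega) (by omega))⟩

/-- In a rightbound fleet there are no sites of the second rule at `0P`. -/
lemma RF.no_P (h : S.RF u b) {s : ℤ} (hs : b ≤ s + S.p + S.l - 1)
    (h1 : S.Zr (S.I1 u) (s - S.K) s) (h2 : S.Zr (S.I1 u) s (s + S.p))
    (h3 : S.AtP (S.I1 u) (s + S.p)) : False := by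
  have hp := S.par
  obtain ⟨q, h4, h5, h6, h7, h8, h9⟩ := h.I1_nonzero hs h3.last
  have h10 := I1_zr h7 (by omega)
  have : q = s + S.p := by
    rcases nonzero_or (h1.append h2) h8.first with h11 | h11 <;>
      rcases nonzero_or h10 h3.first with h12 | h12 <;> omega
  subst this
  exact not_AtP_AtQ h3 h8

/-- Whatever is nonzero beyond `b` after a step stems from a window Q0 of `I2`, even if that window
straddles `b`. The `K` zeros in front of the window and the `p` zeros inside it then give the new P
its context of `K1` zeros. A window 0P reaching that far is impossible, since beyond `b` all kernels
are Q after `I1`. -/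
lemma RF.step_aux (hu : u ∈ S.X) (h : S.RF u b) {k : ℤ} (hk : b ≤ k)
    (hz : ¬ S.Z (S.I2 (S.I1 u) k)) : ∃ s, S.AtQ (S.I1 u) s ∧ S.Zr (S.I1 u) (s - S.K) s ∧
    s + S.p ≤ k ∧ k < s + S.p + S.l ∧ S.AtP (S.I2 (S.I1 u)) (s + S.p) ∧
    S.Zr (S.I2 (S.I1 u)) (s + S.p - S.K1) (s + S.p) := by
  have hp := S.par
  have hv := I1_mem hu
  by_cases hs : ∃ s, S.v2 (shf (S.I1 u) s) ∧ (s ≤ k ∧ k < s + S.l + S.p)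
  · obtain ⟨s, h1, h2, h3⟩ := hs
    have hin := fun j => I2_in hv h1 (k := j)
    have hctx := app_ctx (n := S.l + S.p) (t := S.t2) (x := S.I1 u) (R := S.K) (by omega)
      (fun s s' h h' => v2_sp hv h h') h1
    have h1' := v2_shf.1 h1
    have hk' := hin (k - s) (by omega) (by omega)
    rw [add_sub_cancel] at hk'
    rcases h1'.2.1 with ⟨h4, h5⟩ | ⟨h4, h5⟩
    · exfalso
      rw [t2_P (not_AtQ_of_zr (by rw [Zr.shf_iff]; simpa [add_comm] using h4))] at hk'
      by_cases h6 : k < s + S.l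
      · exact h.no_P (by omega) h1'.1 h4 h5
      · rw [S.Q_right _ (by omega)] at hk'
        exact hz ⟨_, hk'⟩
    · rw [t2_Q (by rw [AtQ.shf_iff]; simpa using h4)] at hin hk'
      obtain ⟨h6, h7⟩ := P_mid _ _ hin
      refine ⟨s, h4, h1'.1, ?_, by omega, h7, ?_⟩
      · by_contra hc
        exact hz (h6 _ h2 (by omega))
      · refine Zr.append (b := s) (fun c h8 h9 => ?_) h6
        have := hctx (c - s) (Or.inl ⟨by omega, by omega⟩)
        rw [shf_apply, shf_apply, sub_add_cancel] at this
        unfold I2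
        rw [this]
        exact h1'.1 _ (by omega) h9
  · exfalso
    have e : S.I2 (S.I1 u) k = S.I1 u k := app_out fun s h1 h2 => hs ⟨s, h1, by omega⟩
    rw [e] at hz
    obtain ⟨q, h1, h2, h3, h4, h5, h6⟩ := h.I1_nonzero hk hz
    exact hs ⟨q, v2_of_RF h4 h5 h6, h1, by omega⟩

lemma RF.bounded (hu : u ∈ S.X) (h : S.RF u b) : ∃ A, ∀ k ≥ A, S.Z (S.I2 (S.I1 u) k) := by
  have hp := S.par
  obtain ⟨A, hA⟩ := h.1
  refine ⟨max A b + S.l + S.p, fun k hk => ?_⟩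
  by_contra hc
  obtain ⟨s, h1, h2, h3, h4, -⟩ := h.step_aux hu (by omega) hc
  obtain ⟨q, h5, h6, h7, -⟩ := h.I1_nonzero (by omega) h1.first
  have := hA _ |> mt <| h7.last
  omega

lemma RF.next (hu : u ∈ S.X) (h : S.RF u b) : S.RF (S.I2 (S.I1 u)) b := by
  refine ⟨h.bounded hu, fun k hk hz => ?_⟩
  obtain ⟨s, h1, h2, h3, h4, h5, h6⟩ := h.step_aux hu hk hz
  exact ⟨s + S.p, h3, h4, h5, h6⟩

/-- Fleets of rightbound gliders move right. -/
lemma RF.step (hu : u ∈ S.X) (h : ∀ b, S.RF u b) (k : ℤ) :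
    S.I2 (S.I1 u) k = u (k - S.p) := by
  have hp := S.par
  have hv := I1_mem hu
  by_cases hq : ∃ q, q ≤ k ∧ k < q + S.l + S.p ∧ S.AtP u q ∧ S.Zr u (q - S.K1) q
  · obtain ⟨q, h1, h2, h3, h4⟩ := hq
    have h5 := (h q).right (by omega) h3 h4
    have h6 := I1_P h4 h3 (h5.mono le_rfl (by omega))
    have h7 := I2_in hv (v2_of_RF h4 h6 h5) (k := k - q) (by omega) (by omega)
    rw [add_sub_cancel, t2_Q (by rw [AtQ.shf_iff]; simpa using h6)] at h7
    rw [h7, shf_apply]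
    have e : q - S.p + S.p = q := by ring
    have h8 := eq_mid_P hu (s := q - S.p) (by rw [e]; exact h4.mono (by omega) le_rfl)
      (by rwa [e]) (k - q) (by omega) (by omega)
    rw [← sub_eq_add_neg, ← h8]
    congr 1; ring
  · have hz : S.Zr u (k - S.p) (k + 1) := by
      intro c h1 h2
      by_contra hc
      obtain ⟨q, h3, h4, h5, h6⟩ := (h c).2 c le_rfl hc
      exact hq ⟨q, by omega, by omega, h5, h6⟩
    rw [I2_out, I1_out]
    · obtain ⟨e, he⟩ := hz (k - S.p) le_rfl (by omega)
      rw [run hu hz he k (by omega) (by omega), he]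
      exact z_congr ⟨1, by ring⟩
    · intro s h1 h2 h3
      obtain ⟨q, h5, h6, h7, h8⟩ := (h s).2 s le_rfl h2.first
      have : q = s := by rcases nonzero_or h1 h7.first with h9 | h9 <;> omega
      subst this
      exact hq ⟨q, by omega, by omega, h7, h8⟩
    · intro s h1 h2 h3 h4
      rcases h2 with ⟨h5, h6⟩ | ⟨h5, h6⟩
      · exact (h _).no_P le_rfl h1 h5 h6
      · obtain ⟨q, h7, h8, h9, h10, h11, -⟩ := (h s).I1_nonzero le_rfl h5.first
        have : q = s := by rcases nonzero_or h1 h11.first with h12 | h12 <;> omega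
        subst this
        exact hq ⟨q, by omega, by omega, h9, h10⟩

/-- The gliders of `x` are sorted. -/
structure Sorted (S : GliderBase B) (x : ℤ → B) (a b : ℤ) : Prop where
  mem : x ∈ S.X
  le : a ≤ b
  left : S.LF x a
  right : S.RF x b
  mid : S.Zr x a b

lemma Sorted.next' (h : S.Sorted u a b) :
    S.Sorted (S.I2 (S.I1 u)) (a - S.p) (b + S.p) := by
  have hp := S.par
  have hl : S.LF u b := h.left.extend h.mid h.le
  have hr : S.RF u (b - S.kap) := h.right.extend hl.zr
  have key : ∀ k ≥ b - S.p, ¬ S.Z (S.I2 (S.I1 u) k) → ∃ q, b + S.p ≤ q ∧ q ≤ k ∧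
      k < q + S.l ∧ S.AtP (S.I2 (S.I1 u)) q ∧ S.Zr (S.I2 (S.I1 u)) (q - S.K1) q := by
    intro k hk hz
    obtain ⟨s, h1, h2, h3, h4, h5, h6⟩ := hr.step_aux h.mem (by omega) hz
    refine ⟨s + S.p, ?_, h3, h4, h5, h6⟩
    by_contra hc
    obtain ⟨q, h7, h8, -, h9, -⟩ := hl.I1_nonzero (c := s) (by omega) h1.first
    have : q = s := by rcases nonzero_or h2 h9.first with h12 | h12 <;> omega
    subst this
    exact not_AtP_AtQ h9 h1
  refine ⟨I2_mem (I1_mem h.mem), by have := h.le; omega, h.left.next h.mem,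
    ⟨hr.bounded h.mem, fun k hk hz => ?_⟩, fun k h1 h2 => ?_⟩
  · obtain ⟨q, -, h2⟩ := key k (by omega) hz
    exact ⟨q, h2⟩
  · by_cases h3 : k < b - S.p
    · rw [hl.step h.mem h3]
      exact h.mid _ (by omega) (by omega)
    · by_contra hc
      obtain ⟨q, h4, h5, -⟩ := key k (by omega) hc
      omega

end GliderBase

/-! ### Rules on fleets, and convergence to sorted configurations. -/

namespace GliderSys

open ZeroSys GliderBase

variable {S : GliderSys B} {x u : ℤ → B} {a b i : ℤ}

/-- A window ending beyond `b` would end in a rightbound P, whose preceding zeros make it the only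
kernel in the window. Such a word is frozen and, beginning with P, is not emitting. -/
lemma RF.vD_le (hx : x ∈ S.X) (h : S.RF x b) {s : ℤ} (hv : S.vD (shf x s))
    (hw : S.word (shf x s) ∈ S.TD (shf x s)) : s + S.m ≤ b := by
  have hp := S.toGliderBase.par
  have hv' := vD_shf.1 hv
  by_contra hc
  obtain ⟨q, h1, h2, h3, h4⟩ := h.2 _ (by omega) hv'.2.2
  have hq : q + S.l = s + S.m := by rcases nonzero_or hv'.2.1 h3.last with h5 | h5 <;> omega
  have hz := h4.mono (c := s) (by omega) le_rfl
  rw [mem_TD_iff hx hv (f := q) (by omega) (by omega) hz h3.first] at hw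
  rcases hw with hw | hw
  · exact hw ⟨Or.inl h3, hv'.2.1.mono (by omega) (by omega)⟩
  · obtain ⟨n, h5⟩ := QP_of_eD hx hv (f := q) (by omega) (by omega) hz h3.first hw
    exact not_AtP_AtQ h3 h5.1

/-- Beyond `b` every nonzero letter belongs to a glider with `K1` zeros in front, so a window of `C`
reaching there would see a run of `K` zeros start too early. -/
lemma RF.vC_le (h : S.RF x b) {s : ℤ} (hv : S.vC (shf x s)) : s + S.m ≤ b := by
  have hp := S.toGliderBase.par
  have hv' := vC_shf.1 hv
  by_contra hc
  have h1 := hv'.2.2 (s + S.m) (by omega) le_rfl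
  unfold Zr at h1
  push Not at h1
  obtain ⟨k, h2, h3, h4⟩ := h1
  obtain ⟨q, h5, h6, h7, h8⟩ := h.2 k (by omega) h4
  rcases nonzero_or h8 hv'.2.1 with h9 | h9
  · exact hv'.2.2 (q - S.K1) (by omega) (by omega) (h8.mono le_rfl (by omega))
  · rcases nonzero_or hv'.1 h7.first with h10 | h10 <;> omega

variable [Finite B]

lemma RF.D_eq (hx : x ∈ S.X) (h : S.RF x b) : S.RF (S.D 1 x) b := by
  have hp := S.toGliderBase.par
  refine h.congr (fun k hk => ruleD.out hx fun s hs h1 h2 hw => ?_)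
    fun q hq h1 h2 k hk hk' => ruleD.out hx fun s hs h3 h4 hw => ?_
  · have := RF.vD_le hx h hs hw
    omega
  · have := RF.vD_le hx h hs hw
    have hv' := vD_shf.1 hs
    rcases nonzero_or h2 hv'.2.2 with h5 | h5
    · omega
    · rcases nonzero_or hv'.2.1 h1.last with h6 | h6 <;> omega

lemma RF.C_eq (hx : x ∈ S.X) (h : S.RF x b) : S.RF (S.C 1 x) b := by
  have hp := S.toGliderBase.par
  refine h.congr (fun k hk => ruleC.out hx fun s hs h1 h2 hw => ?_)
    fun q hq h1 h2 k hk hk' => ruleC.out hx fun s hs h3 h4 hw => ?_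
  · have := RF.vC_le h hs
    omega
  · have := RF.vC_le h hs
    have hv' := vC_shf.1 hs
    rcases nonzero_or h2 hv'.2.1 with h5 | h5
    · exact hv'.2.2 (q - S.K1) (by omega) (by omega) (h2.mono le_rfl (by omega))
    · omega

lemma RF.G_next (hx : x ∈ S.X) (h : S.RF x b) : S.RF (S.G x) b :=
  (RF.C_eq (D_mem hx) (RF.D_eq hx h)).next (C_mem (D_mem hx))

lemma iterate_mem (hx : x ∈ S.X) (t : ℕ) : S.G^[t] x ∈ S.X := by
  induction t with
  | zero => exact hx
  | succ t ih => rw [Function.iterate_succ_apply']; exact G_mem ih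

lemma RF.iterate (hx : x ∈ S.X) (h : S.RF x b) (t : ℕ) : S.RF (S.G^[t] x) b := by
  induction t with
  | zero => exact h
  | succ t ih => rw [Function.iterate_succ_apply']; exact RF.G_next (iterate_mem hx t) ih

omit [Finite B] in
lemma LF.zero_after (h : S.LF x a) {s : ℤ} (hs : s + S.l + S.kap < a) (h1 : S.AtQ x s) :
    S.Z (x (s + S.l + S.kap)) := by
  have hp := S.toGliderBase.par
  by_contra hc
  obtain ⟨q, h2, h3, h4, h5, h6, h7⟩ := h.2 _ hs hc
  rcases nonzero_or h5 h1.last with h8 | h8 <;> omega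

/-- Both word rules are idle on sorted configurations: every candidate window in the left part
begins with a Q having a zero after its `kap` zeros, or ends right there, and is therefore frozen
and not emitting; the right part is out of reach. -/
lemma Sorted.G_eq (h : S.Sorted x a b) : S.G x = S.I2 (S.I1 x) := by
  have hp := S.toGliderBase.par
  have hl : S.LF x b := h.left.extend h.mid h.le
  have e1 : S.D 1 x = x := by
    funext k
    refine ruleD.out h.mem fun s hs h1 h2 hw => ?_
    have h3 := RF.vD_le h.mem h.right hs hw
    have hv := vD_shf.1 hs
    obtain ⟨f, h4, h5, h6, h7⟩ := exists_first (S := S.toZeroSys) (by omega) hv.2.2 (a := s)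
    obtain ⟨h8, h9, h10, h11⟩ := hl.start (by omega) h6 (n := S.K1) (by omega)
      ((hv.1.append h7).mono (by omega) le_rfl)
    rw [mem_TD_iff h.mem hs h4 (by omega) h7 h6] at hw
    rcases hw with hw | hw
    · exact hw ⟨Or.inr h8, h10⟩
    · obtain ⟨n, h12⟩ := QP_of_eD h.mem hs h4 (by omega) h7 h6 hw
      have := h12.2.2.le
      exact h12.2.2.first (LF.zero_after hl (by omega) h8)
  have e2 : S.C 1 x = x := by
    funext k
    refine ruleC.out h.mem fun s hs h1 h2 hw => ?_
    have h3 := RF.vC_le h.right hs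
    have hv := vC_shf.1 hs
    obtain ⟨h8, h9, h10, h11⟩ := hl.start (s := s) (by omega) hv.2.1 (n := S.K1) (by omega) hv.1
    rw [mem_TC_iff hs] at hw
    rcases hw with hw | hw
    · exact hw (by rw [Free.shf_iff, zero_add]; exact ⟨Or.inr h8, h10⟩)
    · exact (eC_of_word' h.mem hs hw).2.2 (LF.zero_after hl (by omega) h8)
  unfold G
  rw [e1, e2]

lemma Sorted.next (h : S.Sorted x a b) : S.Sorted (S.G x) (a - S.p) (b + S.p) := by
  rw [Sorted.G_eq h]
  exact h.next'

lemma Sorted.iterate (h : S.Sorted x a b) (t : ℕ) :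
    S.Sorted (S.G^[t] x) (a - t * S.p) (b + t * S.p) := by
  induction t with
  | zero => simpa using h
  | succ t ih =>
    rw [Function.iterate_succ_apply']
    convert Sorted.next ih using 1 <;> push_cast <;> ring

omit [Finite B] in
/-- Configurations whose gliders are not all sorted have a head. -/
lemma exists_head (hx : x ∈ S.X) {A : ℤ} (A' : ℤ) (hA : ∀ k < A, S.Z (x k)) :
    (∃ i, S.Head x i) ∨ ∃ a, A' ≤ a ∧ S.LF x a := by
  have hp := S.toGliderBase.par
  rw [or_iff_not_imp_left]
  intro hh
  have key : ∀ n : ℕ, ∃ a, A + n ≤ a ∧ S.LF x (a - S.p) ∧ S.Zr x (a - S.p) a := by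
    intro n
    induction n with
    | zero =>
      exact ⟨A, by simp, ⟨⟨A, hA⟩, fun k hk hz => absurd (hA k (by omega)) hz⟩,
        fun k _ hk => hA k hk⟩
    | succ n ih =>
      obtain ⟨a, h1, h2, h3⟩ := ih
      by_cases hz : ∃ k ≥ a, ¬ S.Z (x k)
      · obtain ⟨k, hk, hkz⟩ := hz
        obtain ⟨i, h4, h5, h6, h7⟩ := exists_first (S := S.toZeroSys) hk hkz
        have hl : S.LF x (i - S.p) := h2.extend ((h3.append h7).mono le_rfl (by omega)) (by omega)
        have hzr : S.Zr x (i - S.p) i := (h3.append h7).mono (by omega) le_rfl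
        by_cases hn : S.Zr x (i - S.K1) i ∧ S.AtQ x i ∧ S.Zr x (i + S.l) (i + S.l + S.kap + S.p)
        · refine ⟨i + S.l + S.kap + S.p, by push_cast; omega, ?_, ?_⟩
          · rw [add_sub_cancel_right]
            exact (hl.extend hzr (by omega)).add hn.2.1 hn.1 (hn.2.2.mono le_rfl (by omega))
          · rw [add_sub_cancel_right]
            exact hn.2.2.mono (by omega) le_rfl
        · exact absurd ⟨i, hx, hl, hzr, h6, hn⟩ hh
      · push Not at hz
        refine ⟨a + 1, by push_cast; omega, h2.extend (h3.mono le_rfl (by omega)) (by omega),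
          fun k h4 h5 => ?_⟩
        by_cases hk : k < a
        · exact h3 k (by omega) hk
        · exact hz k (by omega)
  obtain ⟨a, h1, h2, h3⟩ := key (A' - A).toNat
  exact ⟨a, by omega, h2.extend h3 (by omega)⟩

/-- A bound for the progress made in sorting the gliders. -/
def Lev (S : GliderSys B) (x : ℤ → B) (i w : ℤ) : Prop :=
  w ≤ 2 * i ∧ ∀ a, i ≤ a → S.Zr x a (a + S.K) → w ≤ 2 * (a - S.m) - 1

/-- The level is the minimum of `2 * i` and `2 * (j - m) - 1`, with `j` the start of the next long
run. The weights break the tie between the two regimes: without a nearby long run, the next one may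
afterwards start as early as `i + m + 1`; with one, the head may fall back to `j - m`. The minimum
grows in both cases. -/
lemma progress (h : S.Head x i) {w : ℤ} (hw : S.Lev x i w) :
    ∃ (t : ℕ) (j : ℤ), S.Head (S.G^[t] x) j ∧ S.Lev (S.G^[t] x) j (w + 1) := by
  have hp := S.toGliderBase.par
  by_cases hl : S.Long x i
  · obtain ⟨t, j, h1, h2, h3⟩ := up_long S.K1.toNat x h hl fun k _ _ => by omega
    have := hw.1
    refine ⟨t, j, h1, by omega, fun a h4 h5 => ?_⟩
    have := h3 a h4 h5
    omega
  · unfold Long at hl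
    push Not at hl
    obtain ⟨a, h1, h2, h3⟩ := hl
    have hia : i < a := by
      rcases h1.lt_or_eq with h4 | h4
      · exact h4
      · subst h4; exact absurd (h3 _ le_rfl (by omega)) h.ne
    obtain ⟨j, h4, h5, h6, h7⟩ := exists_last (S := S.toZeroSys) hia h.ne
    have hz : S.Zr x j (j + S.K) := (h7.append h3).mono le_rfl (by omega)
    obtain ⟨t, i', h8, h9, h10⟩ := up_short (j - i).toNat i x (by omega) h ⟨h4, by omega, h6, hz⟩
    have := hw.2 j h4.le hz
    refine ⟨t, i', h8, by omega, fun a h4 h5 => ?_⟩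
    have := h10 a h4 h5
    omega

lemma progress_iterate (n : ℕ) : ∀ x i w, S.Head x i → S.Lev x i w →
    ∃ (t : ℕ) (j : ℤ), S.Head (S.G^[t] x) j ∧ S.Lev (S.G^[t] x) j (w + n) := by
  induction n with
  | zero => exact fun x i w h hw => ⟨0, i, h, by simpa using hw⟩
  | succ n ih =>
    intro x i w h hw
    obtain ⟨t, j, h1, h2⟩ := progress h hw
    obtain ⟨t', j', h3, h4⟩ := ih _ _ _ h1 h2
    refine ⟨t' + t, j', ?_⟩
    rw [Function.iterate_add_apply]
    refine ⟨h3, ?_⟩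
    convert h4 using 1
    push_cast; ring

/-- The gliders of finite configurations are eventually sorted. -/
theorem exists_sorted (hx : x ∈ S.X) {A A' : ℤ} (hA : ∀ k < A, S.Z (x k))
    (hA' : ∀ k ≥ A', S.Z (x k)) : ∃ (t : ℕ) (a : ℤ), S.Sorted (S.G^[t] x) a a := by
  have hp := S.toGliderBase.par
  have hR : S.RF x A' := ⟨⟨A', hA'⟩, fun k hk hz => absurd (hA' k hk) hz⟩
  rcases exists_head hx A' hA with ⟨i, hi⟩ | ⟨a, ha, hl⟩
  · have hw : S.Lev x i (2 * (i - S.m) - 1) := ⟨by omega, fun a h1 _ => by omega⟩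
    -- Enough rounds to force the head to `A'` or beyond, where only rightbound gliders remain.
    obtain ⟨t, j, h1, h2⟩ := progress_iterate (2 * A' - (2 * (i - S.m) - 1)).toNat x i _ hi hw
    have := h2.1
    exact ⟨t, j, h1.mem, le_rfl, h1.lf', (RF.iterate hx hR t).mono (by omega),
      fun k _ _ => by omega⟩
  · exact ⟨0, a, hx, le_rfl, hl, hR.mono ha, fun k _ _ => by omega⟩

/-- The automaton shifts fleets of leftbound gliders. -/
lemma G_left (hx : x ∈ S.X) {A' : ℤ} (hA' : ∀ k ≥ A', S.Z (x k)) (h : ∀ a ≥ A', S.LF x a)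
    (k : ℤ) : S.G x k = x (k + S.p) := by
  have hp := S.toGliderBase.par
  have hR : S.RF x A' := ⟨⟨A', hA'⟩, fun k hk hz => absurd (hA' k hk) hz⟩
  rw [Sorted.G_eq (a := A') (b := A') ⟨hx, le_rfl, h _ le_rfl, hR, fun k _ _ => by omega⟩]
  exact (h (max A' (k + S.p + 1)) (by omega)).step hx (by omega)

/-- The automaton shifts fleets of rightbound gliders. -/
lemma G_right (hx : x ∈ S.X) {A : ℤ} (hA : ∀ k < A, S.Z (x k)) (h : ∀ b, S.RF x b)
    (k : ℤ) : S.G x k = x (k - S.p) := by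
  have hp := S.toGliderBase.par
  have hL : S.LF x A := ⟨⟨A, hA⟩, fun k hk hz => absurd (hA k hk) hz⟩
  rw [Sorted.G_eq (a := A) (b := A) ⟨hx, le_rfl, hL, h A, fun k _ _ => by omega⟩]
  exact RF.step hx h k

end GliderSys

/-! ### Construction of the kernels and the emitting words. -/

/-- The configuration `x` followed from `c` on by `y`. -/
def cat (x : ℤ → B) (c : ℤ) (y : ℤ → B) : ℤ → B := glue x (shf y (-c)) c

lemma cat_lt {x y : ℤ → B} {c k : ℤ} (h : k < c) : cat x c y k = x k := glue_lt h

lemma cat_ge {x y : ℤ → B} {c k : ℤ} (h : c ≤ k) : cat x c y k = y (k - c) := glue_ge h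

namespace ZeroSys

variable (S : ZeroSys B)

/-- `x` consists of a word of length `n` between zeros. -/
structure Blk (x : ℤ → B) (n : ℤ) : Prop where
  mem : x ∈ S.X
  left : ∀ k < 0, x k = S.z k
  right : ∀ k ≥ n, x k = S.z (k - n)
  nonneg : 0 ≤ n

/-- `x` consists of a word of length `n` which starts and ends with nonzero letters between
zeros. -/
structure NBlk (x : ℤ → B) (n : ℤ) : Prop extends S.Blk x n where
  first : ¬ S.Z (x 0)
  last : ¬ S.Z (x (n - 1))

variable {S} {x y : ℤ → B} {n m d : ℤ}

lemma cat_mem (hx : x ∈ S.X) (hxr : ∀ k, n ≤ k → k < n + d → x k = S.z (k - n)) (hy : y ∈ S.X)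
    (hyl : ∀ k < 0, y k = S.z k) (hd : S.p ≤ d) (hpd : (S.p : ℤ) ∣ d) :
    cat x (n + d) y ∈ S.X := by
  refine S.sync _ hx _ (S.shift_mem _ hy _) _ (fun k h1 h2 => ?_) fun k h1 h2 => ?_
  · rw [hxr k (by omega) h2]
    exact z_congr (by ring_nf; exact hpd)
  · rw [shf_apply, hyl _ (by omega), sub_eq_add_neg]

lemma Blk.cat (hx : S.Blk x n) (hy : S.Blk y m) (hd : S.p ≤ d) (hpd : (S.p : ℤ) ∣ d) :
    S.Blk (cat x (n + d) y) (n + d + m) := by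
  have := hx.nonneg
  have := hy.nonneg
  have hp : (0 : ℤ) ≤ S.p := by positivity
  refine ⟨cat_mem hx.mem (fun k h _ => hx.right k h) hy.mem hy.left hd hpd, fun k hk => ?_,
    fun k hk => ?_, by omega⟩
  · rw [cat_lt (by omega), hx.left k hk]
  · rw [cat_ge (by omega), hy.right _ (by omega)]
    congr 1; ring

lemma NBlk.pos (hx : S.NBlk x n) : 0 < n := by
  by_contra hc
  exact hx.first ⟨_, hx.right 0 (by omega)⟩

lemma NBlk.cat (hx : S.NBlk x n) (hy : S.NBlk y m) (hd : S.p ≤ d) (hpd : (S.p : ℤ) ∣ d) :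
    S.NBlk (GliderCA.cat x (n + d) y) (n + d + m) := by
  have := hx.pos
  have := hy.pos
  have hp : (0 : ℤ) ≤ S.p := by positivity
  refine ⟨hx.toBlk.cat hy.toBlk hd hpd, ?_, ?_⟩
  · rw [cat_lt (by omega)]; exact hx.first
  · rw [cat_ge (by omega)]
    convert hy.last using 3; ring

lemma blk_z : S.Blk S.z 0 := ⟨S.z_mem, fun _ _ => rfl, fun k _ => by rw [sub_zero], le_rfl⟩

variable (S) in
lemma exists_nblk : ∃ x n, S.NBlk x n := by
  obtain ⟨x, hx, ⟨A, hA⟩, ⟨A', hA'⟩, k, hk⟩ := S.exists_nonzero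
  have hk' : ¬ S.Z (x k) := fun ⟨a, h⟩ => hk a h
  obtain ⟨f, hf1, hf2, hf3, hf4⟩ := exists_first (min_le_right A k) hk'
  obtain ⟨g, hg1, hg2, hg3, hg4⟩ := exists_last (b := max (k + 1) A') (by omega) hk'
  refine ⟨shf x f, g - f, ⟨S.shift_mem x hx f, fun c hc => ?_, fun c hc => ?_, by omega⟩, ?_, ?_⟩
  · rw [shf_apply, align_left hx (a := c + f) (b := f) (fun d _ hd => ?_) hf3 _ le_rfl (by omega),
      add_sub_cancel_right]
    rcases lt_or_ge d (min A k) with h | h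
    · exact hA d (by omega)
    · exact hf4 d h hd
  · rw [shf_apply, align_right hx (a := g) (b := c + f + 1) (fun d hd _ => ?_) hg3 _ (by omega)
      (by omega)]
    · congr 1; ring
    · rcases lt_or_ge d (max (k + 1) A') with h | h
      · exact hg4 d hd h
      · exact hA' d (by omega)
  · rwa [shf_apply, zero_add]
  · rwa [shf_apply, show g - f - 1 + f = g - 1 by ring]

variable (S) in
/-- The integers which are congruent modulo `p` to lengths of words between zeros. -/
def lengths : AddSubgroup ℤ where
  carrier := {k | ∃ x n, S.Blk x n ∧ (S.p : ℤ) ∣ k - n}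
  zero_mem' := ⟨_, _, blk_z, by simp⟩
  add_mem' := by
    rintro a b ⟨x, n, h1, h2⟩ ⟨y, m, h3, h4⟩
    refine ⟨_, _, h1.cat h3 le_rfl dvd_rfl, ?_⟩
    have := dvd_sub (dvd_add h2 h4) (dvd_refl (S.p : ℤ))
    exact (congrArg (fun t : ℤ => (S.p : ℤ) ∣ t) (by ring)).mpr this
  neg_mem' := by
    -- Lengths matter only modulo `p`, so `p - 1` concatenated copies serve as the negative.
    have hs : ∀ (k : ℤ) (j : ℕ), (∃ x n, S.Blk x n ∧ (S.p : ℤ) ∣ k - n) →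
        ∃ x n, S.Blk x n ∧ (S.p : ℤ) ∣ j * k - n := by
      intro k j ⟨y, m, h3, h4⟩
      induction j with
      | zero => exact ⟨_, _, blk_z, by simp⟩
      | succ j ih =>
        obtain ⟨x, n, h1, h2⟩ := ih
        refine ⟨_, _, h1.cat h3 le_rfl dvd_rfl, ?_⟩
        have := dvd_sub (dvd_add h2 h4) (dvd_refl (S.p : ℤ))
        exact (congrArg (fun t : ℤ => (S.p : ℤ) ∣ t) (by push_cast; ring)).mpr this
    rintro k h
    obtain ⟨x, n, h1, h2⟩ := hs k (S.p - 1) h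
    refine ⟨x, n, h1, ?_⟩
    have := dvd_sub h2 (dvd_mul_right (S.p : ℤ) k)
    rw [Nat.cast_sub S.hp] at this
    exact (congrArg (fun t : ℤ => (S.p : ℤ) ∣ t) (by ring)).mpr this

lemma Blk.mem_lengths (h : S.Blk x n) : n ∈ S.lengths := ⟨x, n, h, by simp⟩

/-- A word of residue `r - 2 * L` is put between two copies of a fixed word of length `L` with
nonzero ends, which supply the ends. -/
lemma exists_nblk_of_mem {r : ℤ} (hr : r ∈ S.lengths) :
    ∃ x n, S.NBlk x n ∧ (S.p : ℤ) ∣ r - n := by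
  obtain ⟨x, L, hx⟩ := S.exists_nblk
  obtain ⟨v, n, hv, hd⟩ : r - 2 * L ∈ S.lengths :=
    S.lengths.sub_mem hr (by rw [two_mul]; exact S.lengths.add_mem hx.mem_lengths hx.mem_lengths)
  have hp : (0 : ℤ) ≤ S.p := by positivity
  have h1 := hx.pos
  have h2 := hv.nonneg
  refine ⟨_, _, ⟨hx.toBlk.cat (hv.cat hx.toBlk le_rfl dvd_rfl) le_rfl dvd_rfl, ?_, ?_⟩, ?_⟩
  · rw [cat_lt (by omega)]; exact hx.first
  · rw [cat_ge (by omega), cat_ge (by omega)]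
    convert hx.last using 3; ring
  · have := dvd_sub hd (dvd_mul_left (S.p : ℤ) 2)
    exact (congrArg (fun t : ℤ => (S.p : ℤ) ∣ t) (by ring)).mpr this

variable (S) in
/-- The kernels of the gliders. -/
lemma exists_kernels : ∃ P Q l, S.NBlk P l ∧ S.NBlk Q l ∧ (∃ k, 0 ≤ k ∧ k < l ∧ P k ≠ Q k) ∧
    ∀ r ∈ S.lengths, ∃ n : ℕ, n < S.p ∧ (S.p : ℤ) ∣ (n + 2) * l - r := by
  have hp : (0 : ℤ) < S.p := by exact_mod_cast S.hp
  -- The common length of the kernels will be congruent to a generator, so that multiples of it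
  -- realise every possible residue.
  obtain ⟨g, hg⟩ := Int.subgroup_cyclic S.lengths
  have hgm : g ∈ S.lengths := by rw [hg]; exact AddSubgroup.subset_closure rfl
  obtain ⟨x, L, hx⟩ := S.exists_nblk
  obtain ⟨v, n, hv, hd⟩ := exists_nblk_of_mem (S.lengths.sub_mem hgm
    (S.lengths.add_mem hx.mem_lengths hx.mem_lengths))
  have h1 := hx.pos
  have h2 := hv.pos
  have e2 : (S.p : ℤ) ∣ S.p + S.p := dvd_add dvd_rfl dvd_rfl
  -- The same three words with gaps `2p`, `p` and `p`, `2p`: equal total length, but at `L + p` one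
  -- has a zero and the other a nonzero letter.
  have hP := hx.cat (hx.cat hv le_rfl dvd_rfl) (d := S.p + S.p) (by omega) e2
  have hQ := hx.cat (hx.cat hv (d := S.p + S.p) (by omega) e2) le_rfl dvd_rfl
  have e : L + S.p + (L + (S.p + S.p) + n) = L + (S.p + S.p) + (L + S.p + n) := by ring
  rw [e] at hQ
  refine ⟨_, _, _, hP, hQ, ⟨L + S.p, by omega, by omega, ?_⟩, ?_⟩
  · rw [cat_lt (by omega), cat_ge le_rfl, cat_lt (by omega), sub_self,
      hx.right _ (by omega)]
    intro hc
    exact hx.first ⟨_, hc.symm⟩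
  · intro r hr
    rw [hg, AddSubgroup.mem_closure_singleton] at hr
    obtain ⟨j, rfl⟩ := hr
    have h3 := Int.emod_nonneg (j - 2) hp.ne'
    have h4 := Int.emod_lt_of_pos (j - 2) hp
    -- A train contains at least one Q and the final P, hence the two kernels set aside.
    refine ⟨((j - 2) % S.p).toNat, by omega, ?_⟩
    rw [Int.toNat_of_nonneg h3]
    have h5 : (S.p : ℤ) ∣ (j - 2) - (j - 2) % S.p := Int.dvd_self_sub_emod
    obtain ⟨c, hc⟩ := h5
    obtain ⟨c', hc'⟩ := hd
    have h6 : (j - 2) % S.p = j - 2 - S.p * c := by omega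
    refine ⟨(j - S.p * c) * (3 - c') - c * g, ?_⟩
    rw [h6, smul_eq_mul]
    have h7 : n = g - 2 * L - S.p * c' := by linarith
    rw [h7]; ring

/-- `k` copies of `Q`, followed by zeros, before `y`. -/
def rep (Q : ℤ → B) (c : ℤ) : ℕ → (ℤ → B) → ℤ → B
  | 0, y => y
  | k + 1, y => GliderCA.cat Q c (rep Q c k y)

variable {Q : ℤ → B} {l : ℤ}

lemma rep_left (hQ : S.NBlk Q l) (hd : 0 ≤ d) (hy : ∀ k < 0, y k = S.z k) (j : ℕ) :
    ∀ k < 0, rep Q (l + d) j y k = S.z k := by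
  have := hQ.pos
  cases j with
  | zero => exact hy
  | succ j => exact fun k hk => by rw [rep, cat_lt (by omega), hQ.left k hk]

lemma rep_mem (hQ : S.NBlk Q l) (hd : S.p ≤ d) (hpd : (S.p : ℤ) ∣ d) (hyX : y ∈ S.X)
    (hy : ∀ k < 0, y k = S.z k) (j : ℕ) : rep Q (l + d) j y ∈ S.X := by
  induction j with
  | zero => exact hyX
  | succ j ih =>
    exact cat_mem hQ.mem (fun k h _ => hQ.right k h) ih (rep_left hQ (by omega) hy j) hd hpd

lemma rep_apply (hQ : S.NBlk Q l) (hd : 0 ≤ d) (j : ℕ) {k : ℤ} (hk : 0 ≤ k) :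
    rep Q (l + d) j y (j * (l + d) + k) = y k := by
  have := hQ.pos
  induction j with
  | zero => rw [rep]; congr 1; push_cast; ring
  | succ j ih =>
    have : 0 ≤ (j : ℤ) * (l + d) := by positivity
    rw [rep, cat_ge (by push_cast; linarith), ← ih]
    congr 1; push_cast; ring

lemma rep_pos (hQ : S.NBlk Q l) (hd : 0 ≤ d) {j : ℕ} (hj : 0 < j) {k : ℤ} (hk : k < 0)
    (hk' : -d ≤ k) : rep Q (l + d) j y (j * (l + d) + k) = S.z (k + d) := by
  have := hQ.pos
  obtain ⟨j, rfl⟩ : ∃ i, j = i + 1 := ⟨j - 1, by omega⟩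
  clear hj
  induction j with
  | zero =>
    rw [rep, cat_lt (by push_cast; omega), hQ.right _ (by push_cast; omega)]
    congr 1; push_cast; ring
  | succ j ih =>
    have : 0 ≤ (j : ℤ) * (l + d) := by positivity
    rw [rep, cat_ge (by push_cast; linarith), ← ih]
    congr 1; push_cast; ring

/-- By synchronization, `2p` zeros erase all memory of what lies further left. -/
lemma Fol_congr_of_run {x x' : ℤ → B} (hx : x ∈ S.X) (hx' : x' ∈ S.X) (hn : 0 ≤ n)
    (hz : S.Zr x (-n - 2 * S.p) (-n)) (h : ∀ k, -n - 2 * S.p ≤ k → k < 0 → x' k = x k) :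
    Fol S.X x = Fol S.X x' := by
  have key : ∀ x ∈ S.X, ∀ x' ∈ S.X, S.Zr x (-n - 2 * S.p) (-n) →
      (∀ k, -n - 2 * S.p ≤ k → k < 0 → x' k = x k) → ∀ y, glue x y 0 ∈ S.X → glue x' y 0 ∈ S.X := by
    intro x _ x' hx' hz h y hy
    have := glue_mem hx' hy (c := -n)
      (hz.congr fun k h1 h2 => h k h1 (by omega)) fun k h1 h2 => by
        rw [glue_lt (by omega), h k h1 (by omega)]
    convert this using 1
    funext k
    by_cases h1 : k < -n
    · rw [glue_lt h1, glue_lt (by omega)]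
    · rw [glue_ge (x := x') (c := -n) (by omega)]
      by_cases h2 : k < 0
      · have hp : (0 : ℤ) ≤ S.p := by positivity
        rw [glue_lt h2, glue_lt h2, h k (by omega) h2]
      · rw [glue_ge (by omega), glue_ge (by omega)]
  ext y
  exact ⟨key x hx x' hx' hz h y, key x' hx' x hx
    (hz.congr fun k h1 h2 => h k h1 (by omega)) (fun k h1 h2 => (h k h1 h2).symm) y⟩

lemma Fol_congr {x x' : ℤ → B} (h : ∀ k < 0, x' k = x k) : Fol S.X x = Fol S.X x' := by
  ext y
  unfold Fol
  have : glue x y 0 = glue x' y 0 := by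
    funext k
    unfold glue
    split_ifs with h1
    · exact (h k h1).symm
    · rfl
  rw [Set.mem_ofPred_eq, Set.mem_ofPred_eq, this]

/-- `c` represents the follower set `F` by a word of length `n` with `t` zeros at the end. -/
structure Rep (S : ZeroSys B) (F : Set (ℤ → B)) (t n : ℕ) (c : ℤ → B) : Prop where
  mem : c ∈ S.X
  left : ∀ k < 0, c k = S.z k
  first : ¬ S.Z (c 0)
  fol : Fol S.X (shf c n) = F
  dvd : S.p ∣ n
  lt : t < n
  last : ¬ S.Z (c (n - t - 1))

variable (S) in
lemma exists_rep_bound : ∃ N : ℕ, ∀ F, (∃ t n c, S.Rep F t n c) →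
    ∃ t n c, S.Rep F t n c ∧ n ≤ N ∧ ∀ t' n' c', S.Rep F t' n' c' → t ≤ t' := by
  classical
  have h1 : ∀ F : Set (ℤ → B), ∃ n : ℕ, (∃ t n c, S.Rep F t n c) →
      ∃ t c, S.Rep F t n c ∧ ∀ t' n' c', S.Rep F t' n' c' → t ≤ t' := by
    intro F
    by_cases h : ∃ t n c, S.Rep F t n c
    · obtain ⟨n, c, h2⟩ := Nat.find_spec h
      exact ⟨n, fun _ => ⟨_, c, h2, fun t' n' c' h3 => Nat.find_min' h ⟨n', c', h3⟩⟩⟩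
    · exact ⟨0, fun h' => absurd h' h⟩
  choose f hf using h1
  obtain ⟨N, hN⟩ := (S.fol_finite.image f).bddAbove
  refine ⟨N, fun F hF => ?_⟩
  obtain ⟨t, c, h2, h3⟩ := hf F hF
  exact ⟨t, f F, c, h2, hN ⟨F, ⟨_, S.shift_mem _ h2.mem _, h2.fol⟩, rfl⟩, h3⟩

end ZeroSys

namespace GliderBase

open ZeroSys

variable {S : GliderBase B}

lemma nblk_Q : S.NBlk S.Q S.l :=
  ⟨⟨S.Q_mem, S.Q_left, S.Q_right, S.hl.le⟩, fun ⟨a, h⟩ => S.Q_first a h, fun ⟨a, h⟩ =>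
    S.Q_last a h⟩

lemma rep_of_word (hd : S.p ∣ S.m) {w : Fin S.m → B} (h1 : ¬ S.Z (S.put w S.z 0))
    (h2 : (S.FolC w).Nonempty) : ∃ t c, S.Rep (S.FolC w) t S.m c ∧
      S.Zr (S.put w S.z) (S.m - t) S.m := by
  have hp := S.par
  obtain ⟨y, hy⟩ := h2
  obtain ⟨f, h3, h4, h5, h6⟩ := exists_last (S := S.toZeroSys) (b := S.m) (by omega) h1
  have hX := S.shift_mem _ hy (-S.m)
  have hc : ∀ k : ℤ, k < S.m →
      shf (glue (shf (S.put w S.z) S.m) y 0) (-S.m) k = S.put w S.z k := fun k hk => by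
    rw [shf_apply, glue_lt (by omega), shf_apply, neg_add_cancel_right]
  refine ⟨(S.m - f).toNat, _, ⟨hX, fun k hk => ?_, ?_, ?_, hd, by omega, ?_⟩, ?_⟩
  · rw [hc k (by omega), put_out (by omega)]
  · rw [hc 0 (by omega)]; exact h1
  · refine (Fol_congr fun k hk => ?_).symm
    rw [shf_apply, hc _ (by omega), shf_apply]
  · rw [hc _ (by omega)]
    convert h5 using 3; omega
  · exact h6.mono (by omega) le_rfl

/-- The emitting word is a train of `2p` copies of Q, each with `kap` zeros, then padding, then a
representative of the follower set with the fewest possible trailing zeros. Using `2p` copies makes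
the length of the train divisible by `p` whatever `l` is, and provides the second Q required after
the first. -/
lemma exists_eC {N : ℕ} (hd : S.p ∣ S.m)
    (hN : ∀ F, (∃ t n c, S.Rep F t n c) →
      ∃ t n c, S.Rep F t n c ∧ n ≤ N ∧ ∀ t' n' c', S.Rep F t' n' c' → t ≤ t')
    (hm : 2 * S.p * (S.l + S.kap) + N ≤ S.m) : ∃ eC : Set (ℤ → B) → (Fin S.m → B),
    ∀ w, ¬ S.Z (S.put w S.z 0) → (S.FolC w).Nonempty →
      S.AtQ (S.put (eC (S.FolC w)) S.z) 0 ∧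
      S.Zr (S.put (eC (S.FolC w)) S.z) S.l (S.l + S.kap) ∧
      ¬ S.Z (S.put (eC (S.FolC w)) S.z (S.l + S.kap)) ∧
      S.FolC (eC (S.FolC w)) = S.FolC w ∧
      ∀ a : ℤ, 0 ≤ a → a < S.m → S.Zr (S.put (eC (S.FolC w)) S.z) a S.m →
        S.Zr (S.put w S.z) a S.m := by
  have hp := S.par
  suffices h : ∀ F, ∃ e : Fin S.m → B, ∀ w, ¬ S.Z (S.put w S.z 0) → (S.FolC w).Nonempty →
      S.FolC w = F → S.AtQ (S.put e S.z) 0 ∧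
      S.Zr (S.put e S.z) S.l (S.l + S.kap) ∧ ¬ S.Z (S.put e S.z (S.l + S.kap)) ∧
      S.FolC e = F ∧ ∀ a : ℤ, 0 ≤ a → a < S.m → S.Zr (S.put e S.z) a S.m →
        S.Zr (S.put w S.z) a S.m by
    choose eC h using h
    exact ⟨eC, fun w h1 h2 => h _ w h1 h2 rfl⟩
  intro F
  by_cases hF : ∃ t n c, S.Rep F t n c
  swap
  · refine ⟨fun _ => S.z 0, fun w h1 h2 h3 => absurd ?_ hF⟩
    obtain ⟨t, c, h4, -⟩ := rep_of_word hd h1 h2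
    exact ⟨t, _, c, h3 ▸ h4⟩
  obtain ⟨t, n, c, hr, hnN, hmin⟩ := hN F hF
  -- Length of the padding: `m`, `n` and the train are all multiples of `p`, so it consists of whole
  -- periods.
  set jp : ℤ := S.m - n - 2 * S.p * (S.l + S.kap) with hjp
  have hjp0 : 0 ≤ jp := by omega
  have hjd : (S.p : ℤ) ∣ jp := by
    refine dvd_sub (dvd_sub (by exact_mod_cast hd) (by exact_mod_cast hr.dvd)) ?_
    rw [mul_comm 2, mul_assoc]
    exact dvd_mul_right _ _
  have hy : ∀ k < 0, shf c (-jp) k = S.z k := fun k hk => by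
    rw [shf_apply, hr.left _ (by omega)]
    apply z_congr
    rw [add_sub_cancel_left]
    exact (dvd_neg).2 hjd
  have hyX := S.shift_mem _ hr.mem (-jp)
  have hkp : (S.p : ℤ) ≤ S.kap := by omega
  set E := rep S.Q (S.l + S.kap) (2 * S.p) (shf c (-jp)) with hE
  have hEX : E ∈ S.X := rep_mem nblk_Q hkp S.dvd_kap hyX hy _
  have hEl : ∀ k < 0, E k = S.z k := rep_left nblk_Q (by omega) hy _
  have hEr : ∀ k ≥ (S.m : ℤ) - n - 2 * S.p, E k = c (k - (S.m - n)) := by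
    intro k hk
    have e : ((2 * S.p : ℕ) : ℤ) * (S.l + S.kap) = S.m - n - jp := by push_cast; omega
    by_cases h1 : (S.m : ℤ) - n - jp ≤ k
    · have := rep_apply (S := S.toZeroSys) (y := shf c (-jp)) nblk_Q (d := S.kap) (by omega)
        (2 * S.p) (k := k - (S.m - n - jp)) (by omega)
      rw [e, add_sub_cancel, shf_apply] at this
      rw [hE, this]; congr 1; ring
    · have := rep_pos (S := S.toZeroSys) (y := shf c (-jp)) nblk_Q (d := S.kap) (by omega)
        (j := 2 * S.p) (by omega) (k := k - (S.m - n - jp)) (by omega) (by omega)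
      rw [e, add_sub_cancel] at this
      rw [hE, this, hr.left _ (by omega)]
      apply z_congr
      exact (congrArg (fun t : ℤ => (S.p : ℤ) ∣ t) (by ring)).mpr (dvd_add hjd S.dvd_kap)
  have h2p : ∃ j, 2 * S.p = j + 1 + 1 := ⟨2 * S.p - 2, by omega⟩
  have hEQ : ∀ k, 0 ≤ k → k < S.l + S.kap → E k = S.Q k := by
    obtain ⟨j, hj⟩ := h2p
    intro k h1 h2
    rw [hE, hj, rep, cat_lt h2]
  have hEQ' : E (S.l + S.kap) = S.Q 0 := by
    obtain ⟨j, hj⟩ := h2p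
    rw [hE, hj, rep, cat_ge le_rfl, rep, sub_self, cat_lt (by omega)]
  have hput : ∀ k : ℤ, k < S.m → S.put (fun i => E i) S.z k = E k := by
    intro k hk
    by_cases h1 : k < 0
    · rw [put_out (by omega), hEl k h1]
    · exact put_word (S := S) (x := E) (by omega) hk
  refine ⟨fun i => E i, fun w h1 h2 h3 => ⟨fun k h4 h5 => ?_, fun k h4 h5 => ?_, ?_, ?_,
    fun a h4 h5 h6 => ?_⟩⟩
  · rw [zero_add, hput _ (by omega), hEQ k h4 (by omega)]
  · rw [hput _ (by omega), hEQ k (by omega) h5, S.Q_right k h4]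
    exact Z_z _
  · rw [hput _ (by omega), hEQ']
    exact fun ⟨a, h⟩ => S.Q_first a h
  · rw [← hr.fol]
    have e1 : S.FolC (fun i => E i) = Fol S.X (shf E S.m) :=
      (Fol_congr fun k hk => by rw [shf_apply, shf_apply, hput _ (by omega)]).symm
    rw [e1]
    refine Fol_congr_of_run (S.shift_mem _ hEX _) (S.shift_mem _ hr.mem _) (n := n)
      (by omega) (fun k h4 h5 => ?_) fun k h4 h5 => ?_
    · rw [shf_apply, hEr _ (by omega), hr.left _ (by omega)]
      exact Z_z _
    · rw [shf_apply, shf_apply, hEr _ (by omega)]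
      congr 1; ring
  · obtain ⟨t', c', h7, h8⟩ := rep_of_word hd h1 h2
    have h9 := hmin t' _ c' (h3 ▸ h7)
    refine h8.mono ?_ le_rfl
    have hla : ¬ S.Z (S.put (fun i => E i) S.z (S.m - t - 1)) := by
      have := hr.lt
      rw [hput _ (by omega), hEr _ (by omega)]
      convert hr.last using 3; ring
    rcases nonzero_or h6 hla with h10 | h10 <;> omega

lemma QP_of_rep {x : ℤ → B} (n : ℕ) : ∀ f, (∀ k, 0 ≤ k → k < n * (S.l + S.kap) + S.l →
    x (f + k) = rep S.Q (S.l + S.kap) n S.P k) → S.QP x n f (f + n * (S.l + S.kap) + S.l) := by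
  have hp := S.par
  induction n with
  | zero =>
    intro f h
    refine ⟨fun k h1 h2 => ?_, by push_cast; ring⟩
    rw [h k h1 (by push_cast; omega)]; rfl
  | succ n ih =>
    intro f h
    push_cast at h
    have hn : 0 ≤ (n : ℤ) * (S.l + S.kap) := mul_nonneg (by omega) (by omega)
    have hlen : ((n : ℤ) + 1) * (S.l + S.kap) = n * (S.l + S.kap) + S.l + S.kap := by ring
    rw [hlen] at h
    have hlt : ∀ k, 0 ≤ k → k < S.l + S.kap → x (f + k) = S.Q k := fun k h1 h2 => by
      rw [h k h1 (by omega), rep, cat_lt h2]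
    refine ⟨fun k h1 h2 => hlt k h1 (by omega), fun k h1 h2 => ?_, ?_⟩
    · have := hlt (k - f) (by omega) (by omega)
      rw [add_sub_cancel, S.Q_right _ (by omega)] at this
      exact ⟨_, this⟩
    · have := ih (f + S.l + S.kap) fun k h1 h2 => by
        have h3 := h (S.l + S.kap + k) (by omega) (by omega)
        rw [rep, cat_ge (by omega), add_sub_cancel_left] at h3
        rw [← h3]; congr 1; ring
      convert this using 1
      push_cast; ring

/-- Any admissible word at the phase of `b` shows that the required length lies in `lengths`; `hg`
then supplies a number of kernels with this residue, and the rest of the window is filled with zeros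
on the left. -/
lemma exists_eD (hg : ∀ r ∈ S.lengths, ∃ n : ℕ, n < S.p ∧ (S.p : ℤ) ∣ (n + 2) * S.l - r)
    (hm : ((S.p : ℤ) + 1) * (S.l + S.kap) ≤ S.m) : ∃ eD : B → (Fin S.m → B),
    ∀ b w, S.Z b → S.extD b w ∈ S.X → ¬ S.Z (S.extD b w (S.m - 1)) →
      S.extD b (eD b) ∈ S.X ∧ ∃ n : ℕ, ∃ f : ℤ, 0 ≤ f ∧
      S.Zr (S.extD b (eD b)) 0 f ∧ S.QP (S.extD b (eD b)) (n + 1) f S.m := by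
  have hp := S.par
  suffices h : ∀ b, ∃ e : Fin S.m → B, ∀ w, S.Z b → S.extD b w ∈ S.X →
      ¬ S.Z (S.extD b w (S.m - 1)) → S.extD b e ∈ S.X ∧ ∃ n : ℕ, ∃ f : ℤ, 0 ≤ f ∧
      S.Zr (S.extD b e) 0 f ∧ S.QP (S.extD b e) (n + 1) f S.m by
    choose eD h using h
    exact ⟨eD, h⟩
  intro b
  by_cases hw : ∃ w, S.extD b w ∈ S.X
  swap
  · exact ⟨fun _ => b, fun w _ h _ => absurd ⟨w, h⟩ hw⟩
  obtain ⟨w, hw⟩ := hw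
  -- `c` is the phase at position 0. Moving the origin left by `c`, plus enough whole periods to
  -- make the amount nonnegative, gives a word starting at phase 0.
  set c := 1 + S.ph b with hc
  have hc0 : 0 ≤ c + S.p * |c| := by
    have h1 : |c| ≤ S.p * |c| := le_mul_of_one_le_left (abs_nonneg c) (by omega)
    have := neg_abs_le c
    omega
  have hblk : S.Blk (shf (S.extD b w) (-(c + S.p * |c|))) (S.m + (c + S.p * |c|)) := by
    refine ⟨S.shift_mem _ hw _, fun k hk => ?_, fun k hk => ?_, by omega⟩
    · rw [shf_apply, extD, put_out (by omega), if_pos (by omega)]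
      exact z_congr ⟨-|c|, by rw [hc]; ring⟩
    · rw [shf_apply, extD, put_out (by omega), if_neg (by omega)]
      congr 1; ring
  obtain ⟨n, hn, hnd⟩ := hg _ hblk.mem_lengths
  have hkp : (S.p : ℤ) ≤ S.kap := by omega
  set f : ℤ := S.m - ((n + 1) * (S.l + S.kap) + S.l) with hf
  have hlen : 0 ≤ ((n : ℤ) + 1) * (S.l + S.kap) := mul_nonneg (by omega) (by omega)
  have hf0 : 0 ≤ f := by
    have h1 : ((n : ℤ) + 2) * (S.l + S.kap) ≤ (S.p + 1) * (S.l + S.kap) :=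
      mul_le_mul_of_nonneg_right (by omega) (by omega)
    have h2 : ((n : ℤ) + 2) * (S.l + S.kap) = (n + 1) * (S.l + S.kap) + S.l + S.kap := by ring
    omega
  have hfd : (S.p : ℤ) ∣ c + f := by
    have h1 : (S.p : ℤ) ∣ S.p * |c| + (n + 1) * S.kap :=
      dvd_add (dvd_mul_right _ _) (S.dvd_kap.mul_left _)
    have h2 := (dvd_neg).2 (dvd_add hnd h1)
    exact (congrArg (fun t : ℤ => (S.p : ℤ) ∣ t) (by rw [hf]; ring)).mpr h2
  set E := rep S.Q (S.l + S.kap) (n + 1) S.P with hE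
  have hEX : E ∈ S.X := rep_mem nblk_Q hkp S.dvd_kap S.P_mem S.P_left _
  have hEl : ∀ k < 0, E k = S.z k := rep_left nblk_Q (by omega) S.P_left _
  have hEr : ∀ k ≥ (S.m : ℤ) - f, E k = S.z (k - (S.m - f)) := by
    intro k hk
    have := rep_apply (S := S.toZeroSys) (y := S.P) nblk_Q (d := S.kap) (by omega)
        (n + 1) (k := k - (n + 1) * (S.l + S.kap)) (by omega)
    push_cast at this
    rw [add_sub_cancel, S.P_right _ (by omega)] at this
    rw [hE, this]
    congr 1; omega
  have key : S.extD b (fun i => shf E (-f) i) = shf E (-f) := by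
    funext k
    unfold extD
    by_cases h1 : k < 0
    · rw [put_out (by omega), if_pos h1, shf_apply, hEl _ (by omega)]
      apply z_congr
      convert hfd using 1
      rw [hc]; ring
    · by_cases h2 : k < S.m
      · exact put_word (S := S) (x := shf E (-f)) (by omega) h2
      · rw [put_out (by omega), if_neg h1, shf_apply, hEr _ (by omega)]
        congr 1; ring
  refine ⟨fun i => shf E (-f) i, fun _ _ _ _ => ?_⟩
  rw [key]
  refine ⟨S.shift_mem _ hEX _, n, f, hf0, fun k h1 h2 => ?_, ?_⟩
  · rw [shf_apply, hEl _ (by omega)]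
    exact Z_z _
  · have := QP_of_rep (S := S) (x := shf E (-f)) (n + 1) f fun k h1 h2 => by
      rw [shf_apply]; congr 1; ring
    convert this using 1
    push_cast
    rw [hf]; ring

end GliderBase

open ZeroSys GliderBase in
theorem exists_gliderSys (S : ZeroSys B) : ∃ T : GliderSys B, T.toZeroSys = S := by
  obtain ⟨P, Q, l, hP, hQ, hne, hg⟩ := S.exists_kernels
  obtain ⟨N, hN⟩ := S.exists_rep_bound
  have hp : (0 : ℤ) < S.p := by exact_mod_cast S.hp
  have hl := hP.pos
  set kap : ℤ := S.p * (l + 2) with hkap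
  have hk1 : l + 2 ≤ kap := le_mul_of_one_le_left (by omega) (by omega)
  have hk2 : 2 * (S.p : ℤ) ≤ kap := by nlinarith
  -- A multiple of `p` with room for `2p` kernels and a representative of length at most `N`, and
  -- also for the at most `p + 1` kernels of a train.
  set m : ℕ := S.p * ((2 * S.p + 2) * (l + kap).toNat + N) with hm
  have hm1 : (2 * (S.p : ℤ) + 2) * (l + kap) + N ≤ m := by
    have h1 : ((l + kap).toNat : ℤ) = l + kap := Int.toNat_of_nonneg (by omega)
    rw [hm]
    push_cast
    rw [h1]
    refine le_mul_of_one_le_left ?_ (by omega)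
    have : 0 ≤ (2 * (S.p : ℤ) + 2) * (l + kap) := mul_nonneg (by omega) (by omega)
    omega
  have hm2 : (2 * (S.p : ℤ) + 2) * (l + kap) = 2 * S.p * (l + kap) + 2 * (l + kap) := by ring
  have hm3 : (2 * (S.p : ℤ) + 2) * (l + kap) =
    (S.p + 1) * (l + kap) + (S.p + 1) * (l + kap) := by ring
  have hm4 : 0 ≤ ((S.p : ℤ) + 1) * (l + kap) := mul_nonneg (by omega) (by omega)
  have hm5 : 0 ≤ 2 * (S.p : ℤ) * (l + kap) := mul_nonneg (by omega) (by omega)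
  let T : GliderBase B :=
    { S with
      l := l, kap := kap, K := S.p * (m + l + 2 * kap), m := m, P := P, Q := Q
      P_mem := hP.mem, Q_mem := hQ.mem, P_left := hP.left, Q_left := hQ.left
      P_right := hP.right, Q_right := hQ.right
      P_first := fun a h => hP.first ⟨a, h⟩, Q_first := fun a h => hQ.first ⟨a, h⟩
      P_last := fun a h => hP.last ⟨a, h⟩, Q_last := fun a h => hQ.last ⟨a, h⟩
      PQ_ne := hne, hl := hl, hlk := by omega, hpk := hk2, dvd_kap := dvd_mul_right _ _
      hm := by omega
      hK := le_mul_of_one_le_left (by omega) (by omega)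
      dvd_K := dvd_mul_right _ _ }
  obtain ⟨eC, hC⟩ := exists_eC (S := T) (N := N) (dvd_mul_right _ _) hN
    (by change 2 * (S.p : ℤ) * (l + kap) + N ≤ m; omega)
  obtain ⟨eD, hD⟩ := exists_eD (S := T) hg
    (by change ((S.p : ℤ) + 1) * (l + kap) ≤ m; omega)
  exact ⟨{ T with eC := eC, eD := eD, eC_spec := hC, eD_spec := hD }, rfl⟩


/-! ### Words of configurations and the languages of fleets. -/

section seg

variable {C : Type*} {x y : ℤ → C} {a b c d : ℤ}

/-- The word `x[a] ⋯ x[b - 1]`. -/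
def seg (x : ℤ → C) (a b : ℤ) : List C := (List.range (b - a).toNat).map fun k : ℕ => x (a + k)

lemma block_eq_seg (x : ℤ → C) (i j : ℤ) : block x i j = seg x i (j + 1) := by
  simp only [block, seg, List.pure_def, List.bind_eq_flatMap, List.map_flatMap, List.map_cons,
    List.map_nil]
  rw [← List.map_eq_flatMap]

lemma seg_length (x : ℤ → C) (a b : ℤ) : (seg x a b).length = (b - a).toNat := by simp [seg]

@[simp] lemma seg_self (x : ℤ → C) (a : ℤ) : seg x a a = [] := by simp [seg]

lemma seg_append (x : ℤ → C) (h : a ≤ b) (h' : b ≤ c) : seg x a b ++ seg x b c = seg x a c := by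
  have e : (c - a).toNat = (b - a).toNat + (c - b).toNat := by omega
  unfold seg
  rw [e, List.range_add, List.map_append, List.map_map]
  congr 1
  apply List.map_congr_left
  intro k _
  simp only [Function.comp]
  congr 1; push_cast; omega

lemma seg_congr (h1 : b - a = d - c) (h : ∀ k, a ≤ k → k < b → x k = y (k + (c - a))) :
    seg x a b = seg y c d := by
  unfold seg
  rw [h1]
  apply List.map_congr_left
  intro k hk
  rw [List.mem_range] at hk
  rw [h _ (by omega) (by omega)]
  congr 1; ring

lemma eq_of_seg_eq (h1 : b - a = d - c) (h : seg x a b = seg y c d) {k : ℤ} (h2 : a ≤ k)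
    (h3 : k < b) : x k = y (k + (c - a)) := by
  unfold seg at h
  rw [h1] at h
  have := (List.map_inj_left.mp h) (k - a).toNat (by rw [List.mem_range]; omega)
  convert this using 2 <;> omega

lemma seg_shf (x : ℤ → C) (a b e : ℤ) : seg (shf x e) a b = seg x (a + e) (b + e) :=
  seg_congr (by ring) fun k _ _ => by simp only [shf_apply]; congr 1; ring

/-- Splitting a word of a configuration. -/
lemma seg_split {u v : List C} (h : seg x a b = u ++ v) (hab : a ≤ b) :
    ∃ c, a ≤ c ∧ c ≤ b ∧ c = a + u.length ∧ seg x a c = u ∧ seg x c b = v := by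
  have hl : ((u ++ v).length : ℤ) = b - a := by rw [← h, seg_length]; omega
  rw [List.length_append] at hl
  push_cast at hl
  refine ⟨a + u.length, by omega, by omega, rfl, ?_⟩
  rw [← seg_append x (b := a + u.length) (by omega) (by omega)] at h
  exact List.append_inj h (by rw [seg_length]; omega)

lemma mem_lang {X : Set (ℤ → C)} (hX : ∀ x ∈ X, ∀ c, shf x c ∈ X) {w : List C} :
    w ∈ lang X ↔ ∃ x ∈ X, seg x 0 w.length = w := by
  constructor
  · rintro ⟨x, hx, i, j, rfl⟩
    refine ⟨shf x i, hX x hx i, ?_⟩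
    rw [seg_shf, block_eq_seg, seg_length]
    unfold seg
    rw [zero_add]
    congr 2
    omega
  · rintro ⟨x, hx, h⟩
    refine ⟨x, hx, 0, w.length - 1, ?_⟩
    rw [block_eq_seg, sub_add_cancel, h]

lemma seg_mem_lang {X : Set (ℤ → C)} (hx : x ∈ X) (a b : ℤ) : seg x a b ∈ lang X :=
  ⟨x, hx, a, b - 1, by rw [block_eq_seg, sub_add_cancel]⟩

lemma seg_perConf (z : List C) (hz : z ≠ []) : seg (perConf z hz) 0 z.length = z := by
  apply List.ext_getElem
  · rw [seg_length]; omega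
  · intro i h1 h2
    simp only [seg, List.getElem_map, List.getElem_range, perConf]
    congr 1
    rw [Int.emod_eq_of_lt (by omega) (by omega)]
    omega

lemma perConf_congr (z : List C) (hz : z ≠ []) (h : (z.length : ℤ) ∣ a - b) :
    perConf z hz a = perConf z hz b := by
  unfold perConf
  congr 2
  exact Int.emod_eq_emod_iff_emod_sub_eq_zero.2 (Int.emod_eq_zero_of_dvd h)

lemma seg_perConf_mul (z : List C) (hz : z ≠ []) (r : ℕ) :
    seg (perConf z hz) 0 (r * z.length) = (List.replicate r z).flatten := by
  induction r with
  | zero => simp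
  | succ r ih =>
    rw [List.replicate_succ', List.flatten_append, ← ih,
      ← seg_append _ (b := r * z.length) (by positivity) (by push_cast; nlinarith)]
    congr 1
    simp only [List.flatten_cons, List.flatten_nil, List.append_nil]
    conv_rhs => rw [← seg_perConf z hz]
    refine seg_congr (by push_cast; ring) fun k _ _ => perConf_congr z hz ?_
    exact ⟨r, by ring⟩

end seg

section languages

/-- The words of the languages of fleets: products of words `E r`. -/
def fleetWord {C : Type*} (E : ℕ → List C) (rs : List ℕ) : List C := (rs.map E).flatten

variable {C : Type*} (z g : List C)

lemma kstar_singleton {w : List C} :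
    w ∈ ({z} : Language C)∗ ↔ ∃ r : ℕ, w = (List.replicate r z).flatten := by
  rw [Language.mem_kstar]
  constructor
  · rintro ⟨L, rfl, h⟩
    exact ⟨L.length, by rw [List.eq_replicate_of_mem (a := z) fun y hy => h y hy, List.length_replicate]⟩
  · rintro ⟨r, rfl⟩
    exact ⟨_, rfl, fun y hy => List.eq_of_mem_replicate hy⟩

lemma kstar_range {L : Language C} {E : ℕ → List C} (h : ∀ w, w ∈ L ↔ ∃ r, w = E r) {w : List C} :
    w ∈ L∗ ↔ ∃ rs, w = fleetWord E rs := by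
  rw [Language.mem_kstar]
  constructor
  · rintro ⟨l, rfl, hl⟩
    induction l with
    | nil => exact ⟨[], rfl⟩
    | cons a l ih =>
      obtain ⟨rs, hrs⟩ := ih fun y hy => hl y (List.mem_cons_of_mem _ hy)
      obtain ⟨r, hr⟩ := (h a).1 (hl a List.mem_cons_self)
      exact ⟨r :: rs, by rw [List.flatten_cons, hrs, hr]; rfl⟩
  · rintro ⟨rs, rfl⟩
    refine ⟨_, rfl, fun y hy => ?_⟩
    obtain ⟨r, -, rfl⟩ := List.mem_map.1 hy
    exact (h _).2 ⟨r, rfl⟩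

lemma mem_leftGliderLang {w : List C} : w ∈ leftGliderLang z g ↔
    ∃ rs, w = fleetWord (fun r => g ++ (List.replicate (r + 1) z).flatten) rs := by
  refine kstar_range fun w => ?_
  simp only [Language.mem_mul, kstar_singleton]
  constructor
  · rintro ⟨a, ⟨b, rfl, c, rfl, rfl⟩, d, ⟨r, rfl⟩, rfl⟩
    exact ⟨r, by rw [List.replicate_succ, List.flatten_cons, List.append_assoc]⟩
  · rintro ⟨r, rfl⟩
    exact ⟨_, ⟨_, rfl, _, rfl, rfl⟩, _, ⟨r, rfl⟩,
      by rw [List.replicate_succ, List.flatten_cons, List.append_assoc]⟩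

lemma mem_rightGliderLang {w : List C} : w ∈ rightGliderLang z g ↔
    ∃ rs, w = fleetWord (fun r => (List.replicate (r + 1) z).flatten ++ g) rs := by
  refine kstar_range fun w => ?_
  simp only [Language.mem_mul, kstar_singleton]
  constructor
  · rintro ⟨a, ⟨d, ⟨r, rfl⟩, c, rfl, rfl⟩, b, rfl, rfl⟩
    exact ⟨r, by simp [List.replicate_succ', List.append_assoc]⟩
  · rintro ⟨r, rfl⟩
    exact ⟨_, ⟨_, ⟨r, rfl⟩, _, rfl, rfl⟩, _, rfl,
      by simp [List.replicate_succ', List.append_assoc]⟩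

end languages

namespace ZeroSys

variable {S : ZeroSys B} {x : ℤ → B}

/-- Two configurations sharing an aligned zero word can be glued. -/
lemma sync_append {u v w : List B} (hw : w = seg S.z 0 S.p)
    (h1 : u ++ w ∈ lang S.X) (h2 : w ++ v ∈ lang S.X) : u ++ w ++ v ∈ lang S.X := by
  have hp := S.hp
  rw [mem_lang S.shift_mem] at h1 h2
  obtain ⟨x, hx, hx'⟩ := h1
  obtain ⟨y, hy, hy'⟩ := h2
  obtain ⟨c, h0c, hc, -, hxu, hxw⟩ := seg_split hx' (by positivity)
  obtain ⟨d, h0d, hd, hd', hyw, hyv⟩ := seg_split hy' (by positivity)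
  have hwl : (w.length : ℤ) = S.p := by rw [hw, seg_length]; omega
  rw [hwl, zero_add] at hd'
  subst hd'
  have hl : (((u ++ w).length : ℕ) : ℤ) = c + S.p := by
    have e : ((w.length : ℕ) : ℤ) = ((u ++ w).length : ℕ) - c := by
      conv_lhs => rw [← hxw]
      rw [seg_length]; omega
    omega
  rw [hl] at hx' hxw hc
  have key := S.sync x hx _ (S.shift_mem y hy (-c)) (c + S.p) ?_ ?_
  · convert seg_mem_lang key 0 (c + ((w ++ v).length : ℕ)) using 1
    rw [← seg_append (b := c + S.p) _ (by omega) (by rw [List.length_append]; push_cast; omega)]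
    congr 1
    · rw [← hx']
      exact seg_congr (by ring) fun k _ h => by rw [glue_lt (by omega)]; congr 1; ring
    · rw [← hyv]
      refine seg_congr (by rw [hyv]; ring) fun k h _ => ?_
      rw [glue_ge (by omega), shf_apply]
      congr 1; ring
  · intro k h3 h4
    rw [eq_of_seg_eq (by ring) (hxw.trans hw) (k := k) (by omega) h4]
    exact z_congr ⟨1, by ring⟩
  · intro k h3 h4
    rw [shf_apply, eq_of_seg_eq (by ring) (hyw.trans hw) (k := k + -c) (by omega) (by omega)]
    exact z_congr ⟨1, by ring⟩

lemma pair_mem_lang {a b : B} : [a, b] ∈ lang S.X ↔ ∃ x ∈ S.X, x 0 = a ∧ x 1 = b := by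
  rw [mem_lang S.shift_mem]
  constructor
  · rintro ⟨x, hx, h⟩
    refine ⟨x, hx, ?_⟩
    simpa [seg, List.range_succ] using h
  · rintro ⟨x, hx, rfl, rfl⟩
    exact ⟨x, hx, by simp [seg, List.range_succ]⟩

section

variable [TopologicalSpace B] {X : Subshift B ℤ} {z : List B}

lemma isSynchronizing (hX : X.carrier = S.X) (hz : z = seg S.z 0 S.p) : IsSynchronizing X z := by
  unfold IsSynchronizing
  rw [hX]
  exact ⟨hz ▸ seg_mem_lang S.z_mem _ _, fun u _ v _ h1 h2 => sync_append hz h1 h2⟩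

lemma isDeterministic (hX : X.carrier = S.X) (hz : z = seg S.z 0 S.p) : IsDeterministic X z := by
  have hzl : z.length = S.p := by rw [hz, seg_length]; omega
  have hget : ∀ (i : ℕ) (h : i < z.length), z[i] = S.z i := by
    intro i h
    subst hz
    simp [seg]
  have hnd : z.Nodup := by
    rw [List.nodup_iff_injective_get]
    intro i j hij
    have h1 := i.2
    have h2 := j.2
    simp only [List.get_eq_getElem, hget, S.z_eq] at hij
    have := Int.eq_zero_of_abs_lt_dvd hij (by rw [abs_lt]; omega)
    apply Fin.ext
    omega
  have hmem : z ∈ lang X.carrier := by rw [hX, hz]; exact seg_mem_lang S.z_mem _ _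
  have hnot : ∀ i : ℕ, i + 1 < z.length → ¬ (S.p : ℤ) ∣ i + 1 := fun i h hd => by
    have := Int.le_of_dvd (by positivity) hd
    omega
  refine ⟨⟨hmem, hnd, fun i h => ⟨S.z (i + 1), ?_, fun b hb => ?_⟩⟩,
    ⟨hmem, hnd, fun i h => ⟨S.z i, ?_, fun b hb => ?_⟩⟩⟩
  · simp only [List.cons_append, List.nil_append, hX, hget, pair_mem_lang]
    exact ⟨shf S.z i, S.shift_mem _ S.z_mem _, by simp, by simp [add_comm]⟩
  · simp only [List.cons_append, List.nil_append, hX, hget, pair_mem_lang] at hb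
    obtain ⟨x, hx, h1, rfl⟩ := hb
    exact S.det_succ x hx 0 i h1 (hnot i h)
  · simp only [hX, hget, pair_mem_lang]
    exact ⟨shf S.z i, S.shift_mem _ S.z_mem _, by simp, by simp [add_comm]⟩
  · simp only [hX, hget, pair_mem_lang] at hb
    obtain ⟨x, hx, rfl, h1⟩ := hb
    have := S.det_pred x hx 1 ((i + 1 : ℕ) : ℤ) h1 (by exact_mod_cast hnot i h)
    simpa using this

end

/-- Configurations in which words of `R` surrounded by zeros are concatenated. -/
lemma fleet_mem {R : ℤ → B} (hR : R ∈ S.X) {l : ℤ} (hl : ∀ k < 0, R k = S.z k)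
    (hr : ∀ k ≥ l, R k = S.z (k - l)) {u v : ℕ → ℤ} (h0 : 0 ≤ l) (hu : ∀ r, 0 ≤ u r)
    (hu' : ∀ r, (S.p : ℤ) ∣ u r) (hv : ∀ r, l + 2 * S.p ≤ v r) (hv' : ∀ r, (S.p : ℤ) ∣ v r - l)
    (rs : List ℕ) : ∀ (x : ℤ → B) (i j : ℤ), i ≤ j → (∀ k < i, x k = S.z (k - i)) →
      (∀ k ≥ j, x k = S.z (k - j)) → seg x i j = fleetWord (fun r => seg R (-u r) (v r)) rs →
      x ∈ S.X := by
  have hp : (0 : ℤ) < S.p := by exact_mod_cast S.hp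
  induction rs with
  | nil =>
    intro x i j hij h1 h2 h3
    have h4 : (j - i).toNat = 0 := by rw [← seg_length x, h3]; rfl
    have h5 : i = j := by omega
    subst h5
    convert S.shift_mem _ S.z_mem (-i) using 1
    funext k
    rw [shf_apply, ← sub_eq_add_neg]
    rcases lt_or_ge k i with h | h
    · exact h1 k h
    · exact h2 k h
  | cons r rs ih =>
    intro x i j hij h1 h2 h3
    have hur := hu r
    have hvr := hv r
    obtain ⟨c, hc1, hc2, hc3, hc4, hc5⟩ := seg_split (h3.trans (List.flatten_cons ..)) hij
    rw [seg_length, Int.toNat_of_nonneg (by omega)] at hc3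
    set q := i + u r with hq
    have hx1 : ∀ k, i ≤ k → k < c → x k = R (k - q) := by
      intro k h5 h6
      rw [eq_of_seg_eq (by rw [hc3]; ring) hc4 h5 h6]
      congr 1; rw [hq]; ring
    have h4 := ih (glue (shf S.z (-c)) x c) c j hc2 (fun k hk => by
      rw [glue_lt hk, shf_apply, sub_eq_add_neg]) (fun k hk => by
      rw [glue_ge (by omega)]; exact h2 k hk) (by
      rw [← show seg x c j = fleetWord _ rs from hc5]
      exact seg_congr rfl fun k h _ => by rw [glue_ge h]; congr 1; ring)
    have hz1 : ∀ k, q + l ≤ k → R (k - q) = S.z (k - c) := by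
      intro k hk
      rw [hr _ (by omega)]
      apply z_congr
      obtain ⟨t, ht⟩ := hv' r
      exact ⟨t, by rw [← ht, hc3]; ring⟩
    have := S.glue_mem (S.shift_mem R hR (-q)) h4 (c := c) (fun k h5 h6 => ?_) (fun k h5 h6 => ?_)
    · convert this using 1
      funext k
      rcases lt_or_ge k c with h5 | h5
      · rw [glue_lt h5, shf_apply, ← sub_eq_add_neg]
        rcases lt_or_ge k i with h6 | h6
        · rw [h1 k h6, hl _ (by omega)]
          apply z_congr
          obtain ⟨t, ht⟩ := hu' r
          exact ⟨t, by rw [← ht, hq]; ring⟩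
        · exact hx1 k h6 h5
      · rw [glue_ge h5, glue_ge h5]
    · rw [shf_apply, ← sub_eq_add_neg, hz1 k (by omega)]
      exact S.Z_z _
    · rw [glue_lt h6, shf_apply, shf_apply, ← sub_eq_add_neg, ← sub_eq_add_neg, hz1 k (by omega)]

end ZeroSys


/-! ### Fleets as languages and as configurations. -/

namespace GliderBase

open ZeroSys

variable (S : GliderBase B)

/-- The leftbound glider. -/
def gl : List B := seg S.Q (-(S.K - S.kap)) (S.l + S.kap)

/-- The rightbound glider. -/
def gr : List B := seg S.P 0 (S.l + S.K)

lemma dvd_sub_kap : (S.p : ℤ) ∣ S.K - S.kap := dvd_sub S.dvd_K S.dvd_kap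

variable {S} {z : List B} {hz : z ≠ []} (hS : S.z = perConf z hz) (hp : z.length = S.p)

include hS hp

lemma seg_zeros (r : ℕ) : (List.replicate r z).flatten = seg S.z 0 (r * S.p) := by
  rw [hS, ← hp, seg_perConf_mul]

lemma seg_one : z = seg S.z 0 S.p := by
  rw [hS, ← hp, seg_perConf]

lemma gl_zeros (r : ℕ) : S.gl ++ (List.replicate (r + 1) z).flatten =
    seg S.Q (-(S.K - S.kap)) (S.l + S.kap + (r + 1) * S.p) := by
  have h := S.par
  rw [seg_zeros hS hp, gl, ← seg_append S.Q (b := S.l + S.kap) (by omega)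
    (le_add_of_nonneg_right (by positivity))]
  congr 1
  refine seg_congr (by push_cast; ring) fun k h1 h2 => ?_
  rw [S.Q_right _ (by omega)]
  obtain ⟨t, ht⟩ := S.dvd_kap
  exact z_congr ⟨-t, by rw [mul_neg, ← ht]; ring⟩

lemma zeros_gr (r : ℕ) : (List.replicate (r + 1) z).flatten ++ S.gr =
    seg S.P (-((r + 1) * S.p)) (S.l + S.K) := by
  have h := S.par
  rw [seg_zeros hS hp, gr, ← seg_append S.P (b := 0) (neg_nonpos.2 (by positivity)) (by omega)]
  congr 1
  refine seg_congr (by push_cast; ring) fun k h1 h2 => ?_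
  push_cast at h2
  rw [S.P_left _ (by linarith)]
  exact z_congr ⟨r + 1, by ring⟩

lemma mem_left {w : List B} : w ∈ leftGliderLang z S.gl ↔
    ∃ rs, w = fleetWord (fun r => seg S.Q (-(S.K - S.kap)) (S.l + S.kap + (r + 1) * S.p)) rs := by
  simp_rw [mem_leftGliderLang, gl_zeros hS hp]

lemma mem_right {w : List B} : w ∈ rightGliderLang z S.gr ↔
    ∃ rs, w = fleetWord (fun r => seg S.P (-((r + 1) * S.p)) (S.l + S.K)) rs := by
  simp_rw [mem_rightGliderLang, zeros_gr hS hp]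

lemma fleet_left_mem : fleetSet z hz (leftGliderLang z S.gl) ⊆ S.X := by
  rintro x ⟨i, j, hij, h1, h2, h3⟩
  have h := S.par
  rw [block_eq_seg, sub_add_cancel, mem_left hS hp] at h2
  obtain ⟨rs, h2⟩ := h2
  refine fleet_mem S.Q_mem S.Q_left S.Q_right (u := fun _ => S.K - S.kap)
    (v := fun r => S.l + S.kap + (r + 1) * S.p) S.hl.le (fun _ => by omega)
    (fun _ => S.dvd_sub_kap) (fun r => ?_) (fun r => ?_) rs x i j hij (fun k hk => ?_)
    (fun k hk => ?_) h2
  · have : (0 : ℤ) ≤ (r + 1) * S.p := by positivity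
    omega
  · rw [show S.l + S.kap + (r + 1) * S.p - S.l = S.kap + (r + 1) * (S.p : ℤ) by ring]
    exact dvd_add S.dvd_kap (dvd_mul_left _ _)
  · rw [h1 k (by omega), hS]; congr 1; ring
  · rw [h3 k hk, hS]

lemma fleet_right_mem : fleetSet z hz (rightGliderLang z S.gr) ⊆ S.X := by
  rintro x ⟨i, j, hij, h1, h2, h3⟩
  have h := S.par
  rw [block_eq_seg, sub_add_cancel, mem_right hS hp] at h2
  obtain ⟨rs, h2⟩ := h2
  refine fleet_mem S.P_mem S.P_left S.P_right (u := fun r => (r + 1) * S.p)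
    (v := fun _ => S.l + S.K) S.hl.le (fun _ => by positivity)
    (fun _ => dvd_mul_left _ _) (fun r => by omega) (fun r => ?_) rs x i j hij (fun k hk => ?_)
    (fun k hk => ?_) h2
  · rw [add_sub_cancel_left]; exact S.dvd_K
  · rw [h1 k (by omega), hS]; congr 1; ring
  · rw [h3 k hk, hS]

omit hp in
lemma lang_le {L : Language B} (h : fleetSet z hz L ⊆ S.X) : L ≤ lang S.X := by
  intro w hw
  set x : ℤ → B := fun k => if h : 0 ≤ k ∧ k < w.length then w[k.toNat] else
    if k < 0 then S.z k else S.z (k - w.length) with hx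
  have hxw : seg x 0 w.length = w := by
    apply List.ext_getElem
    · rw [seg_length]; omega
    · intro i h1 h2
      simp only [seg, List.getElem_map, List.getElem_range, zero_add, hx]
      rw [dif_pos (by omega)]
      rfl
  rw [← hxw]
  refine seg_mem_lang (h ⟨0, w.length, by positivity, fun k hk => ?_, ?_, fun k hk => ?_⟩) _ _
  · simp only [hx]
    rw [dif_neg (by omega), if_pos (by omega), hS]
    congr 1; ring
  · rwa [block_eq_seg, sub_add_cancel, hxw]
  · simp only [hx]
    rw [dif_neg (by omega), if_neg (by omega), hS]

-- The word contains a nonzero letter, so each occurrence must meet the finite middle part.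
omit hp in
lemma occ_finite {L : Language B} {x : ℤ → B} (hx : x ∈ fleetSet z hz L) {y : ℤ → B} {a b c : ℤ}
    (hc : a ≤ c) (hc' : c < b) (hy : ¬ S.Z (y c)) : (occ x (seg y a b)).Finite := by
  obtain ⟨i, j, hij, h1, -, h3⟩ := hx
  refine (Set.finite_Icc (i - (c - a)) (j - (c - a))).subset fun k hk => ?_
  have hk' : seg x k (k + (b - a)) = seg y a b := by
    have : block x k (k + (seg y a b).length - 1) = seg y a b := hk
    rw [block_eq_seg, sub_add_cancel, seg_length] at this
    rw [← this]
    congr 1; omega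
  have hn : ¬ S.Z (x (k + (c - a))) := by
    rwa [eq_of_seg_eq (by ring) hk' (by omega) (by omega), show k + (c - a) + (a - k) = c by ring]
  constructor
  · by_contra hlt
    exact hn ⟨k + (c - a) - i, by rw [h1 _ (by omega), hS]; congr 1; ring⟩
  · by_contra hlt
    exact hn ⟨k + (c - a) - j, by rw [h3 _ (by omega), hS]⟩

omit hS hp

variable {x : ℤ → B}

/-- Consecutive kernels are separated by `kap` and at least `p` zeros from one factor and `K - kap`
from the next, hence by at least `K1`. This explains how `gl` distributes its zeros. -/
lemma fleet_LF (rs : List ℕ) : ∀ i j : ℤ, i ≤ j →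
    seg x i j = fleetWord (fun r => seg S.Q (-(S.K - S.kap)) (S.l + S.kap + (r + 1) * S.p)) rs →
    S.LF x i → S.Zr x (i - S.kap - S.p) i → S.LF x j := by
  have h := S.par
  induction rs with
  | nil =>
    intro i j hij h3 h1 _
    have h4 : (j - i).toNat = 0 := by rw [← seg_length x, h3]; rfl
    rwa [show j = i by omega]
  | cons r rs ih =>
    intro i j hij h3 h1 h2
    have hr : (S.p : ℤ) ≤ (r + 1) * S.p := le_mul_of_one_le_left (by omega) (by omega)
    obtain ⟨c, hc1, hc2, hc3, hc4, hc5⟩ := seg_split (h3.trans (List.flatten_cons ..)) hij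
    rw [seg_length, Int.toNat_of_nonneg (by omega)] at hc3
    set n : ℤ := (r + 1) * S.p
    have hx1 : ∀ k, i ≤ k → k < c → x k = S.Q (k - (i + (S.K - S.kap))) := by
      intro k h5 h6
      rw [eq_of_seg_eq (by rw [hc3]; ring) hc4 h5 h6]
      congr 1; ring
    have h4 : S.Zr x i (i + (S.K - S.kap)) := fun k h5 h6 => by
      rw [hx1 k h5 (by omega), S.Q_left _ (by omega)]; exact S.Z_z _
    have h5 : S.Zr x (i + (S.K - S.kap) + S.l) c := fun k h5 h6 => by
      rw [hx1 k (by omega) (by omega), S.Q_right _ (by omega)]; exact S.Z_z _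
    refine ih c j hc2 hc5 ?_ (h5.mono (by omega) le_rfl)
    refine ((h1.extend h4 (by omega)).add (fun k h6 h7 => ?_)
      ((h2.append h4).mono (by omega) le_rfl) (h5.mono le_rfl (by omega))).extend
      (h5.mono (by omega) le_rfl) (by omega)
    rw [hx1 _ (by omega) (by omega), add_sub_cancel_left]

lemma fleet_RF (rs : List ℕ) : ∀ i j : ℤ, i ≤ j →
    seg x i j = fleetWord (fun r => seg S.P (-((r + 1) * S.p)) (S.l + S.K)) rs →
    S.Zr x (i - S.K) i → (∀ k ≥ j, S.Z (x k)) → S.RF x i := by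
  have h := S.par
  induction rs with
  | nil =>
    intro i j hij h3 _ h1
    have h4 : (j - i).toNat = 0 := by rw [← seg_length x, h3]; rfl
    exact ⟨⟨j, h1⟩, fun k hk hz => absurd (h1 k (by omega)) hz⟩
  | cons r rs ih =>
    intro i j hij h3 h1 h2
    have hr : (S.p : ℤ) ≤ (r + 1) * S.p := le_mul_of_one_le_left (by omega) (by omega)
    obtain ⟨c, hc1, hc2, hc3, hc4, hc5⟩ := seg_split (h3.trans (List.flatten_cons ..)) hij
    rw [seg_length, Int.toNat_of_nonneg (by omega)] at hc3
    set n : ℤ := (r + 1) * S.p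
    have hx1 : ∀ k, i ≤ k → k < c → x k = S.P (k - (i + n)) := by
      intro k h5 h6
      rw [eq_of_seg_eq (by rw [hc3]; ring) hc4 h5 h6]
      congr 1; ring
    have h4 : S.Zr x i (i + n) := fun k h5 h6 => by
      rw [hx1 k h5 (by omega), S.P_left _ (by omega)]; exact S.Z_z _
    have h5 : S.Zr x (i + n + S.l) c := fun k h5 h6 => by
      rw [hx1 k (by omega) (by omega), S.P_right _ (by omega)]; exact S.Z_z _
    have hR := ih c j hc2 hc5 (h5.mono (by omega) le_rfl) h2
    refine ⟨hR.1, fun k hk hkz => ?_⟩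
    rcases lt_or_ge k c with h6 | h6
    · have h7 := nonzero_or h4 hkz
      have h8 := nonzero_or h5 hkz
      refine ⟨i + n, by omega, by omega, fun k h9 h10 => ?_,
        (h1.append h4).mono (by omega) le_rfl⟩
      rw [hx1 _ (by omega) (by omega), add_sub_cancel_left]
    · exact hR.2 k h6 hkz

/-- Fleets of leftbound gliders are recovered from `LF`. -/
lemma LF.leftRepLang (hx : x ∈ S.X) {A : ℤ} (hA : ∀ k < A, S.Z (x k)) (n : ℕ) :
    ∀ I : ℤ, I ≤ A + n → S.LF x I → S.Zr x (I - S.kap - S.p) I →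
      (∀ k, I - S.p ≤ k → k < I → x k = S.z (k - I)) →
      ∃ j ≤ I, (∀ k < j, x k = S.z (k - j)) ∧ ∃ rs, seg x j I =
        fleetWord (fun r => seg S.Q (-(S.K - S.kap)) (S.l + S.kap + (r + 1) * S.p)) rs := by
  have h := S.par
  have base : ∀ I : ℤ, (∀ k < I, S.Z (x k)) → (∀ k, I - S.p ≤ k → k < I → x k = S.z (k - I)) →
      ∃ j ≤ I, (∀ k < j, x k = S.z (k - j)) ∧ ∃ rs, seg x j I =
        fleetWord (fun r => seg S.Q (-(S.K - S.kap)) (S.l + S.kap + (r + 1) * S.p)) rs := by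
    intro I h0 h1
    refine ⟨I, le_rfl, fun k hk => ?_, [], by rw [seg_self]; rfl⟩
    obtain ⟨e, he⟩ := h0 k hk
    have h2 := run hx (a := k) (b := I) (fun c _ hc => h0 c hc) he (I - 1) (by omega) (by omega)
    rw [h1 (I - 1) (by omega) (by omega), S.z_eq] at h2
    rw [he]
    apply z_congr
    obtain ⟨t, ht⟩ := h2
    exact ⟨-t, by rw [mul_neg, ← ht]; ring⟩
  induction n with
  | zero =>
    intro I hI _ _ h3
    exact base I (fun k hk => hA k (by push_cast at hI; omega)) h3
  | succ n ih =>
    intro I hI h1 h2 h3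
    by_cases h0 : ∀ k < I, S.Z (x k)
    · exact base I h0 h3
    push Not at h0
    obtain ⟨k, hk, hkz⟩ := h0
    obtain ⟨f, hf1, hf2, hf3, hf4⟩ := exists_last hk hkz
    obtain ⟨q, hq1, hq2, hq3, hq4, hq5, hq6⟩ := h1.2 (f - 1) (by omega) hf3
    have hf : f = q + S.l := by
      rcases nonzero_or hf4 hq3.last with h5 | h5 <;> omega
    subst hf
    -- Cutting off the last glider together with the `K - kap` zeros that `gl` has in front leaves a
    -- shorter fleet with enough zeros at its end.
    have h4 : S.LF x (q - (S.K - S.kap)) := by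
      refine ⟨h1.1, fun k hk hkz => ?_⟩
      obtain ⟨r, hr1, hr2, hr3, hr4, hr5, hr6⟩ := h1.2 k (by omega) hkz
      refine ⟨r, hr1, hr2, hr3, hr4, hr5, ?_⟩
      have h5 := nonzero_or hq4 hkz
      have h6 := nonzero_or hq4 hr3.last
      omega
    have h5 : ∀ k, q - S.K1 ≤ k → k < q → x k = S.z (k - q) := align_left hx hq4 hq3.first
    have h6 : ∀ k, q + S.l ≤ k → k < I → x k = S.z (k - (q + S.l)) := align_right hx hf4 hf3
    have h7 : (S.p : ℤ) ∣ I - (q + S.l) := by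
      have := h6 (I - 1) (by omega) (by omega)
      rw [h3 (I - 1) (by omega) (by omega), S.z_eq] at this
      obtain ⟨t, ht⟩ := this
      exact ⟨-t, by rw [mul_neg, ← ht]; ring⟩
    have h8 : q + S.l ≤ I - S.kap - S.p := by
      rcases nonzero_or h2 hf3 with h9 | h9 <;> omega
    -- The run behind the glider begins and ends at phase 0, so what exceeds `kap` is a positive
    -- multiple of `p`.
    obtain ⟨r, hr⟩ : ∃ r : ℕ, I = q + S.l + S.kap + (r + 1) * S.p := by
      obtain ⟨t, ht⟩ := dvd_sub h7 S.dvd_kap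
      have ht0 : 1 ≤ t := by
        have : 0 < (S.p : ℤ) * t := by omega
        have := pos_of_mul_pos_right this (by omega)
        omega
      refine ⟨(t - 1).toNat, ?_⟩
      rw [Int.toNat_of_nonneg (by omega), sub_add_cancel, mul_comm, ← ht]
      ring
    obtain ⟨j, hj1, hj2, rs, hj3⟩ := ih (q - (S.K - S.kap)) (by omega) h4
      (hq4.mono (by omega) (by omega)) (fun k h9 h10 => by
        rw [h5 k (by omega) (by omega)]
        apply z_congr
        obtain ⟨t, ht⟩ := S.dvd_sub_kap
        exact ⟨-t, by rw [mul_neg, ← ht]; ring⟩)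
    refine ⟨j, by omega, hj2, rs ++ [r], ?_⟩
    rw [← seg_append x hj1 (by omega), hj3, fleetWord, fleetWord, List.map_append,
      List.flatten_append]
    congr 1
    simp only [List.map_cons, List.map_nil, List.flatten_cons, List.flatten_nil, List.append_nil]
    refine seg_congr (by rw [hr]; ring) fun k h9 h10 => ?_
    rw [show k + (-(S.K - S.kap) - (q - (S.K - S.kap))) = k - q by ring]
    rcases lt_or_ge k q with h11 | h11
    · rw [S.Q_left _ (by omega), h5 k (by omega) h11]
    rcases lt_or_ge k (q + S.l) with h12 | h12
    · rw [← hq3 _ (by omega) (by omega), add_sub_cancel]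
    · rw [S.Q_right _ (by omega), h6 k h12 h10]
      congr 1; ring

/-- Fleets of rightbound gliders are recovered from `RF`. -/
lemma RF.rightLangRep (hx : x ∈ S.X) {A : ℤ} (hA : ∀ k ≥ A, S.Z (x k)) (n : ℕ) :
    ∀ I : ℤ, A - n ≤ I → S.RF x I → S.Zr x (I - S.K) (I + S.p) →
      (∀ k, I ≤ k → k < I + S.p → x k = S.z (k - I)) →
      ∃ j ≥ I, (∀ k ≥ j, x k = S.z (k - j)) ∧ ∃ rs, seg x I j =
        fleetWord (fun r => seg S.P (-((r + 1) * S.p)) (S.l + S.K)) rs := by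
  have h := S.par
  have base : ∀ I : ℤ, (∀ k ≥ I, S.Z (x k)) → (∀ k, I ≤ k → k < I + S.p → x k = S.z (k - I)) →
      ∃ j ≥ I, (∀ k ≥ j, x k = S.z (k - j)) ∧ ∃ rs, seg x I j =
        fleetWord (fun r => seg S.P (-((r + 1) * S.p)) (S.l + S.K)) rs := by
    intro I h0 h1
    refine ⟨I, le_rfl, fun k hk => ?_, [], by rw [seg_self]; rfl⟩
    rw [run hx (a := I) (b := k + 1) (e := 0) (fun c hc _ => h0 c hc)
      (by rw [h1 I le_rfl (by omega), sub_self]) k hk (by omega), zero_add]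
  induction n with
  | zero =>
    intro I hI _ _ h3
    exact base I (fun k hk => hA k (by push_cast at hI; omega)) h3
  | succ n ih =>
    intro I hI h1 h2 h3
    by_cases h0 : ∀ k ≥ I, S.Z (x k)
    · exact base I h0 h3
    push Not at h0
    obtain ⟨k, hk, hkz⟩ := h0
    obtain ⟨f, hf1, hf2, hf3, hf4⟩ := exists_first hk hkz
    obtain ⟨q, hq1, hq2, hq3, hq4⟩ := h1.2 f hf1 hf3
    have hq : q = f := by
      have h5 := nonzero_or hf4 hq3.first
      have h6 := nonzero_or h2 hq3.first
      omega
    subst hq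
    have hqp : I + S.p ≤ q := by
      rcases nonzero_or h2 hf3 with h5 | h5 <;> omega
    have h5 : ∀ k, I ≤ k → k < q → x k = S.z (k - q) := align_left hx hf4 hf3
    have h6 := RF.right h1 (q := q) (by omega) hq3 hq4
    have h7 := align_right hx h6 hq3.last
    obtain ⟨r, hr⟩ : ∃ r : ℕ, q = I + (r + 1) * S.p := by
      have h8 := h5 I le_rfl (by omega)
      rw [h3 I le_rfl (by omega), S.z_eq] at h8
      obtain ⟨t, ht⟩ := h8
      have ht0 : 1 ≤ t := by
        have : 0 < (S.p : ℤ) * t := by omega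
        have := pos_of_mul_pos_right this (by omega)
        omega
      refine ⟨(t - 1).toNat, ?_⟩
      rw [Int.toNat_of_nonneg (by omega), sub_add_cancel, mul_comm, ← ht]
      ring
    obtain ⟨j, hj1, hj2, rs, hj3⟩ := ih (q + S.l + S.K) (by omega) (h1.mono (by omega))
      (h6.mono (by omega) (by omega)) (fun k h9 h10 => by
        rw [h7 k (by omega) (by omega)]
        apply z_congr
        obtain ⟨t, ht⟩ := S.dvd_K
        exact ⟨t, by rw [← ht]; ring⟩)
    refine ⟨j, by omega, hj2, r :: rs, ?_⟩
    rw [← seg_append x (b := q + S.l + S.K) (by omega) hj1, hj3, fleetWord, fleetWord,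
      List.map_cons, List.flatten_cons]
    congr 1
    refine seg_congr (by rw [hr]; ring) fun k h9 h10 => ?_
    rw [show k + (-((r + 1) * S.p) - I) = k - q by rw [hr]; ring]
    rcases lt_or_ge k q with h11 | h11
    · rw [S.P_left _ (by omega), h5 k (by omega) h11]
    rcases lt_or_ge k (q + S.l) with h12 | h12
    · rw [← hq3 _ (by omega) (by omega), add_sub_cancel]
    · rw [S.P_right _ (by omega), h7 k h12 (by omega)]
      congr 1; ring

end GliderBase


/-! ### The reversible automaton on the subshift and the decomposition. -/

namespace GliderSys

open ZeroSys GliderBase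

variable [Finite B] (S : GliderSys B)

section ca

variable [TopologicalSpace B] {X : Subshift B ℤ} (hX : X.carrier = S.X)

/-- The automaton as a self-map of the subshift. -/
noncomputable def ca (x : X.carrier) : X.carrier :=
  ⟨S.G x.1, hX.ge (G_mem (hX.le x.2))⟩

lemma ca_iterate (x : X.carrier) (t : ℕ) : ((S.ca hX)^[t] x).1 = S.G^[t] x.1 := by
  induction t with
  | zero => rfl
  | succ t ih =>
    rw [Function.iterate_succ_apply', Function.iterate_succ_apply', ← ih]
    rfl

lemma ca_isReversibleCA : IsReversibleCA (S.ca hX) := by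
  have : Nonempty B := ⟨S.z 0⟩
  refine ⟨G_localMap.isMorphism _ fun _ => rfl, fun x y h => Subtype.ext ?_, fun y => ?_⟩
  · have h1 : S.G x.1 = S.G y.1 := congrArg Subtype.val h
    rw [← Ginv_G (hX.le x.2), h1, Ginv_G (hX.le y.2)]
  · exact ⟨⟨S.Ginv y.1, hX.ge (Ginv_mem (hX.le y.2))⟩, Subtype.ext (G_Ginv (hX.le y.2))⟩

end ca

variable {z : List B} {hz : z ≠ []} (hS : S.z = perConf z hz) (hp : z.length = S.p)

variable {S} {x : ℤ → B}

include hS hp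

lemma G_fleet_left (hx : x ∈ fleetSet z hz (leftGliderLang z S.gl)) :
    S.G x = shift (S.p : ℤ) x := by
  have hxX := fleet_left_mem hS hp hx
  obtain ⟨i, j, hij, h1, h2, h3⟩ := hx
  rw [block_eq_seg, sub_add_cancel, mem_left hS hp] at h2
  obtain ⟨rs, h2⟩ := h2
  have h0 : ∀ k < i, S.Z (x k) := fun k hk => ⟨k - (i - 1) - 1, by rw [h1 k (by omega), hS]⟩
  have h0' : ∀ k ≥ j, S.Z (x k) := fun k hk => ⟨k - j, by rw [h3 k hk, hS]⟩
  have hL := fleet_LF rs i j hij h2 ⟨⟨i, h0⟩, fun k hk hz => absurd (h0 k hk) hz⟩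
    fun k _ hk => h0 k hk
  funext k
  rw [G_left hxX h0' fun a ha => hL.extend (fun k hk _ => h0' k hk) ha,
    SymbolicDynamics.FullShift.shift_apply, add_comm]

lemma G_fleet_right (hx : x ∈ fleetSet z hz (rightGliderLang z S.gr)) :
    S.G x = shift (-(S.p : ℤ)) x := by
  have hxX := fleet_right_mem hS hp hx
  obtain ⟨i, j, hij, h1, h2, h3⟩ := hx
  rw [block_eq_seg, sub_add_cancel, mem_right hS hp] at h2
  obtain ⟨rs, h2⟩ := h2
  have h0 : ∀ k < i, S.Z (x k) := fun k hk => ⟨k - (i - 1) - 1, by rw [h1 k (by omega), hS]⟩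
  have h0' : ∀ k ≥ j, S.Z (x k) := fun k hk => ⟨k - j, by rw [h3 k hk, hS]⟩
  have hR := fleet_RF rs i j hij h2 (fun k _ hk => h0 k hk) h0'
  funext k
  rw [G_right hxX h0 fun b => (hR.mono (le_max_left i b)).extend fun k _ h5 => h0 k (by omega),
    SymbolicDynamics.FullShift.shift_apply, sub_eq_add_neg, add_comm]

/-- Finite configurations decompose into two fleets moving away from each other. -/
lemma decompose (hx : x ∈ S.X) (hf : IsFiniteConf z hz x) (N : ℕ) :
    ∃ t Nl Nr M : ℕ, N ≤ Nl ∧ N ≤ Nr ∧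
      block (S.G^[t] x) (-(Nl : ℤ)) Nr = (List.replicate M z).flatten ∧
      LeftRepLang z hz (leftGliderLang z S.gl) (S.G^[t] x) (-((Nl : ℤ) + 1)) ∧
      RightLangRep z hz (rightGliderLang z S.gr) (S.G^[t] x) ((Nr : ℤ) + 1) := by
  have h := S.toGliderBase.par
  obtain ⟨i, j, h1, h2⟩ := hf
  obtain ⟨t₀, a, h3⟩ := exists_sorted hx (A := i) (A' := j)
    (fun k hk => ⟨k - i - 1, by rw [h1 k (by omega), hS]⟩)
    (fun k hk => ⟨k - j, by rw [h2 k hk, hS]⟩)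
  -- `T` further steps clear a radius of `T * p` around `a`. This has to cover the offset of `a`,
  -- the central periods, the alignment, and the context zeros required by both fleets.
  obtain ⟨T, hT⟩ : ∃ T : ℕ, |a| + S.p * (N + 3) + S.K + S.kap ≤ T * (S.p : ℤ) :=
    ⟨(|a| + S.p * (N + 3) + S.K + S.kap).toNat, (Int.self_le_toNat _).trans
      (le_mul_of_one_le_right (by positivity) (by omega))⟩
  have h4 := Sorted.iterate h3 T
  rw [← Function.iterate_add_apply] at h4
  set y := S.G^[T + t₀] x with hy
  obtain ⟨c, hc⟩ : ∃ c, ∀ k, a - T * S.p ≤ k → k < a + T * S.p → y k = S.z (k - c) := by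
    have hTp : 0 < T * (S.p : ℤ) := by
      have : 0 ≤ (S.p : ℤ) * (N + 3) := by positivity
      have := abs_nonneg a
      omega
    obtain ⟨e, he⟩ := h4.mid (a - T * S.p) le_rfl (by omega)
    refine ⟨a - T * S.p - e, fun k hk hk' => ?_⟩
    rw [run h4.mem h4.mid he k hk hk']
    congr 1; ring
  have he0 := Int.emod_nonneg c h.1.ne'
  have he1 := Int.emod_lt_of_pos c h.1
  set e := c % S.p with he
  have hc' : ∀ (n : ℤ) k, a - T * S.p ≤ k → k < a + T * S.p →
      y k = S.z (k - (e + S.p * n)) := by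
    intro n k hk hk'
    rw [hc k hk hk']
    apply z_congr
    obtain ⟨t, ht⟩ : (S.p : ℤ) ∣ c - c % S.p := Int.dvd_self_sub_emod
    exact ⟨n - t, by rw [mul_sub, ← ht]; ring⟩
  obtain ⟨D, hD⟩ : ∃ D : ℤ, D = S.p * (N + 1) := ⟨_, rfl⟩
  have hDN : N + S.p ≤ D := by rw [hD]; nlinarith [h.1]
  have hT' : |a| + D + 2 * S.p + S.K + S.kap ≤ T * (S.p : ℤ) := by rw [hD]; linarith
  have ha := abs_le.1 (le_refl |a|)
  -- The central block is `[e - D, e + D)`: both ends have phase 0, and it consists of `2 * (N + 1)`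
  -- whole periods.
  obtain ⟨Nl, hNl⟩ := Int.eq_ofNat_of_zero_le (show 0 ≤ D - e by omega)
  obtain ⟨Nr, hNr⟩ := Int.eq_ofNat_of_zero_le (show 0 ≤ e + D - 1 by omega)
  refine ⟨T + t₀, Nl, Nr, 2 * (N + 1), by omega, by omega, ?_⟩
  rw [← hy]
  refine ⟨?_, ?_, ?_⟩
  · rw [block_eq_seg, seg_zeros hS hp]
    refine seg_congr (by push_cast; rw [← hNl, ← hNr, hD]; ring) fun k h5 h6 => ?_
    rw [hc' (-(N + 1)) k (by omega) (by omega)]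
    congr 1
    rw [← hNl, hD]; ring
  · have hI : (-((Nl : ℤ) + 1)) + 1 = e + S.p * (-(N + 1)) := by
      rw [show e + S.p * (-(N + 1)) = e - S.p * ((N : ℤ) + 1) by ring, ← hD]; omega
    obtain ⟨A, hA⟩ := h4.left.1
    obtain ⟨k, hk1, hk2, rs, hk3⟩ := LF.leftRepLang h4.mem hA ((-((Nl : ℤ) + 1)) + 1 - A).toNat
      (-((Nl : ℤ) + 1) + 1) (by omega)
      (h4.left.extend (h4.mid.mono le_rfl (by omega)) (by omega)) (h4.mid.mono (by omega) (by omega))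
      (fun k h5 h6 => by rw [hI]; exact hc' _ k (by omega) (by omega))
    refine ⟨k, hk1, fun l hl => ?_, ?_⟩
    · rw [hk2 l (by omega), hS]; congr 1; ring
    · rw [block_eq_seg, mem_left hS hp]; exact ⟨rs, hk3⟩
  · have hI : (Nr : ℤ) + 1 = e + S.p * (N + 1) := by rw [← hD]; omega
    obtain ⟨A, hA⟩ := h4.right.1
    obtain ⟨k, hk1, hk2, rs, hk3⟩ := RF.rightLangRep h4.mem hA (A - ((Nr : ℤ) + 1)).toNat
      (Nr + 1) (by omega)
      (h4.right.extend (h4.mid.mono (by omega) le_rfl)) (h4.mid.mono (by omega) (by omega))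
      (fun k h5 h6 => by rw [hI]; exact hc' _ k (by omega) (by omega))
    refine ⟨k, hk1, ?_, fun l hl => ?_⟩
    · rw [block_eq_seg, sub_add_cancel, mem_right hS hp]; exact ⟨rs, hk3⟩
    · rw [hk2 l hl, hS]

theorem gliders [TopologicalSpace B] {X : Subshift B ℤ} (hX : X.carrier = S.X) :
    IsSynchronizing X z ∧ IsDeterministic X z ∧
    ∃ G : X.carrier → X.carrier, IsReversibleCA G ∧
    ∃ gl gr : List B,
      gl ∈ lang X.carrier ∧ gr ∈ lang X.carrier ∧
      leftGliderLang z gl ≤ lang X.carrier ∧ rightGliderLang z gr ≤ lang X.carrier ∧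
      fleetSet z hz (leftGliderLang z gl) ⊆ X.carrier ∧
      fleetSet z hz (rightGliderLang z gr) ⊆ X.carrier ∧
      (∀ x ∈ fleetSet z hz (leftGliderLang z gl) ∪ fleetSet z hz (rightGliderLang z gr),
        (occ x gl).Finite ∧ (occ x gr).Finite) ∧
      ∃ s : ℕ, 0 < s ∧ z.length ∣ s ∧
        (∀ x : X.carrier, x.1 ∈ fleetSet z hz (leftGliderLang z gl) →
          (G x).1 = shift (s : ℤ) x.1) ∧
        (∀ x : X.carrier, x.1 ∈ fleetSet z hz (rightGliderLang z gr) →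
          (G x).1 = shift (-(s : ℤ)) x.1) ∧
        ∀ x : X.carrier, IsFiniteConf z hz x.1 → ∀ N : ℕ,
          ∃ t Nl Nr M : ℕ, N ≤ Nl ∧ N ≤ Nr ∧
            block (G^[t] x).1 (-(Nl : ℤ)) Nr = (List.replicate M z).flatten ∧
            LeftRepLang z hz (leftGliderLang z gl) (G^[t] x).1 (-((Nl : ℤ) + 1)) ∧
            RightLangRep z hz (rightGliderLang z gr) (G^[t] x).1 ((Nr : ℤ) + 1) := by
  have h := S.toGliderBase.par
  have hQ : ¬ S.Z (S.Q 0) := fun ⟨a, ha⟩ => S.Q_first a ha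
  have hP : ¬ S.Z (S.P 0) := fun ⟨a, ha⟩ => S.P_first a ha
  have hocc : ∀ {L : Language B} {x : ℤ → B}, x ∈ fleetSet z hz L →
      (occ x S.gl).Finite ∧ (occ x S.gr).Finite := fun hx =>
    ⟨occ_finite hS hx (by omega) (by omega) hQ, occ_finite hS hx le_rfl (by omega) hP⟩
  refine ⟨isSynchronizing hX (seg_one hS hp), isDeterministic hX (seg_one hS hp), S.ca hX,
    S.ca_isReversibleCA hX, S.gl, S.gr, hX.symm ▸ seg_mem_lang S.Q_mem _ _,
    hX.symm ▸ seg_mem_lang S.P_mem _ _, hX.symm ▸ lang_le hS (fleet_left_mem hS hp),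
    hX.symm ▸ lang_le hS (fleet_right_mem hS hp), hX.symm ▸ fleet_left_mem hS hp,
    hX.symm ▸ fleet_right_mem hS hp, fun x hx => hx.elim hocc hocc, S.p, S.hp, hp.dvd,
    fun x hx => G_fleet_left hS hp hx, fun x hx => G_fleet_right hS hp hx, fun x hx N => ?_⟩
  simp_rw [ca_iterate]
  exact decompose hS hp (hX.le x.2) hx N

end GliderSys

end GliderCA

/-! ### Recoding a periodic point into numbered zeros. -/

namespace GliderCA

/-- If `g` is determined by `f` on `s` and `f` takes finitely many values then so does `g`. -/
lemma finite_image_of_factor {α β γ : Type*} {s : Set α} {f : α → β} {g : α → γ}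
    (hf : (f '' s).Finite) (h : ∀ x ∈ s, ∀ y ∈ s, f x = f y → g x = g y) : (g '' s).Finite := by
  classical
  rcases s.eq_empty_or_nonempty with rfl | ⟨x₀, hx₀⟩
  · simp
  let c : β → α := fun b => if hb : ∃ x ∈ s, f x = b then hb.choose else x₀
  refine (hf.image (g ∘ c)).subset ?_
  rintro _ ⟨x, hx, rfl⟩
  refine ⟨f x, ⟨x, hx, rfl⟩, ?_⟩
  have hb : ∃ y ∈ s, f y = f x := ⟨x, hx, rfl⟩
  simp only [Function.comp, c, dif_pos hb]
  exact h _ hb.choose_spec.1 _ hx hb.choose_spec.2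

/-- A subshift with a distinguished periodic point `per` of least period `p`, such that all words
of length `2 * n` occurring in it are synchronizing. -/
structure PerSys (A : Type*) where
  Y : Set (ℤ → A)
  per : ℤ → A
  p : ℕ
  n : ℤ
  q : ℕ
  e : A ≃ Fin q
  hp : 0 < p
  hn : p ≤ n
  periodic : ∀ a b : ℤ, (p : ℤ) ∣ a - b → per a = per b
  minimal : ∀ d : ℤ, (∀ k, per (k + d) = per k) → (p : ℤ) ∣ d
  shift_mem : ∀ y ∈ Y, ∀ c, shf y c ∈ Y
  closed : ∀ y : ℤ → A, (∀ N : ℕ, ∃ y' ∈ Y, ∀ k : ℤ, -N ≤ k → k ≤ N → y' k = y k) → y ∈ Y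
  per_mem : per ∈ Y
  sync : ∀ y ∈ Y, ∀ y' ∈ Y, ∀ c : ℤ, (∀ k, c - n ≤ k → k < c + n → y k = per (k - c)) →
    (∀ k, c - n ≤ k → k < c + n → y' k = per (k - c)) → glue y y' c ∈ Y
  fol_finite : (Fol Y '' Y).Finite

namespace PerSys

variable {A : Type*} (S : PerSys A)

/-- A long stretch of the periodic point occurs around `[a, a + p)`. -/
def Blk (y : ℤ → A) (a : ℤ) : Prop := ∀ k, -S.n ≤ k → k < S.p + S.n → y (a + k) = S.per k

/-- The position `i` lies in a block of the periodic point starting at `a`. -/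
def Cov (y : ℤ → A) (i a : ℤ) : Prop := a ≤ i ∧ i < a + S.p ∧ S.Blk y a

variable {S}

lemma pp : (0 : ℤ) < S.p ∧ (S.p : ℤ) ≤ S.n := ⟨by exact_mod_cast S.hp, S.hn⟩

instance : NeZero S.p := ⟨S.hp.ne'⟩

/-- Since `n ≥ p`, the two stretches overlap in at least a full period, so the shift by `b - a`
fixes the periodic point; minimality of the period concludes. Hence no position lies in two blocks.
-/
lemma Blk.dvd {y : ℤ → A} {a b : ℤ} (ha : S.Blk y a) (hb : S.Blk y b) (h : a ≤ b)
    (h' : b ≤ a + S.p) : (S.p : ℤ) ∣ b - a := by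
  have hp := S.pp
  refine S.minimal _ fun m => ?_
  have h1 := Int.emod_nonneg (m + S.n) hp.1.ne'
  have h2 := Int.emod_lt_of_pos (m + S.n) hp.1
  obtain ⟨t, ht⟩ : (S.p : ℤ) ∣ m + S.n - (m + S.n) % S.p := Int.dvd_self_sub_emod
  set r := (m + S.n) % S.p
  have e1 := ha (b - a - S.n + r) (by omega) (by omega)
  have e2 := hb (-S.n + r) (by omega) (by omega)
  rw [show b + (-S.n + r) = a + (b - a - S.n + r) by ring, e1] at e2
  rw [S.periodic (m + (b - a)) (b - a - S.n + r) ⟨t, by rw [← ht]; ring⟩, e2]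
  exact S.periodic _ _ ⟨-t, by rw [mul_neg, ← ht]; ring⟩

lemma Blk.congr {y y' : ℤ → A} {a : ℤ} (h : S.Blk y a)
    (h1 : ∀ k, a - S.n ≤ k → k < a + S.p + S.n → y' k = y k) : S.Blk y' a :=
  fun k hk hk' => by rw [h1 _ (by omega) (by omega), h k hk hk']

lemma Cov.unique {y : ℤ → A} {i a b : ℤ} (ha : S.Cov y i a) (hb : S.Cov y i b) : a = b := by
  wlog h : a ≤ b generalizing a b
  · exact (this hb ha (by omega)).symm
  obtain ⟨h1, h2, h3⟩ := ha
  obtain ⟨h4, h5, h6⟩ := hb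
  have := Int.eq_zero_of_abs_lt_dvd (h3.dvd h6 h (by omega)) (by rw [abs_lt]; omega)
  omega

lemma Blk.shf_iff {y : ℤ → A} {a c : ℤ} : S.Blk (shf y c) a ↔ S.Blk y (a + c) := by
  constructor <;> intro h k hk hk' <;> have := h k hk hk' <;>
    simpa only [shf_apply, add_right_comm] using this

lemma Cov.shf_iff {y : ℤ → A} {i a c : ℤ} : S.Cov (shf y c) i a ↔ S.Cov y (i + c) (a + c) := by
  unfold Cov
  rw [Blk.shf_iff]
  constructor <;> rintro ⟨h1, h2, h3⟩ <;> exact ⟨by omega, by omega, h3⟩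

variable (S)

/-- The alphabet of the recoded subshift. -/
abbrev Alph : Type := Fin S.q ⊕ ZMod S.p

open Classical in
/-- Replace the letters in blocks of the periodic point by numbered zeros. -/
noncomputable def psi (y : ℤ → A) (i : ℤ) : S.Alph :=
  if h : ∃ a, S.Cov y i a then Sum.inr ((i - h.choose : ℤ) : ZMod S.p) else Sum.inl (S.e (y i))

/-- The inverse of `psi`. -/
def phi (x : ℤ → S.Alph) (i : ℤ) : A := Sum.elim S.e.symm (fun r => S.per r.val) (x i)

/-- The zero point of the recoded subshift. -/
def zero (k : ℤ) : S.Alph := Sum.inr (k : ZMod S.p)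

variable {S} {y y' : ℤ → A} {i a b : ℤ}

lemma zero_eq : S.zero a = S.zero b ↔ (S.p : ℤ) ∣ a - b := by
  rw [zero, zero, Sum.inr.injEq, eq_comm, ZMod.intCast_eq_intCast_iff_dvd_sub]

lemma psi_cov (h : S.Cov y i a) : S.psi y i = S.zero (i - a) := by
  have hex : ∃ a, S.Cov y i a := ⟨a, h⟩
  rw [psi, dif_pos hex, hex.choose_spec.unique h, zero]

lemma psi_not (h : ∀ a, ¬ S.Cov y i a) : S.psi y i = Sum.inl (S.e (y i)) :=
  dif_neg fun ⟨a, ha⟩ => h a ha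

lemma cov_of_psi (h : S.psi y i = S.zero b) : ∃ a, S.Cov y i a ∧ (S.p : ℤ) ∣ i - a - b := by
  by_cases hex : ∃ a, S.Cov y i a
  · obtain ⟨a, ha⟩ := hex
    rw [psi_cov ha, zero_eq] at h
    exact ⟨a, ha, h⟩
  · push Not at hex
    rw [psi_not hex, zero] at h
    cases h

lemma psi_congr {j : ℤ} (h : ∀ a, S.Cov y i a ↔ S.Cov y' j (a + (j - i))) (h1 : y i = y' j) :
    S.psi y i = S.psi y' j := by
  by_cases hex : ∃ a, S.Cov y i a
  · obtain ⟨a, ha⟩ := hex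
    rw [psi_cov ha, psi_cov ((h a).1 ha)]
    congr 1; ring
  · push Not at hex
    rw [psi_not hex, psi_not fun a ha => hex (a - (j - i)) ((h _).2 (by rwa [sub_add_cancel])), h1]

lemma psi_shf (c : ℤ) : S.psi (shf y c) = shf (S.psi y) c := by
  funext i
  refine psi_congr (fun a => ?_) rfl
  rw [Cov.shf_iff, add_sub_cancel_left]

lemma cov_loc (h : ∀ k, i - S.p - S.n ≤ k → k ≤ i + S.p + S.n → y' k = y k) :
    S.Cov y i a ↔ S.Cov y' i a :=
  ⟨fun ⟨h1, h2, h3⟩ => ⟨h1, h2, h3.congr fun k _ _ => h k (by omega) (by omega)⟩,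
    fun ⟨h1, h2, h3⟩ => ⟨h1, h2, h3.congr fun k _ _ => (h k (by omega) (by omega)).symm⟩⟩

lemma psi_loc (h : ∀ k, i - S.p - S.n ≤ k → k ≤ i + S.p + S.n → y' k = y k) :
    S.psi y i = S.psi y' i := by
  have hp := S.pp
  refine psi_congr (fun a => ?_) (h i (by omega) (by omega)).symm
  rw [sub_self, add_zero, cov_loc h]

lemma phi_psi (y : ℤ → A) : S.phi (S.psi y) = y := by
  have hp := S.pp
  funext i
  unfold phi
  by_cases hex : ∃ a, S.Cov y i a
  · obtain ⟨a, ha⟩ := hex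
    rw [psi_cov ha, zero, Sum.elim_inr, ZMod.val_intCast]
    obtain ⟨h1, h2, h3⟩ := ha
    have := h3 (i - a) (by omega) (by omega)
    rw [add_sub_cancel] at this
    rw [this]
    exact S.periodic _ _ ((dvd_neg.2 Int.dvd_self_sub_emod).trans (by rw [neg_sub]))
  · push Not at hex
    rw [psi_not hex, Sum.elim_inl, Equiv.symm_apply_apply]

lemma phi_shf (x : ℤ → S.Alph) (c : ℤ) : S.phi (shf x c) = shf (S.phi x) c := rfl

lemma phi_congr {x x' : ℤ → S.Alph} (h : x i = x' i) : S.phi x i = S.phi x' i := by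
  unfold phi; rw [h]

lemma blk_per (h : (S.p : ℤ) ∣ a) : S.Blk S.per a := fun k _ _ =>
  S.periodic _ _ (by rwa [add_sub_cancel_right])

lemma psi_per : S.psi S.per = S.zero := by
  have hp := S.pp
  funext i
  have h1 := Int.emod_nonneg i hp.1.ne'
  have h2 := Int.emod_lt_of_pos i hp.1
  have h3 : (S.p : ℤ) ∣ i - i % S.p := Int.dvd_self_sub_emod
  rw [psi_cov (a := i - i % S.p) ⟨by omega, by omega, blk_per h3⟩, zero_eq]
  rw [show i - (i - i % S.p) - i = -(i - i % S.p) by ring]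
  exact (dvd_neg.2 h3)

variable (S)

/-- The recoded subshift. -/
def X : Set (ℤ → S.Alph) := {x | S.phi x ∈ S.Y ∧ S.psi (S.phi x) = x}

variable {S}

lemma psi_mem (h : y ∈ S.Y) : S.psi y ∈ S.X := by
  constructor <;> rw [phi_psi]
  exact h

lemma exists_psi {x : ℤ → S.Alph} (hx : x ∈ S.X) : ∃ y ∈ S.Y, S.psi y = x := ⟨_, hx.1, hx.2⟩

lemma X_closed (x : ℤ → S.Alph)
    (h : ∀ N : ℕ, ∃ x' ∈ S.X, ∀ k : ℤ, -N ≤ k → k ≤ N → x' k = x k) : x ∈ S.X := by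
  have hp := S.pp
  constructor
  · refine S.closed _ fun N => ?_
    obtain ⟨x', hx', h1⟩ := h N
    exact ⟨_, hx'.1, fun k h2 h3 => phi_congr (h1 k h2 h3)⟩
  · funext i
    obtain ⟨x', hx', h1⟩ := h (|i| + S.p + S.n).toNat
    have hi := abs_le.1 (le_refl |i|)
    rw [← h1 i (by omega) (by omega), ← hx'.2]
    exact psi_loc fun k h2 h3 => phi_congr (h1 k (by omega) (by omega))

/-- No block straddles `c` because one ends there, and both configurations agree within `n` of `c`,
so every block sees its whole context on its own side. -/
lemma psi_glue {c : ℤ} (h : S.Blk y (c - S.p)) (h' : S.Blk y' (c - S.p)) :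
    S.psi (glue y y' c) = glue (S.psi y) (S.psi y') c := by
  have hp := S.pp
  have hyy : ∀ k, c - S.p - S.n ≤ k → k < c + S.n → y k = y' k := fun k h1 h2 => by
    have e1 := h (k - (c - S.p)) (by omega) (by omega)
    have e2 := h' (k - (c - S.p)) (by omega) (by omega)
    rw [add_sub_cancel] at e1 e2
    rw [e1, e2]
  have hg1 : ∀ k < c + S.n, glue y y' c k = y k := fun k hk => by
    rcases lt_or_ge k c with h1 | h1
    · exact glue_lt h1
    · rw [glue_ge h1, hyy k (by omega) hk]
  have hg2 : ∀ k ≥ c - S.p - S.n, glue y y' c k = y' k := fun k hk => by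
    rcases lt_or_ge k c with h1 | h1
    · rw [glue_lt h1, hyy k hk (by omega)]
    · exact glue_ge h1
  have hgb : S.Blk (glue y y' c) (c - S.p) := h.congr fun k _ _ => hg1 k (by omega)
  funext k
  rcases lt_or_ge k c with hk | hk
  · rw [glue_lt hk]
    refine psi_congr (fun a => ?_) (hg1 k (by omega))
    rw [sub_self, add_zero]
    have key : ∀ w, S.Blk w (c - S.p) → S.Cov w k a → a ≤ c - S.p := by
      intro w hw ⟨h1, h2, h3⟩
      by_contra hc
      have := Int.eq_zero_of_abs_lt_dvd (hw.dvd h3 (by omega) (by omega)) (by rw [abs_lt]; omega)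
      omega
    constructor <;> intro hC
    · have := key _ hgb hC
      exact ⟨hC.1, hC.2.1, hC.2.2.congr fun k _ _ => (hg1 k (by omega)).symm⟩
    · have := key _ h hC
      exact ⟨hC.1, hC.2.1, hC.2.2.congr fun k _ _ => hg1 k (by omega)⟩
  · rw [glue_ge hk]
    refine psi_congr (fun a => ?_) (hg2 k (by omega))
    rw [sub_self, add_zero]
    constructor <;> rintro ⟨h1, h2, h3⟩
    · exact ⟨h1, h2, h3.congr fun k _ _ => (hg2 k (by omega)).symm⟩
    · exact ⟨h1, h2, h3.congr fun k _ _ => hg2 k (by omega)⟩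

lemma blk_of_zero {c : ℤ} (h : S.psi y (c - 1) = S.zero (-1)) : S.Blk y (c - S.p) := by
  obtain ⟨a, ⟨h1, h2, h3⟩, t, ht⟩ := cov_of_psi h
  have hp := S.pp
  obtain ⟨s, hs⟩ : ∃ s : ℤ, c - a - S.p = S.p * s := ⟨t - 1, by rw [mul_sub, ← ht]; ring⟩
  have := Int.eq_zero_of_abs_lt_dvd (⟨s, hs⟩ : (S.p : ℤ) ∣ c - a - S.p) (by rw [abs_lt]; omega)
  rwa [show c - S.p = a by omega]

/-- The follower set is determined by three data with finitely many values: the follower set in `Y`,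
the last `2 * R` letters, and the last `R` code letters. The code letters are needed because coding
just left of the origin also reads letters right of it. -/
lemma X_fol_finite [Finite A] : (Fol S.X '' S.X).Finite := by
  have hp := S.pp
  set R := S.p + S.n with hR
  have himg : Fol S.X '' S.X = (fun y => Fol S.X (S.psi y)) '' S.Y := by
    ext F
    constructor
    · rintro ⟨x, hx, rfl⟩
      obtain ⟨y, hy, rfl⟩ := exists_psi hx
      exact ⟨y, hy, rfl⟩
    · rintro ⟨y, hy, rfl⟩
      exact ⟨_, psi_mem hy, rfl⟩
  rw [himg]
  let f : (ℤ → A) → Set (ℤ → A) × (Set.Ico (-(2 * R)) 0 → A) × (Set.Ico (-R) 0 → S.Alph) :=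
    fun y => (Fol S.Y y, fun k => y k, fun k => S.psi y k)
  refine finite_image_of_factor (f := f) ?_ ?_
  · refine (S.fol_finite.prod (Set.finite_univ (α := (Set.Ico (-(2 * R)) 0 → A) ×
      (Set.Ico (-R) 0 → S.Alph)))).subset ?_
    rintro _ ⟨y, hy, rfl⟩
    exact ⟨⟨y, hy, rfl⟩, Set.mem_univ _⟩
  · suffices h : ∀ y ∈ S.Y, ∀ y' ∈ S.Y, f y = f y' → Fol S.X (S.psi y) ⊆ Fol S.X (S.psi y') from
      fun y hy y' hy' h1 => (h y hy y' hy' h1).antisymm (h y' hy' y hy h1.symm)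
    intro y hy y' hy' hf w hw
    simp only [f, Prod.mk.injEq] at hf
    obtain ⟨hf1, hf2, hf3⟩ := hf
    replace hf2 : ∀ k, -(2 * R) ≤ k → k < 0 → y k = y' k := fun k h1 h2 =>
      congrFun hf2 ⟨k, h1, h2⟩
    replace hf3 : ∀ k, -R ≤ k → k < 0 → S.psi y k = S.psi y' k := fun k h1 h2 =>
      congrFun hf3 ⟨k, h1, h2⟩
    obtain ⟨v, hv, hvw⟩ := exists_psi hw
    have h1 : ∀ k < 0, v k = y k := fun k hk => by
      have := congrFun hvw k
      rw [glue_lt hk] at this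
      rw [← phi_psi (S := S) v, ← phi_psi (S := S) y]
      exact phi_congr this
    have h2 : v ∈ Fol S.Y y := by
      change glue y v 0 ∈ S.Y
      convert hv using 1
      funext k
      rcases lt_or_ge k 0 with hk | hk
      · rw [glue_lt hk, h1 k hk]
      · rw [glue_ge hk]
    rw [hf1] at h2
    change glue (S.psi y') w 0 ∈ S.X
    convert psi_mem h2 using 1
    funext k
    have h3 : ∀ k ≥ -(2 * R), glue y' v 0 k = v k := fun k hk => by
      rcases lt_or_ge k 0 with h4 | h4
      · rw [glue_lt h4, h1 k h4, hf2 k hk h4]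
      · rw [glue_ge h4]
    have hvk := congrFun hvw k
    rcases lt_or_ge k 0 with hk | hk
    · rw [glue_lt hk] at hvk ⊢
      rcases lt_or_ge k (-R) with hk' | hk'
      · exact psi_loc fun l _ _ => glue_lt (by omega)
      · rw [← hf3 k hk' hk, ← hvk]
        exact psi_loc fun l _ _ => h3 l (by omega)
    · rw [glue_ge hk] at hvk ⊢
      rw [← hvk]
      exact psi_loc fun l _ _ => h3 l (by omega)

/-- If all letters are recoded to zeros then the configuration is periodic. -/
lemma periodic_of_cov (h : ∀ i, ∃ a, S.Cov y i a) : ∃ c, ∀ k, y k = S.per (k - c) := by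
  have hp := S.pp
  obtain ⟨c, -, -, hc⟩ := h 0
  refine ⟨c, fun k => ?_⟩
  have up : ∀ t : ℕ, S.Blk y (c + t * S.p) := by
    intro t
    induction t with
    | zero => simpa using hc
    | succ t ih =>
      obtain ⟨b, h1, h2, h3⟩ := h (c + t * S.p + S.p)
      have := Int.eq_zero_of_abs_lt_dvd (dvd_sub (ih.dvd h3 (by omega) (by omega)) dvd_rfl)
        (by rw [abs_lt]; omega)
      convert h3 using 1
      push_cast
      linarith
  have down : ∀ t : ℕ, S.Blk y (c - t * S.p) := by
    intro t
    induction t with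
    | zero => simpa using hc
    | succ t ih =>
      obtain ⟨b, h1, h2, h3⟩ := h (c - t * S.p - 1)
      have := Int.eq_zero_of_abs_lt_dvd (dvd_sub (h3.dvd ih (by omega) (by omega)) dvd_rfl)
        (by rw [abs_lt]; omega)
      convert h3 using 1
      push_cast
      linarith
  have h1 := Int.emod_nonneg (k - c) hp.1.ne'
  have h2 := Int.emod_lt_of_pos (k - c) hp.1
  obtain ⟨t, ht⟩ : (S.p : ℤ) ∣ k - c - (k - c) % S.p := Int.dvd_self_sub_emod
  set r := (k - c) % S.p
  have hb : S.Blk y (c + t * S.p) := by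
    rcases le_or_gt 0 t with h3 | h3
    · obtain ⟨s, rfl⟩ := Int.eq_ofNat_of_zero_le h3
      exact up s
    · obtain ⟨s, hs⟩ := Int.eq_ofNat_of_zero_le (show 0 ≤ -t by omega)
      have := down s
      rw [show t = -s by omega]
      convert this using 1; ring
  have := hb r (by omega) (by omega)
  rw [show c + t * S.p + r = k by linarith] at this
  rw [this]
  exact S.periodic _ _ ⟨-t, by rw [mul_neg, ← ht]; ring⟩

variable (S) in
/-- The recoded subshift satisfies the axioms of `ZeroSys`. -/
def toZeroSys [Finite A] (h : ∃ y ∈ S.Y, (∃ c A, ∀ k < A, y k = S.per (k - c)) ∧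
    (∃ c A, ∀ k ≥ A, y k = S.per (k - c)) ∧ ∃ i, ∀ a, ¬ S.Cov y i a) : ZeroSys S.Alph where
  X := S.X
  p := S.p
  z := S.zero
  hp := S.hp
  shift_mem := by
    intro x hx c
    refine ⟨S.shift_mem _ hx.1 c, ?_⟩
    rw [phi_shf, psi_shf, hx.2]
  closed := X_closed
  z_mem := psi_per (S := S) ▸ psi_mem S.per_mem
  z_eq _ _ := zero_eq
  det_succ := by
    rintro x hx k b h h1
    obtain ⟨y, hy, rfl⟩ := exists_psi hx
    obtain ⟨a, ⟨h2, h3, h4⟩, h5⟩ := cov_of_psi h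
    have h6 : k + 1 ≠ a + S.p := by
      rintro h6
      apply h1
      have := dvd_sub (dvd_refl (S.p : ℤ)) h5
      exact (congrArg (fun t : ℤ => (S.p : ℤ) ∣ t) (by linarith)).mpr this
    rw [psi_cov (a := a) ⟨by omega, by omega, h4⟩, zero_eq]
    exact (congrArg (fun t : ℤ => (S.p : ℤ) ∣ t) (by ring)).mpr h5
  det_pred := by
    rintro x hx k b h h1
    obtain ⟨y, hy, rfl⟩ := exists_psi hx
    obtain ⟨a, ⟨h2, h3, h4⟩, h5⟩ := cov_of_psi h
    have h6 : k ≠ a := by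
      rintro rfl
      rw [sub_self, zero_sub, dvd_neg] at h5
      exact h1 h5
    rw [psi_cov (a := a) ⟨by omega, by omega, h4⟩, zero_eq]
    exact (congrArg (fun t : ℤ => (S.p : ℤ) ∣ t) (by ring)).mpr h5
  sync := by
    intro x hx x' hx' i h1 h2
    have hp := S.pp
    obtain ⟨y, hy, rfl⟩ := exists_psi hx
    obtain ⟨y', hy', rfl⟩ := exists_psi hx'
    have e : i - 1 - i = -1 := by ring
    have b1 := blk_of_zero (e ▸ h1 (i - 1) (by omega) (by omega))
    have b2 := blk_of_zero (e ▸ h2 (i - 1) (by omega) (by omega))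
    rw [← psi_glue b1 b2]
    have key : ∀ w, S.Blk w (i - S.p) → ∀ k, i - S.n ≤ k → k < i + S.n →
        w k = S.per (k - i) := by
      intro w hw k h3 h4
      have := hw (k - (i - S.p)) (by omega) (by omega)
      rw [add_sub_cancel] at this
      rw [this]
      exact S.periodic _ _ ⟨1, by ring⟩
    exact psi_mem (S.sync y hy y' hy' i (key y b1) (key y' b2))
  fol_finite := X_fol_finite
  exists_nonzero := by
    have hp := S.pp
    obtain ⟨y, hy, ⟨c, A, h1⟩, ⟨c', A', h2⟩, i, h3⟩ := h
    have key : ∀ k c, (∀ l, k - S.p - S.n ≤ l → l ≤ k + S.p + S.n → y l = S.per (l - c)) →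
        ∃ a, S.psi y k = S.zero a := by
      intro k c h
      refine ⟨k - c, ?_⟩
      rw [psi_loc (y' := shf S.per (-c)) fun l h4 h5 => by rw [h l h4 h5, shf_apply]; rfl, psi_shf,
        shf_apply, psi_per, ← sub_eq_add_neg]
    refine ⟨_, psi_mem hy, ⟨A - S.p - S.n, fun k hk => key k c fun l _ _ => h1 l (by omega)⟩,
      ⟨A' + S.p + S.n, fun k hk => key k c' fun l _ _ => h2 l (by omega)⟩, i, fun a ha => ?_⟩
    obtain ⟨b, hb, -⟩ := cov_of_psi ha
    exact h3 b hb

end PerSys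

end GliderCA

/-! ### From the hypotheses on the subshift to the recoded system. -/

namespace GliderCA

section subshift

variable {A : Type*} {Y : Set (ℤ → A)} (hY : ∀ y ∈ Y, ∀ c, shf y c ∈ Y)
  (hY' : ∀ y : ℤ → A, (∀ N : ℕ, ∃ y' ∈ Y, ∀ k : ℤ, -N ≤ k → k ≤ N → y' k = y k) → y ∈ Y)

lemma Subshift.shf_mem [TopologicalSpace A] (Y : Subshift A ℤ) :
    ∀ y ∈ Y.carrier, ∀ c, shf y c ∈ Y.carrier := fun y hy c => by
  convert Y.mapsTo c hy using 1
  funext k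
  rw [shf_apply, SymbolicDynamics.FullShift.shift_apply, add_comm]

lemma Subshift.mem_of_approx [TopologicalSpace A] (Y : Subshift A ℤ) (y : ℤ → A)
    (h : ∀ N : ℕ, ∃ y' ∈ Y.carrier, ∀ k : ℤ, -N ≤ k → k ≤ N → y' k = y k) : y ∈ Y.carrier := by
  by_contra hy
  obtain ⟨I, u, h1, h2⟩ := isOpen_pi_iff.1 Y.isClosed.isOpen_compl y hy
  obtain ⟨y', hy', h3⟩ := h (I.sup Int.natAbs)
  refine h2 (fun a ha => ?_) hy'
  have : a.natAbs ≤ I.sup Int.natAbs := Finset.le_sup (f := Int.natAbs) ha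
  rw [h3 a (by omega) (by omega)]
  exact (h1 a ha).2

include hY

lemma exists_of_seg_mem {y : ℤ → A} {a b : ℤ} (h : seg y a b ∈ lang Y) :
    ∃ x ∈ Y, ∀ k, a ≤ k → k < b → x k = y k := by
  obtain ⟨x, hx, h⟩ := (mem_lang hY).1 h
  refine ⟨_, hY x hx (-a), fun k h1 h2 => ?_⟩
  rw [seg_length] at h
  rw [shf_apply, eq_of_seg_eq (by omega) h (by omega) (by omega)]
  congr 1; ring

include hY'

/-- By closedness, only finite suffixes of the left half and finite prefixes of the right half
matter. The condition depends on the set of left quotients alone, not on their order. -/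
lemma mem_fol_iff {y w : ℤ → A} : w ∈ Fol Y y ↔
    ∀ Q ∈ Set.range fun N : ℕ => (lang Y).leftQuotient (seg y (-N) 0), ∀ M : ℕ, seg w 0 M ∈ Q := by
  have e : ∀ N M : ℕ, seg y (-N) 0 ++ seg w 0 M = seg (glue y w 0) (-N) M := fun N M => by
    rw [← seg_append (glue y w 0) (b := 0) (by omega) (by omega)]
    congr 1
    · exact seg_congr rfl fun k _ h => by rw [glue_lt (by omega)]; congr 1; ring
  constructor
  · rintro h _ ⟨N, rfl⟩ M
    rw [Language.mem_leftQuotient, e]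
    exact seg_mem_lang (X := Y) (x := glue y w 0) h _ _
  · intro h
    refine hY' _ fun N => ?_
    have h1 := h _ ⟨N, rfl⟩ (N + 1)
    rw [Language.mem_leftQuotient, e] at h1
    obtain ⟨x, hx, h2⟩ := exists_of_seg_mem hY h1
    exact ⟨x, hx, fun k h3 h4 => h2 k h3 (by push_cast; omega)⟩

/-- Myhill–Nerode: a regular language has finitely many left quotients, hence finitely many sets of
them. -/
lemma fol_finite (h : (lang Y).IsRegular) : (Fol Y '' Y).Finite := by
  refine finite_image_of_factor
    (f := fun y => Set.range fun N : ℕ => (lang Y).leftQuotient (seg y (-N) 0)) ?_ ?_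
  · refine h.finite_range_leftQuotient.finite_subsets.subset ?_
    rintro _ ⟨y, -, rfl⟩
    rintro _ ⟨N, rfl⟩
    exact ⟨_, rfl⟩
  · intro y _ y' _ h1
    ext w
    rw [mem_fol_iff hY hY', mem_fol_iff hY hY', h1]

lemma glue_mem_of_sync {per : ℤ → A} {i b n : ℤ} (hib : i ≤ b) (hi : -n ≤ i) (hb : b ≤ n)
    (hw : ∀ u ∈ lang Y, ∀ v ∈ lang Y, u ++ seg per i b ∈ lang Y → seg per i b ++ v ∈ lang Y →
      u ++ seg per i b ++ v ∈ lang Y) {y y' : ℤ → A} (hy : y ∈ Y) (hy' : y' ∈ Y) (c : ℤ)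
    (h : ∀ k, c - n ≤ k → k < c + n → y k = per (k - c))
    (h' : ∀ k, c - n ≤ k → k < c + n → y' k = per (k - c)) : glue y y' c ∈ Y := by
  refine hY' _ fun N => ?_
  obtain ⟨T, hT⟩ : ∃ T : ℤ, T = N + |c| + n + 1 := ⟨_, rfl⟩
  have hc := abs_le.1 (le_refl |c|)
  have e1 : seg per i b = seg y (c + i) (c + b) :=
    (seg_congr (by ring) fun k h1 h2 => by rw [h _ (by omega) (by omega)]; congr 1; ring).symm
  have e2 : seg per i b = seg y' (c + i) (c + b) :=
    (seg_congr (by ring) fun k h1 h2 => by rw [h' _ (by omega) (by omega)]; congr 1; ring).symm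
  have h1 := hw (seg y (-T) (c + i)) (seg_mem_lang hy _ _) (seg y' (c + b) T)
    (seg_mem_lang hy' _ _)
    (by rw [e1, seg_append _ (by omega) (by omega)]; exact seg_mem_lang hy _ _)
    (by rw [e2, seg_append _ (by omega) (by omega)]; exact seg_mem_lang hy' _ _)
  have e3 : seg y (-T) (c + i) ++ seg per i b ++ seg y' (c + b) T = seg (glue y y' c) (-T) T := by
    rw [e1, seg_append _ (by omega) (by omega),
      ← seg_append (glue y y' c) (b := c + b) (by omega) (by omega)]
    congr 1
    · refine seg_congr rfl fun k h2 h3 => ?_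
      rw [sub_self, add_zero]
      rcases lt_or_ge k c with h4 | h4
      · rw [glue_lt h4]
      · rw [glue_ge h4, h k (by omega) (by omega), h' k (by omega) (by omega)]
    · refine seg_congr rfl fun k h2 h3 => ?_
      rw [sub_self, add_zero]
      rcases lt_or_ge k c with h4 | h4
      · rw [glue_lt h4, h k (by omega) (by omega), h' k (by omega) (by omega)]
      · rw [glue_ge h4]
  rw [e3] at h1
  obtain ⟨x, hx, h2⟩ := exists_of_seg_mem hY h1
  exact ⟨x, hx, fun k h3 h4 => h2 k (by omega) (by omega)⟩

end subshift

namespace PerSys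

variable {A : Type*} {S : PerSys A}

/-- Were every position always covered, each point would be one of the finitely many translates of
the periodic point. -/
lemma exists_not_cov (h : S.Y.Infinite) : ∃ y ∈ S.Y, ∃ i, ∀ a, ¬ S.Cov y i a := by
  have hp := S.pp
  by_contra hc
  push Not at hc
  refine h (((Set.finite_Ico (0 : ℤ) S.p).image fun c => shf S.per c).subset fun y hy => ?_)
  obtain ⟨c, hc⟩ := periodic_of_cov (hc y hy)
  refine ⟨(-c) % S.p, ⟨Int.emod_nonneg _ hp.1.ne', Int.emod_lt_of_pos _ hp.1⟩, ?_⟩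
  funext k
  change S.per (k + (-c) % S.p) = y k
  rw [hc]
  apply S.periodic
  obtain ⟨t, ht⟩ : (S.p : ℤ) ∣ -c - (-c) % S.p := Int.dvd_self_sub_emod
  exact ⟨-t, by rw [mul_neg, ← ht]; ring⟩

/-- Transitivity joins a stretch of the periodic point, an uncovered position with all letters
deciding its coverage, and another such stretch. Synchronization then replaces both outer sides by
periodic tails. -/
lemma exists_asymptotic (h : S.Y.Infinite) (ht : ∀ u ∈ lang S.Y, ∀ v ∈ lang S.Y,
      ∃ w ∈ lang S.Y, u ++ w ++ v ∈ lang S.Y) :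
    ∃ y ∈ S.Y, (∃ c A, ∀ k < A, y k = S.per (k - c)) ∧
      (∃ c A, ∀ k ≥ A, y k = S.per (k - c)) ∧ ∃ i, ∀ a, ¬ S.Cov y i a := by
  have hp := S.pp
  obtain ⟨y₁, hy₁, i, hi⟩ := exists_not_cov h
  obtain ⟨R, hR⟩ : ∃ R, R = S.p + S.n := ⟨_, rfl⟩
  obtain ⟨w₁, -, h1⟩ := ht _ (seg_mem_lang S.per_mem (-S.n) S.n) _
    (seg_mem_lang hy₁ (i - R) (i + R + 1))
  obtain ⟨w₂, -, h2⟩ := ht _ h1 _ (seg_mem_lang S.per_mem (-S.n) S.n)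
  obtain ⟨y, hy, h3⟩ := (mem_lang S.shift_mem).1 h2
  obtain ⟨c₄, h4, h4', -, h5, h6⟩ := seg_split h3 (by positivity)
  obtain ⟨c₃, h7, h7', -, h8, -⟩ := seg_split h5 h4
  obtain ⟨c₂, h9, h9', -, h10, h11⟩ := seg_split h8 h7
  obtain ⟨c₁, h12, h12', h13, h14, -⟩ := seg_split h10 h9
  have l1 := congrArg List.length h6
  have l2 := congrArg List.length h11
  rw [seg_length] at h13
  rw [seg_length, seg_length] at l1 l2
  have a1 : ∀ k, S.n - S.n ≤ k → k < S.n + S.n → y k = S.per (k - S.n) := fun k h15 h16 => by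
    rw [eq_of_seg_eq (by omega) h14 (by omega) (by omega)]; congr 1; ring
  have a2 : ∀ k, c₄ + S.n - S.n ≤ k → k < c₄ + S.n + S.n → y k = S.per (k - (c₄ + S.n)) :=
    fun k h15 h16 => by
      rw [eq_of_seg_eq (by omega) h6 (by omega) (by omega)]; congr 1; ring
  have m1 := S.sync _ (S.shift_mem _ S.per_mem (-S.n)) y hy S.n
    (fun k _ _ => by rw [shf_apply, sub_eq_add_neg]) a1
  have m2 := S.sync _ m1 _ (S.shift_mem _ S.per_mem (-(c₄ + S.n))) (c₄ + S.n)
    (fun k h15 h16 => by rw [glue_ge (by omega), a2 k h15 h16])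
    (fun k _ _ => by rw [shf_apply, sub_eq_add_neg])
  refine ⟨_, m2, ⟨S.n, S.n, fun k hk => ?_⟩, ⟨c₄ + S.n, c₄ + S.n, fun k hk => ?_⟩, c₂ + R,
    fun a ha => hi (a - (c₂ + R - i)) ?_⟩
  · rw [glue_lt (by omega), glue_lt hk, shf_apply, sub_eq_add_neg]
  · rw [glue_ge hk, shf_apply, sub_eq_add_neg]
  · rw [cov_loc (y' := shf y (c₂ + R - i)) fun k h15 h16 => ?_, Cov.shf_iff, add_sub_cancel,
      sub_add_cancel, cov_loc (y' := _) fun k h15 h16 => ?_]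
    · exact ha
    · rw [glue_lt (by omega), glue_ge (by omega)]
    · rw [shf_apply, eq_of_seg_eq (by omega) h11 (by omega) (by omega)]
      congr 1; ring

/-- The recoded subshift as a topological object. -/
def subshift (S : PerSys A) : Subshift S.Alph ℤ where
  carrier := S.X
  isClosed := by
    rw [← isOpen_compl_iff, isOpen_iff_forall_mem_open]
    intro x hx
    by_contra hc
    refine hx (X_closed x fun N => ?_)
    by_contra hN
    push Not at hN
    refine hc ⟨_, fun x' hx' hxX => ?_,
      SymbolicDynamics.FullShift.isOpen_cylinder (Finset.Icc (-(N : ℤ)) N) x, fun _ _ => rfl⟩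
    obtain ⟨k, h1, h2, h3⟩ := hN x' hxX
    exact h3 (hx' k (Finset.mem_Icc.2 ⟨h1, h2⟩))
  mapsTo c x hx := by
    have e : shift c x = shf x c := by
      funext k
      rw [shf_apply, SymbolicDynamics.FullShift.shift_apply, add_comm]
    rw [e]
    refine ⟨S.shift_mem _ hx.1 c, ?_⟩
    rw [phi_shf, psi_shf, hx.2]

/-- The word `012 ⋯ (p - 1)`. -/
def zeroWord (S : PerSys A) : List S.Alph := (List.range S.p).map fun i : ℕ => S.zero i

lemma zeroWord_length : S.zeroWord.length = S.p := by simp [zeroWord]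

lemma zeroWord_ne : S.zeroWord ≠ [] := List.ne_nil_of_length_pos (zeroWord_length (S := S) ▸ S.hp)

lemma zero_eq_perConf : S.zero = perConf S.zeroWord zeroWord_ne := by
  have hp := S.pp
  funext k
  simp only [perConf, zeroWord, List.getElem_map, List.getElem_range, List.length_map,
    List.length_range]
  rw [Int.toNat_of_nonneg (Int.emod_nonneg _ hp.1.ne'), zero_eq]
  exact Int.dvd_self_sub_emod

lemma psi_isConjugacy [TopologicalSpace A] {Y : Subshift A ℤ} (hY : Y.carrier = S.Y) :
    IsConjugacy (Y := S.subshift)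
      fun y : Y.carrier => (⟨S.psi y.1, psi_mem (hY.le y.2)⟩ : S.subshift.carrier) := by
  have hp := S.pp
  refine ⟨⟨-(S.p + S.n), S.p + S.n, by omega, fun w => S.psi (fun k =>
    if hk : k ∈ Set.Icc (-(S.p + S.n)) (S.p + S.n) then w ⟨k, hk⟩ else S.per 0) 0,
    fun y i => ?_⟩, fun y y' h => ?_, fun x => ?_⟩
  · have : S.psi y.1 i = S.psi (shf y.1 i) 0 := by rw [psi_shf, shf_apply, zero_add]
    change S.psi y.1 i = _
    rw [this]
    refine psi_loc fun k h1 h2 => ?_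
    rw [dif_pos (Set.mem_Icc.2 ⟨by omega, by omega⟩), shf_apply, add_comm k]
  · have h1 : S.psi y.1 = S.psi y'.1 := congrArg Subtype.val h
    exact Subtype.ext (by rw [← phi_psi (S := S) y.1, h1, phi_psi])
  · obtain ⟨y, hy, h⟩ := exists_psi x.2
    exact ⟨⟨y, hY.ge hy⟩, Subtype.ext h⟩

end PerSys

lemma shift_iterate {A : Type*} (x : ℤ → A) (m : ℕ) : (shift (1 : ℤ))^[m] x = shift (m : ℤ) x := by
  induction m with
  | zero => simp
  | succ m ih =>
    rw [Function.iterate_succ_apply', ih]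
    funext k
    simp only [SymbolicDynamics.FullShift.shift_apply]
    congr 1; push_cast; ring

lemma dvd_of_period {A : Type*} {x : ℤ → A} {d : ℤ} (h : ∀ k, x (k + d) = x k) :
    (Function.minimalPeriod (shift (1 : ℤ)) x : ℤ) ∣ d := by
  have key : ∀ m : ℕ, (∀ k, x (k + m) = x k) → Function.minimalPeriod (shift (1 : ℤ)) x ∣ m := by
    intro m hm
    refine Function.IsPeriodicPt.minimalPeriod_dvd ?_
    rw [Function.IsPeriodicPt, Function.IsFixedPt, shift_iterate]
    funext k
    rw [SymbolicDynamics.FullShift.shift_apply, add_comm, hm]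
  rcases le_or_gt 0 d with hd | hd
  · obtain ⟨m, rfl⟩ := Int.eq_ofNat_of_zero_le hd
    exact_mod_cast key m h
  · obtain ⟨m, hm⟩ := Int.eq_ofNat_of_zero_le (show 0 ≤ -d by omega)
    rw [← dvd_neg, hm]
    exact_mod_cast key m fun k => by
      rw [← hm, ← h (k + -d), neg_add_cancel_right]

lemma exists_perSys {A : Type*} [Finite A] [TopologicalSpace A] (Y : Subshift A ℤ)
    (hYsofic : IsSofic Y) (z₀ : List A) (hz₀ : z₀ ≠ []) (hz₀Y : perConf z₀ hz₀ ∈ Y.carrier)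
    (hz₀sync : ∃ i j : ℤ, IsSynchronizing Y (block (perConf z₀ hz₀) i j))
    (hz₀per : Function.minimalPeriod (shift (1 : ℤ)) (perConf z₀ hz₀) = z₀.length) :
    ∃ S : PerSys A, S.Y = Y.carrier ∧ S.per = perConf z₀ hz₀ ∧ S.p = z₀.length := by
  obtain ⟨i, j, hs⟩ := hz₀sync
  obtain ⟨q, ⟨e⟩⟩ := Finite.exists_equiv_fin A
  obtain ⟨b, hb, hib⟩ : ∃ b, block (perConf z₀ hz₀) i j = seg (perConf z₀ hz₀) i b ∧ i ≤ b := by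
    rw [block_eq_seg]
    rcases le_total i (j + 1) with h | h
    · exact ⟨_, rfl, h⟩
    -- The synchronizing word may be empty with `j + 1 < i`; its end is then moved to `i`.
    · exact ⟨i, by rw [seg_self, seg, Int.toNat_of_nonpos (by omega)]; rfl, le_rfl⟩
  rw [hb] at hs
  have hi := abs_le.1 (le_refl |i|)
  have hb' := abs_le.1 (le_refl |b|)
  refine ⟨{
    Y := Y.carrier
    per := perConf z₀ hz₀
    p := z₀.length
    -- Large enough for a stretch of radius `n` at phase 0 to contain the synchronizing word, and at
    -- least the period.
    n := |i| + |b| + z₀.length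
    q := q
    e := e
    hp := List.length_pos_iff.2 hz₀
    hn := by omega
    periodic := fun a b h => perConf_congr z₀ hz₀ h
    minimal := fun d h => hz₀per ▸ dvd_of_period h
    shift_mem := Subshift.shf_mem Y
    closed := Subshift.mem_of_approx Y
    per_mem := hz₀Y
    sync := fun y hy y' hy' c => glue_mem_of_sync (Subshift.shf_mem Y) (Subshift.mem_of_approx Y)
      hib (by omega) (by omega) hs.2 hy hy' c
    fol_finite := fol_finite (Subshift.shf_mem Y) (Subshift.mem_of_approx Y) hYsofic }, rfl, rfl,
    rfl⟩

end GliderCA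

open GliderCA in
theorem mainTheorem1 {A : Type*} [Finite A] [TopologicalSpace A] [DiscreteTopology A]
    (Y : Subshift A ℤ) (hYinf : Y.carrier.Infinite) (hYtrans : IsTransitive Y)
    (hYsofic : IsSofic Y) (z₀ : List A) (hz₀ : z₀ ≠ []) (hz₀Y : perConf z₀ hz₀ ∈ Y.carrier)
    (hz₀sync : ∃ i j : ℤ, IsSynchronizing Y (block (perConf z₀ hz₀) i j))
    (hz₀per : Function.minimalPeriod (shift (1 : ℤ)) (perConf z₀ hz₀) = z₀.length) :
    ∃ (B : Type) (_ : Finite B) (_ : TopologicalSpace B) (_ : DiscreteTopology B)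
      (X : Subshift B ℤ) (ψ : Y.carrier → X.carrier) (z : List B) (hz : z ≠ []),
      IsConjugacy ψ ∧ z.length = z₀.length ∧
      (ψ ⟨perConf z₀ hz₀, hz₀Y⟩).1 = perConf z hz ∧
      IsSynchronizing X z ∧ IsDeterministic X z ∧
      ∃ G : X.carrier → X.carrier, IsReversibleCA G ∧
      ∃ gl gr : List B,
        gl ∈ lang X.carrier ∧ gr ∈ lang X.carrier ∧
        leftGliderLang z gl ≤ lang X.carrier ∧ rightGliderLang z gr ≤ lang X.carrier ∧
        fleetSet z hz (leftGliderLang z gl) ⊆ X.carrier ∧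
        fleetSet z hz (rightGliderLang z gr) ⊆ X.carrier ∧
        (∀ x ∈ fleetSet z hz (leftGliderLang z gl) ∪ fleetSet z hz (rightGliderLang z gr),
          (occ x gl).Finite ∧ (occ x gr).Finite) ∧
        ∃ s : ℕ, 0 < s ∧ z.length ∣ s ∧
          (∀ x : X.carrier, x.1 ∈ fleetSet z hz (leftGliderLang z gl) →
            (G x).1 = shift (s : ℤ) x.1) ∧
          (∀ x : X.carrier, x.1 ∈ fleetSet z hz (rightGliderLang z gr) →
            (G x).1 = shift (-(s : ℤ)) x.1) ∧
          ∀ x : X.carrier, IsFiniteConf z hz x.1 → ∀ N : ℕ,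
            ∃ t Nl Nr M : ℕ, N ≤ Nl ∧ N ≤ Nr ∧
              block (G^[t] x).1 (-(Nl : ℤ)) Nr = (List.replicate M z).flatten ∧
              LeftRepLang z hz (leftGliderLang z gl) (G^[t] x).1 (-((Nl : ℤ) + 1)) ∧
              RightLangRep z hz (rightGliderLang z gr) (G^[t] x).1 ((Nr : ℤ) + 1) := by
  obtain ⟨S, hSY, hper, hp⟩ := exists_perSys Y hYsofic z₀ hz₀ hz₀Y hz₀sync hz₀per
  obtain ⟨T, hT⟩ := exists_gliderSys (S.toZeroSys (PerSys.exists_asymptotic (hSY ▸ hYinf)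
    (hSY ▸ hYtrans)))
  have hX : S.subshift.carrier = T.X := by rw [hT]; rfl
  have hz : T.z = perConf S.zeroWord PerSys.zeroWord_ne := by
    rw [hT, ← PerSys.zero_eq_perConf]; rfl
  have hTp : S.zeroWord.length = T.p := by rw [hT, PerSys.zeroWord_length]; rfl
  refine ⟨S.Alph, inferInstance, inferInstance, inferInstance, S.subshift,
    fun y => ⟨S.psi y.1, PerSys.psi_mem (hSY.ge y.2)⟩, S.zeroWord, PerSys.zeroWord_ne,
    PerSys.psi_isConjugacy hSY.symm, PerSys.zeroWord_length.trans hp, ?_, T.gliders hz hTp hX⟩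
  change S.psi (perConf z₀ hz₀) = _
  rw [← hper, PerSys.psi_per, PerSys.zero_eq_perConf]
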